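/- Let $(\cdot,\cdot)$ be the scalar product of signature $(n+1,1)$ on $\mathbb R^{n+2}$. The de Sitter space $S^{n+1}_1$ is the domain $(x,x)>0$ of $P^{n+1}=P(\mathbb R^{n+2})$, and its absolute $Q^n$ is the quadric $(x,x)=0$. Let $U^n$ be a smooth immersed lightlike hypersurface of $S^{n+1}_1$, i.e. all its tangent hyperplanes are tangent to $Q^n$. *Frames.* Over open parts of $U^n$ consider smooth frames $A_0,A_1,\dots,A_{n+1}$ such that $A_n=x$ is the point of $U^n$, the tangent hyperplane is $\eta=A_0\wedge A_1\wedge\dots\wedge A_n$, $(A_n,A_n)=1$, $(A_0,A_{n+1})=-1$, $g_{ij}=(A_i,A_j)$ is positive definite ($1\le i,j\le n-1$), and all other scalar products vanish. Put $dA_\xi=\omega_\xi^\eta A_\eta$; then $\omega_i^{n+1}=\nu_{ij}\omega_n^j$. Suppose that the rank of $(\nu_{ij})$ is everywhere $r<n-1$, and put $m=n-1-r\ge 1$. A frame is called adapted if, for indices $a=1,\dots,m$ and $p,q,s,t=m+1,\dots,n-1$, one has $g_{ap}=0$ and $\nu_{aj}=0$ for all $j$. The plane generator through $x$ is then $L=A_0\wedge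 A_1\wedge\dots\wedge A_m\wedge A_n$. *The objects.* In an adapted frame $\omega_p^\alpha=\lambda^\alpha_{pq}\,\omega_0^q$ with $\lambda^\alpha_{pq}=\lambda^\alpha_{qp}$, for $\alpha\in\{1,\dots,m,n\}$. Put $$a^\alpha_{pq}=\lambda^\alpha_{pq}-\tfrac1r\,(g^{st}\lambda^\alpha_{st})\,g_{pq},\qquad a^{\alpha\beta}=g^{pq}g^{st}a^\alpha_{ps}a^\beta_{qt},\qquad a^\alpha_\beta=g_{\beta\gamma}a^{\gamma\alpha},$$ where $(g^{pq})$ is the inverse of $(g_{pq})$ and $g_{\alpha\beta}=(A_\alpha,A_\beta)$. Let $A=(a^\alpha_{pq})$ be the matrix with rows $\alpha$ and columns $(p,q)$. Suppose that its rank $\rho$ is constant on $U^n$ and different from $0$. Let $a$ be the sum of the diagonal minors of order $\rho$ of $(a^\alpha_\beta)$. **Theorem.** Under these assumptions $U^n$ carries an invariant $r$-dimensional screen distribution $\Delta$, defined in the third-order neighborhood of each plane generator. Precisely: 1. Every point of $U^n$ has a neighborhood carrying an adapted frame. In every adapted frame $\lambda^\alpha_{pq}$ is defined and smooth, $a\neq0$,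 and there are smooth functions $\mu_p$ with $$\frac{da}{2\rho a}+\omega_0^0=\mu_p\,\omega_0^p .$$ The plane $\Delta_x=x\wedge\zeta$, where $\zeta$ is the span of the points $C_p=A_p+\mu_pA_0$, does not depend on the choice of the adapted frame. 2. $\Delta_x$ is an $r$-dimensional projective plane in $\eta$ passing through $x$, with $\Delta_x\cap L=\{x\}$, and $\Delta_x$ and $L$ together span $\eta$. The corresponding subspaces of the tangent space of the $n$-manifold $U^n$ at $x$ are complementary, the first of dimension $r$. The subspace $\zeta$ does not change when $x$ moves along a generator: $dC_p(v)\in\zeta$ for every $p$ and every $v$ tangent to $L$. 3. Let $T$ be a linear automorphism preserving $(\cdot,\cdot)$, and let $U'^n$ be another such hypersurface, with the same $r$ and $\rho$. Suppose that near $x'\in U'^n$ and $T(x)$ the hypersurfaces $U'^n$ and $T(U^n)$ have local parametrizations, by vectors with $(x,x)=1$, whose partial derivatives up to order $3$ coincide at all points, near $T(x)$, of the generator of $T(U^n)$ through $T(x)$. Then $\Delta'_{x'}=T(\Delta_x)$. In particular, $\Delta$ is invariant under the motions of $S^{n+1}_1$, does not depend on the parametrization, and is determined by the third-order neighborhood of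 the generator. -/

import Mathlib

open scoped Manifold ContDiff LinearAlgebra.Projectivization Topology

namespace DeSitter

noncomputable section

/-! ### The ambient space -/

/-- The vector space of homogeneous coordinates of the projective space `P^{n+1}`. -/
abbrev LVec (n : ℕ) : Type := Fin (n + 2) → ℝ

/-- The scalar product `(x, y)` of signature `(n+1, 1)`.  The absolute `Q^n` is `(x, x) = 0`, and the
de Sitter space `S^{n+1}_1` is the domain `(x, x) > 0` of the projective space `ℙ ℝ (LVec n)`. -/
def lform {n : ℕ} (x y : LVec n) : ℝ :=
  ∑ i : Fin (n + 1), x i.castSucc * y i.castSucc - x (Fin.last (n + 1)) * y (Fin.last (n + 1))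

/-- The differential, at a point of a smooth `n`-manifold, of a map to a normed space. -/
def dAt {n : ℕ} {N : Type*} [TopologicalSpace N] [ChartedSpace (EuclideanSpace ℝ (Fin n)) N]
    {E : Type*} [NormedAddCommGroup E] [NormedSpace ℝ E] (F : N → E) (q : N) :
    TangentSpace (𝓡 n) q →ₗ[ℝ] E :=
  (mfderiv (𝓡 n) 𝓘(ℝ, E) F q).toLinearMap

/-! ### Lightlike hypersurfaces -/

/-- `F` is a smooth representation, normalized by `(F, F) = 1`, of the map `f` on the set `W`. -/
structure IsUnitLift {n : ℕ} {N : Type*} [TopologicalSpace N]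
    [ChartedSpace (EuclideanSpace ℝ (Fin n)) N]
    (f : N → ℙ ℝ (LVec n)) (W : Set N) (F : N → LVec n) : Prop where
  smooth : ContMDiffOn (𝓡 n) 𝓘(ℝ, LVec n) ∞ F W
  unit : ∀ q ∈ W, lform (F q) (F q) = 1
  lift : ∀ q ∈ W, (f q).submodule = Submodule.span ℝ {F q}

/-- The tangent hyperplane `η` at `x = F q`, as a linear subspace of `LVec n`: the span of `x` and
of the values of `dx`. -/
def tangentHyperplane {n : ℕ} {N : Type*} [TopologicalSpace N]
    [ChartedSpace (EuclideanSpace ℝ (Fin n)) N] (F : N → LVec n) (q : N) :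
    Submodule ℝ (LVec n) :=
  Submodule.span ℝ {F q} ⊔ LinearMap.range (dAt (n := n) F q)

/-- A smooth (immersed) hypersurface `f : N → S^{n+1}_1` each of whose tangent hyperplanes is
tangent to the absolute, i.e. is polar-conjugate to a point `y` of the absolute. -/
def IsLightlikeHypersurface {n : ℕ} {N : Type*} [TopologicalSpace N]
    [ChartedSpace (EuclideanSpace ℝ (Fin n)) N] (f : N → ℙ ℝ (LVec n)) : Prop :=
  ∀ p : N, ∃ (W : Set N) (F : N → LVec n), IsOpen W ∧ p ∈ W ∧ IsUnitLift f W F ∧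
    ∀ q ∈ W, Function.Injective (dAt (n := n) F q) ∧
      ∃ y : LVec n, y ≠ 0 ∧ lform y y = 0 ∧ ∀ w ∈ tangentHyperplane (n := n) F q, lform y w = 0

/-! ### Moving frames

From here on `n = m + r + 1`.  The indices `i = 1, …, n - 1` are split into `a` (`m` values,
`Sum.inl a`) and `p` (`r` values, `Sum.inr p`). -/

/-- The indices `0`, `i`, `n`, `n + 1` of the vertices of a frame. -/
inductive FrameIdx (m r : ℕ) : Type
  | zero : FrameIdx m r
  | mid (i : Fin m ⊕ Fin r) : FrameIdx m r
  | pt : FrameIdx m r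
  | top : FrameIdx m r

/-- The index `α`, which runs through the `m` values of `a` (`some a`) and the value `n` (`none`). -/
def normalIdx {m r : ℕ} : Option (Fin m) → FrameIdx m r
  | none => FrameIdx.pt
  | some a => FrameIdx.mid (Sum.inl a)

/-- The matrix `g_{ij} = (e_i, e_j)`. -/
def gram {m r : ℕ} (e : FrameIdx m r → LVec (m + r + 1)) :
    Matrix (Fin m ⊕ Fin r) (Fin m ⊕ Fin r) ℝ :=
  Matrix.of fun i j => lform (e (.mid i)) (e (.mid j))

/-- The normalization of the scalar products of the elements of a conformal frame. -/
structure IsConformalBasis {m r : ℕ} (e : FrameIdx m r → LVec (m + r + 1)) : Prop where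
  zero_zero : lform (e .zero) (e .zero) = 0
  zero_mid : ∀ i, lform (e .zero) (e (.mid i)) = 0
  zero_pt : lform (e .zero) (e .pt) = 0
  zero_top : lform (e .zero) (e .top) = -1
  mid_pt : ∀ i, lform (e (.mid i)) (e .pt) = 0
  mid_top : ∀ i, lform (e (.mid i)) (e .top) = 0
  pt_pt : lform (e .pt) (e .pt) = 1
  pt_top : lform (e .pt) (e .top) = 0
  top_top : lform (e .top) (e .top) = 0
  posDef : (gram e).PosDef

/-- The coefficients of a vector `w` with respect to a conformal frame (see `sum_coeff`). -/
def coeff {m r : ℕ} (e : FrameIdx m r → LVec (m + r + 1)) (w : LVec (m + r + 1)) :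
    FrameIdx m r → ℝ
  | .zero => -lform w (e .top)
  | .mid i => ∑ j, (gram e)⁻¹ i j * lform w (e (.mid j))
  | .pt => lform w (e .pt)
  | .top => -lform w (e .zero)


theorem lform_add_left {n : ℕ} (x y z : LVec n) : lform (x + y) z = lform x z + lform y z := by
  simp only [lform, Pi.add_apply, add_mul, Finset.sum_add_distrib]; ring

theorem lform_smul_left {n : ℕ} (c : ℝ) (x z : LVec n) : lform (c • x) z = c * lform x z := by
  simp only [lform, Pi.smul_apply, smul_eq_mul, mul_sub, Finset.mul_sum, mul_assoc]

theorem lform_comm {n : ℕ} (x z : LVec n) : lform x z = lform z x := by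
  simp only [lform, mul_comm]

theorem lform_sum_left {n : ℕ} {κ : Type*} [Fintype κ] (c : κ → ℝ) (x : κ → LVec n) (z : LVec n) :
    lform (∑ j, c j • x j) z = ∑ j, c j * lform (x j) z := by
  have h : ∀ w, lform w z = (⟨⟨fun w => lform w z, fun a b => lform_add_left a b z⟩,
    fun a b => lform_smul_left a b z⟩ : LVec n →ₗ[ℝ] ℝ) w := fun _ => rfl
  rw [h, map_sum]
  simp only [map_smul, smul_eq_mul]
  rfl

/-- The numbers `coeff e w` are the coefficients in the decomposition of `w` with respect to `e`. -/
theorem sum_coeff {m r : ℕ} {e : FrameIdx m r → LVec (m + r + 1)} (he : IsConformalBasis e)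
    (w : LVec (m + r + 1)) :
    w = coeff e w .zero • e .zero + ∑ i, coeff e w (.mid i) • e (.mid i) +
      coeff e w .pt • e .pt + coeff e w .top • e .top := by
  let Ψ : (ℝ × (Fin m ⊕ Fin r → ℝ) × ℝ × ℝ) →ₗ[ℝ] LVec (m + r + 1) :=
    { toFun := fun c => c.1 • e .zero + ∑ i, c.2.1 i • e (.mid i) +
        c.2.2.1 • e .pt + c.2.2.2 • e .top
      map_add' := by
        intro a b
        simp only [Prod.fst_add, Prod.snd_add, Pi.add_apply, add_smul, Finset.sum_add_distrib]
        abel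
      map_smul' := by
        intro a b
        simp only [Prod.smul_fst, Prod.smul_snd, Pi.smul_apply, smul_eq_mul, mul_smul, smul_add,
          Finset.smul_sum, RingHom.id_apply] }
  have hΨ : ∀ c, Ψ c = c.1 • e .zero + ∑ i, c.2.1 i • e (.mid i) +
        c.2.2.1 • e .pt + c.2.2.2 • e .top := fun _ => rfl
  have hdet : IsUnit (gram e).det := he.posDef.isUnit.map Matrix.detMonoidHom
  have hc : ∀ c, coeff e (Ψ c) .zero = c.1 ∧ (∀ i, coeff e (Ψ c) (.mid i) = c.2.1 i) ∧
      coeff e (Ψ c) .pt = c.2.2.1 ∧ coeff e (Ψ c) .top = c.2.2.2 := by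
    intro c
    have e1 : lform (e .top) (e .zero) = -1 := by rw [lform_comm]; exact he.zero_top
    have e2 : lform (e .pt) (e .zero) = 0 := by rw [lform_comm]; exact he.zero_pt
    have e3 : ∀ i, lform (e (.mid i)) (e .zero) = 0 := fun i => by
      rw [lform_comm]; exact he.zero_mid i
    have e4 : lform (e .top) (e .pt) = 0 := by rw [lform_comm]; exact he.pt_top
    have e5 : ∀ i, lform (e .pt) (e (.mid i)) = 0 := fun i => by
      rw [lform_comm]; exact he.mid_pt i
    have e6 : ∀ i, lform (e .top) (e (.mid i)) = 0 := fun i => by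
      rw [lform_comm]; exact he.mid_top i
    refine ⟨?_, fun i => ?_, ?_, ?_⟩
    · simp [coeff, hΨ, lform_add_left, lform_smul_left, lform_sum_left, he.zero_top, he.mid_top,
        he.pt_top, he.top_top]
    · have hk : ∀ j, lform (Ψ c) (e (.mid j)) = ((gram e).mulVec c.2.1) j := by
        intro j
        simp only [hΨ, lform_add_left, lform_smul_left, lform_sum_left, he.zero_mid, e5, e6,
          mul_zero, zero_add, add_zero, Matrix.mulVec, dotProduct, gram, Matrix.of_apply]
        exact Finset.sum_congr rfl fun i _ => by rw [mul_comm, lform_comm]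
      have : coeff e (Ψ c) (.mid i) = ((gram e)⁻¹.mulVec ((gram e).mulVec c.2.1)) i := by
        simp only [coeff, hk]; rfl
      rw [this, Matrix.mulVec_mulVec, Matrix.nonsing_inv_mul _ hdet, Matrix.one_mulVec]
    · simp [coeff, hΨ, lform_add_left, lform_smul_left, lform_sum_left, he.zero_pt, he.mid_pt,
        he.pt_pt, e4]
    · simp [coeff, hΨ, lform_add_left, lform_smul_left, lform_sum_left, he.zero_zero, e1, e2, e3]
  have hinj : Function.Injective Ψ := by
    intro c d hcd
    obtain ⟨a1, a2, a3, a4⟩ := hc c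
    obtain ⟨b1, b2, b3, b4⟩ := hc d
    rw [hcd] at a1 a2 a3 a4
    refine Prod.ext (a1.symm.trans b1) (Prod.ext (funext fun i => (a2 i).symm.trans (b2 i))
      (Prod.ext (a3.symm.trans b3) (a4.symm.trans b4)))
  have hsurj : Function.Surjective Ψ := by
    refine (LinearMap.injective_iff_surjective_of_finrank_eq_finrank ?_).mp hinj
    simp
    omega
  obtain ⟨c, rfl⟩ := hsurj w
  obtain ⟨a1, a2, a3, a4⟩ := hc c
  simp only [a1, a2, a3, a4]
  exact hΨ c

section Frames

variable {m r : ℕ} {N : Type*} [TopologicalSpace N]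
  [ChartedSpace (EuclideanSpace ℝ (Fin (m + r + 1))) N]

/-- The forms `ω_ξ^η` of a moving frame: `dA_ξ = ω_ξ^η A_η`. -/
def omega (A : FrameIdx m r → N → LVec (m + r + 1)) (q : N) (ξ η : FrameIdx m r)
    (v : TangentSpace (𝓡 (m + r + 1)) q) : ℝ :=
  coeff (fun ζ => A ζ q) (dAt (A ξ) q v) η

/-- `A` is a smooth field, over the open set `W`, of conformal frames associated with the points
`x = A_n` of the lightlike hypersurface `f`: `A_0` and `A_i` lie in the tangent hyperplane, i.e.
`ω_n^{n+1} = 0`. -/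
structure IsLightlikeFrame (f : N → ℙ ℝ (LVec (m + r + 1))) (W : Set N)
    (A : FrameIdx m r → N → LVec (m + r + 1)) : Prop where
  isOpen : IsOpen W
  smooth : ∀ ξ, ContMDiffOn (𝓡 (m + r + 1)) 𝓘(ℝ, LVec (m + r + 1)) ∞ (A ξ) W
  basis : ∀ q ∈ W, IsConformalBasis fun ξ => A ξ q
  lift : ∀ q ∈ W, (f q).submodule = Submodule.span ℝ {A .pt q}
  tangent : ∀ q ∈ W, ∀ v, omega A q .pt .top v = 0

/-- `ν` is the tensor of coefficients in `ω_i^{n+1} = ν_{ij} ω_n^j` at the point `q`. -/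
def IsNu (A : FrameIdx m r → N → LVec (m + r + 1)) (q : N)
    (ν : Matrix (Fin m ⊕ Fin r) (Fin m ⊕ Fin r) ℝ) : Prop :=
  ∀ i v, omega A q (.mid i) .top v = ∑ j, ν i j * omega A q .pt (.mid j) v

/-- The tensor `ν_{ij}` of the hypersurface `f` of dimension `m + r + 1` has rank `r`. -/
def HasReducedRank (m r : ℕ) {N : Type*} [TopologicalSpace N]
    [ChartedSpace (EuclideanSpace ℝ (Fin (m + r + 1))) N]
    (f : N → ℙ ℝ (LVec (m + r + 1))) : Prop :=
  ∀ (W : Set N) (A : FrameIdx m r → N → LVec (m + r + 1)), IsLightlikeFrame f W A →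
    ∀ q ∈ W, ∀ ν, IsNu A q ν → ν.rank = r

/-- The frames in which `g_{ij}` and `ν_{ij}` are simultaneously quasidiagonal:
`g_{ap} = 0` and `ν_{aj} = 0`, i.e. `ω_a^{n+1} = 0`. -/
structure IsAdaptedFrame (f : N → ℙ ℝ (LVec (m + r + 1))) (W : Set N)
    (A : FrameIdx m r → N → LVec (m + r + 1)) : Prop extends IsLightlikeFrame f W A where
  orthogonal : ∀ q ∈ W, ∀ a p, lform (A (.mid (.inl a)) q) (A (.mid (.inr p)) q) = 0
  kernel : ∀ q ∈ W, ∀ a v, omega A q (.mid (.inl a)) .top v = 0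

/-- The plane generator `L = A_0 ∧ A_1 ∧ … ∧ A_m ∧ A_n`, as a linear subspace. -/
def generator (A : FrameIdx m r → N → LVec (m + r + 1)) (q : N) :
    Submodule ℝ (LVec (m + r + 1)) :=
  Submodule.span ℝ {A .zero q} ⊔ Submodule.span ℝ (Set.range fun α => A (normalIdx α) q)

/-- `L` is the plane generator of `f` through the point `p`. -/
def IsGeneratorAt (f : N → ℙ ℝ (LVec (m + r + 1))) (p : N)
    (L : Submodule ℝ (LVec (m + r + 1))) : Prop :=
  ∃ (W : Set N) (A : FrameIdx m r → N → LVec (m + r + 1)),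
    p ∈ W ∧ IsAdaptedFrame f W A ∧ L = generator A p

/-! ### The tensor `a^α_{pq}`, the relative invariant `a` and the object `μ_p` -/

/-- `Λ` is the family of coefficients in `ω_p^α = λ^α_{ps} ω_0^s` at the point `q`. -/
def IsLambda (A : FrameIdx m r → N → LVec (m + r + 1)) (q : N)
    (Λ : Option (Fin m) → Matrix (Fin r) (Fin r) ℝ) : Prop :=
  ∀ α p v, omega A q (.mid (.inr p)) (normalIdx α) v =
    ∑ s, Λ α p s * omega A q .zero (.mid (.inr s)) v

/-- The matrix `g_{pq}`. -/
def gTan (A : FrameIdx m r → N → LVec (m + r + 1)) (q : N) : Matrix (Fin r) (Fin r) ℝ :=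
  Matrix.of fun p s => lform (A (.mid (.inr p)) q) (A (.mid (.inr s)) q)

/-- The matrix `g_{αβ}`. -/
def gNor (A : FrameIdx m r → N → LVec (m + r + 1)) (q : N) :
    Matrix (Option (Fin m)) (Option (Fin m)) ℝ :=
  Matrix.of fun α β => lform (A (normalIdx α) q) (A (normalIdx β) q)

/-- `a^α_{pq} = λ^α_{pq} - λ^α g_{pq}`, where `λ^α = (1/r) g^{pq} λ^α_{pq}`. -/
def traceFree (g : Matrix (Fin r) (Fin r) ℝ) (Λ : Option (Fin m) → Matrix (Fin r) (Fin r) ℝ)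
    (α : Option (Fin m)) : Matrix (Fin r) (Fin r) ℝ :=
  Λ α - ((1 / (r : ℝ)) * ∑ p, ∑ s, g⁻¹ p s * Λ α p s) • g

/-- The matrix `A = (a^α_{pq})` with rows `α` and columns `(p, q)`.  The columns `(p, q)` and
`(q, p)` are both kept, which does not affect the rank. -/
def matA (g : Matrix (Fin r) (Fin r) ℝ) (Λ : Option (Fin m) → Matrix (Fin r) (Fin r) ℝ) :
    Matrix (Option (Fin m)) (Fin r × Fin r) ℝ :=
  Matrix.of fun α ps => traceFree g Λ α ps.1 ps.2

/-- The matrix `A = (a^α_{pq})` of the hypersurface `f` has rank `ρ` at all points. -/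
def HasMatrixRank (ρ : ℕ) (f : N → ℙ ℝ (LVec (m + r + 1))) : Prop :=
  ∀ (W : Set N) (A : FrameIdx m r → N → LVec (m + r + 1)), IsAdaptedFrame f W A →
    ∀ q ∈ W, ∀ Λ, IsLambda A q Λ → (matA (gTan A q) Λ).rank = ρ

/-- The tensor `a^{αβ} = g^{pq} g^{st} a^α_{ps} a^β_{qt}`. -/
def upperTensor (g : Matrix (Fin r) (Fin r) ℝ) (Λ : Option (Fin m) → Matrix (Fin r) (Fin r) ℝ) :
    Matrix (Option (Fin m)) (Option (Fin m)) ℝ :=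
  Matrix.of fun α β => ∑ p, ∑ q, ∑ s, ∑ t,
    g⁻¹ p q * g⁻¹ s t * traceFree g Λ α p s * traceFree g Λ β q t

/-- The tensor `a^α_β = g_{βγ} a^{γα}`, with row index `β` and column index `α`. -/
def mixedTensor (h : Matrix (Option (Fin m)) (Option (Fin m)) ℝ)
    (g : Matrix (Fin r) (Fin r) ℝ) (Λ : Option (Fin m) → Matrix (Fin r) (Fin r) ℝ) :
    Matrix (Option (Fin m)) (Option (Fin m)) ℝ :=
  h * upperTensor g Λ

/-- The sum of the diagonal minors of order `ρ` of a square matrix. -/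
def sumDiagMinors (ρ : ℕ) {κ : Type*} [Fintype κ] [DecidableEq κ] (M : Matrix κ κ ℝ) : ℝ :=
  ∑ S ∈ (Finset.univ : Finset κ).powersetCard ρ,
    (M.submatrix (Subtype.val : S → κ) (Subtype.val : S → κ)).det

/-- The relative invariant `a`. -/
def relInv (ρ : ℕ) (A : FrameIdx m r → N → LVec (m + r + 1))
    (Λ : N → Option (Fin m) → Matrix (Fin r) (Fin r) ℝ) (q : N) : ℝ :=
  sumDiagMinors ρ (mixedTensor (gNor A q) (gTan A q) (Λ q))

/-- `μ` is the family of coefficients in `da / (2 ρ a) + ω_0^0 = μ_p ω_0^p` at the point `q`. -/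
def IsMu (ρ : ℕ) (A : FrameIdx m r → N → LVec (m + r + 1))
    (Λ : N → Option (Fin m) → Matrix (Fin r) (Fin r) ℝ) (q : N) (μ : Fin r → ℝ) : Prop :=
  ∀ v : TangentSpace (𝓡 (m + r + 1)) q,
    dAt (relInv ρ A Λ) q v / (2 * (ρ : ℝ) * relInv ρ A Λ q) + omega A q .zero .zero v =
      ∑ p, μ p * omega A q .zero (.mid (.inr p)) v

/-! ### The screen distribution -/

/-- `(A, Λ, μ)` is a moving frame over `W` adapted to `f`, together with the quantities
`λ^α_{pq}` and `μ_p` which it defines. -/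
structure IsScreenConstruction (ρ : ℕ) (f : N → ℙ ℝ (LVec (m + r + 1))) (W : Set N)
    (A : FrameIdx m r → N → LVec (m + r + 1))
    (Λ : N → Option (Fin m) → Matrix (Fin r) (Fin r) ℝ) (μ : N → Fin r → ℝ) : Prop where
  frame : IsAdaptedFrame f W A
  lambda : ∀ q ∈ W, IsLambda A q (Λ q)
  mu : ∀ q ∈ W, IsMu ρ A Λ q (μ q)

/-- The points `C_p = A_p + μ_p A_0`. -/
def normPt (A : FrameIdx m r → N → LVec (m + r + 1)) (μ : N → Fin r → ℝ) (p : Fin r) (q : N) :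
    LVec (m + r + 1) :=
  A (.mid (.inr p)) q + μ q p • A .zero q

/-- The normalizing subspace `ζ`, the span of the points `C_p`. -/
def normSubspace (A : FrameIdx m r → N → LVec (m + r + 1)) (μ : N → Fin r → ℝ) (q : N) :
    Submodule ℝ (LVec (m + r + 1)) :=
  Submodule.span ℝ (Set.range fun p => normPt A μ p q)

/-- The `r`-plane `Δ_x = x ∧ ζ`, as a linear subspace. -/
def screenPlane (A : FrameIdx m r → N → LVec (m + r + 1)) (μ : N → Fin r → ℝ) (q : N) :
    Submodule ℝ (LVec (m + r + 1)) :=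
  Submodule.span ℝ {A .pt q} ⊔ normSubspace A μ q

/-- `S` is the `r`-plane `Δ_x` at the point `x = f p` obtained from some adapted moving frame. -/
def IsScreenAt (ρ : ℕ) (f : N → ℙ ℝ (LVec (m + r + 1))) (p : N)
    (S : Submodule ℝ (LVec (m + r + 1))) : Prop :=
  ∃ (W : Set N) (A : FrameIdx m r → N → LVec (m + r + 1))
    (Λ : N → Option (Fin m) → Matrix (Fin r) (Fin r) ℝ) (μ : N → Fin r → ℝ),
    p ∈ W ∧ IsScreenConstruction ρ f W A Λ μ ∧ S = screenPlane A μ p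

end Frames

/-! ### Motions and contact -/

/-- A linear automorphism preserving the scalar product.  These act on the projective space as the
motions of the de Sitter space. -/
def IsMotion {n : ℕ} (T : LVec n ≃ₗ[ℝ] LVec n) : Prop :=
  ∀ x y, lform (T x) (T y) = lform x y

/-- The image of a hypersurface under a linear automorphism. -/
def moved {n : ℕ} {N : Type*} (T : LVec n ≃ₗ[ℝ] LVec n) (f : N → ℙ ℝ (LVec n)) :
    N → ℙ ℝ (LVec n) :=
  fun q => Projectivization.map T.toLinearMap T.injective (f q)

/-- `F` is a smooth local parametrization near `0`, by vectors with `(F, F) = 1`, of the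
hypersurface `f` near the point `p` of its parameter manifold. -/
def IsLocalParam {n : ℕ} {N : Type*} [TopologicalSpace N]
    [ChartedSpace (EuclideanSpace ℝ (Fin n)) N] (f : N → ℙ ℝ (LVec n)) (p : N)
    (F : EuclideanSpace ℝ (Fin n) → LVec n) : Prop :=
  ContDiffAt ℝ ∞ F 0 ∧ ∃ ψ : EuclideanSpace ℝ (Fin n) → N,
    IsLocalDiffeomorphAt (𝓡 n) (𝓡 n) ∞ ψ 0 ∧ ψ 0 = p ∧
    ∀ᶠ t in 𝓝 (0 : EuclideanSpace ℝ (Fin n)),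
      lform (F t) (F t) = 1 ∧ (f (ψ t)).submodule = Submodule.span ℝ {F t}

/-- The neighborhoods of order `k` of a plane generator coincide: the hypersurfaces `f`, near `p`,
and `f'`, near `p'`, have local parametrizations with the same partial derivatives up to order `k`
at all points of the generator `L` of `f` through `p` (near `p`). -/
def HaveContactAlongGenerator {m r : ℕ} (k : ℕ) {N N' : Type*}
    [TopologicalSpace N] [ChartedSpace (EuclideanSpace ℝ (Fin (m + r + 1))) N]
    [TopologicalSpace N'] [ChartedSpace (EuclideanSpace ℝ (Fin (m + r + 1))) N']
    (f : N → ℙ ℝ (LVec (m + r + 1))) (p : N) (f' : N' → ℙ ℝ (LVec (m + r + 1))) (p' : N') :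
    Prop :=
  ∃ F F' : EuclideanSpace ℝ (Fin (m + r + 1)) → LVec (m + r + 1),
    IsLocalParam f p F ∧ IsLocalParam f' p' F' ∧
    ∃ L, IsGeneratorAt f p L ∧
      ∀ᶠ t in 𝓝 (0 : EuclideanSpace ℝ (Fin (m + r + 1))), F t ∈ L →
        ∀ j ≤ k, iteratedFDeriv ℝ j F t = iteratedFDeriv ℝ j F' t

end

end DeSitter

open DeSitter

namespace DeSitter

noncomputable section

/-! ### Sums of principal minors -/

section Minors

variable {κ : Type*} [Fintype κ] [DecidableEq κ]

/-! The screen is read off from one vector field. The isotropic vector A_0 spans the orthogonal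
complement of η, so the hypersurface determines it up to a factor; the vector Ã = a^{1/(2ρ)} A_0
(`normZero`) is determined up to sign. Since dA_0 = ω_0^0 A_0 + ω_0^p A_p, the relation da/(2ρa) +
ω_0^0 = μ_p ω_0^p says exactly that dÃ = a^{1/(2ρ)} ω_0^p C_p. Hence ζ is the span of all
derivatives of Ã (`span_pd_normZero`), which does not depend on the frame, and the constancy of ζ
along a generator is the symmetry of the second derivatives of Ã (`pd_normPt_mem`).

This rests on two properties of a. It is positive: up to factorizations of the positive definite
metrics, (a^α_β) has the same sums of diagonal minors as a Gram matrix Y Yᵀ with Y of rank ρ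
(`sumDiagMinors_mixedTensor_pos`). And it has a weight: lowering the index α makes λ_{βpq} the
coefficients of (d²A_0, A_β), and as a function of (g_{αβ}, g_{pq}, λ_{βpq}) the invariant a is
multiplied by k^{2ρ} when λ is scaled by k, is unchanged under linear changes of the A_α and of the
A_p, and ignores multiples of g_{pq} added to λ_β (`lowInv_gauge`). A change of adapted frame with
A_0' = s A_0 acts on the triple in this way with k = 1/s (`locInv_change`), so Ã changes only by a
sign. Motion along a generator acts by the infinitesimal version of the same transformations; this
is the symmetry of the third derivatives of A_0 (`pd_lowerIdx_of_kernel`). Hence da = -2ρ ω_0^0 a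
along generators (`pd_locInv_of_kernel`), so da/(2ρa) + ω_0^0 vanishes there and is a combination of
the ω_0^p.

Adapted frames are obtained from the isotropic normal e₀ normalized by (e₀, N₀) = -1 for a fixed
vector N₀: it solves a linear system, hence is smooth (`exists_nullNormal`). The A_p are projections
of r derivatives of e₀, the A_a are projections of fixed vectors corrected to be orthogonal to the
A_p, and the rank hypothesis forces ν_{aj} = 0 (`exists_localFrame`).

The order of contact needs care. The normal e₀ costs one derivative of the parametrization F, the
frame one more and λ another, so that da formally contains fourth derivatives of F. They enter only
through (∂∂∂e₀, A_α), and the components of e₀ along the generator are better than the others: (e₀ -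
e₀', ∂_v F) = -(∂_v(F - F'), e₀'), where for v tangent to the generator ∂_v(F - F') still vanishes
to order 3, because F - F' vanishes to that order all along the generator (`flat_sub_generator`).
Curves inside the generator (`exists_curve`) turn the hypothesis along the generator into this
statement about ∂_v(F - F'). -/

theorem sumDiagMinors_mul_comm {κ' : Type*} [Fintype κ'] [DecidableEq κ'] (ρ : ℕ)
    (P : Matrix κ κ' ℝ) (Q : Matrix κ' κ ℝ) :
    sumDiagMinors ρ (P * Q) = sumDiagMinors ρ (Q * P) := by
  unfold sumDiagMinors
  -- The sums of diagonal minors are the coefficients of det(1 + X M), so Sylvester's identity det(1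
  -- + PQ) = det(1 + QP) applies.
  rw [← Matrix.coeff_det_one_add_X_smul_eq_sum_minors,
    ← Matrix.coeff_det_one_add_X_smul_eq_sum_minors, Matrix.map_mul, Matrix.map_mul,
    ← Matrix.smul_mul, Matrix.det_one_add_mul_comm, Matrix.mul_smul]

theorem sumDiagMinors_smul (ρ : ℕ) (k : ℝ) (M : Matrix κ κ ℝ) :
    sumDiagMinors ρ (k • M) = k ^ ρ * sumDiagMinors ρ M := by
  unfold sumDiagMinors
  rw [Finset.mul_sum]
  refine Finset.sum_congr rfl fun S hS => ?_
  have : (k • M).submatrix (Subtype.val : S → κ) (Subtype.val : S → κ) =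
    k • M.submatrix (Subtype.val : S → κ) (Subtype.val : S → κ) := rfl
  rw [this, Matrix.det_smul, Fintype.card_coe, (Finset.mem_powersetCard.mp hS).2]

/-- A diagonal minor of Y Yᵀ is the Gram determinant of the selected rows: it is never negative, and
it is positive for linearly independent rows. -/
theorem sumDiagMinors_mul_transpose_pos {κ' : Type*} [Fintype κ'] [DecidableEq κ'] {ρ : ℕ}
    (Y : Matrix κ κ' ℝ) (hY : Y.rank = ρ) : 0 < sumDiagMinors ρ (Y * Y.transpose) := by
  have hsub : ∀ S : Finset κ, (Y * Y.transpose).submatrix (Subtype.val : S → κ)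
      (Subtype.val : S → κ) = Y.submatrix (Subtype.val : S → κ) id *
        (Y.submatrix (Subtype.val : S → κ) id).conjTranspose := by
    intro S
    ext i j
    simp [Matrix.mul_apply]
  refine Finset.sum_pos' (fun S _ => ?_) ?_
  · rw [hsub]
    exact (Matrix.posSemidef_self_mul_conjTranspose _).det_nonneg
  -- A maximal independent set of rows has exactly ρ elements and supplies a positive term of the
  -- sum.
  · obtain ⟨ι, a, ha, hspan, hli⟩ := exists_linearIndependent' ℝ Y.row
    have : Fintype ι := Fintype.ofInjective a ha
    let S : Finset κ := Finset.univ.map ⟨a, ha⟩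
    refine ⟨S, ?_, ?_⟩
    · simp only [Finset.mem_powersetCard, Finset.subset_univ, true_and]
      rw [Finset.card_map, Finset.card_univ, ← hY, Matrix.rank_eq_finrank_span_row, ← hspan,
        finrank_span_eq_card hli]
    · rw [hsub]
      refine Matrix.PosDef.det_pos (Matrix.PosDef.mul_conjTranspose_self _ ?_)
      rw [Matrix.vecMul_injective_iff]
      let φ : S → ι := fun s => (Finset.mem_map.mp s.2).choose
      have hφ : ∀ s : S, a (φ s) = s := fun s => (Finset.mem_map.mp s.2).choose_spec.2
      have hinj : Function.Injective φ := fun s t hst => by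
        apply Subtype.ext
        rw [← hφ s, ← hφ t, hst]
      have := hli.comp φ hinj
      have heq : (Y.row ∘ a) ∘ φ =
          (Y.submatrix (Subtype.val : S → κ) id).row := by
        funext s
        simp only [Function.comp, hφ]
        rfl
      rwa [heq] at this

end Minors

/-! ### The relative invariant in terms of covariant components -/

section Tensors

variable {m r : ℕ}

/-- The transpose makes this valid for arbitrary Λ, so that the tensor algebra below never needs the
symmetry of λ. -/
theorem traceFree_eq (g : Matrix (Fin r) (Fin r) ℝ)
    (Λ : Option (Fin m) → Matrix (Fin r) (Fin r) ℝ) (α : Option (Fin m)) :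
    traceFree g Λ α = Λ α - ((1 / (r : ℝ)) * (g⁻¹ * (Λ α).transpose).trace) • g := by
  simp [traceFree, Matrix.trace, Matrix.mul_apply]

theorem upperTensor_eq_trace (g : Matrix (Fin r) (Fin r) ℝ)
    (Λ : Option (Fin m) → Matrix (Fin r) (Fin r) ℝ) (α β : Option (Fin m)) :
    upperTensor g Λ α β =
      ((traceFree g Λ α).transpose * (g⁻¹ * traceFree g Λ β * g⁻¹.transpose)).trace := by
  simp only [upperTensor, Matrix.of_apply, Matrix.trace, Matrix.diag_apply, Matrix.mul_apply,
    Matrix.transpose_apply, Finset.sum_mul, Finset.mul_sum]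
  rw [Finset.sum_congr rfl fun p _ => Finset.sum_comm]
  rw [Finset.sum_comm]
  refine Finset.sum_congr rfl fun s _ => Finset.sum_congr rfl fun p _ => ?_
  rw [Finset.sum_comm]
  refine Finset.sum_congr rfl fun t _ => Finset.sum_congr rfl fun q _ => ?_
  ring

/-- The relative invariant as a function of the covariant components
`λ_{βpq} = g_{βγ} λ^γ_{pq}`. -/
def lowInv (ρ : ℕ) (h : Matrix (Option (Fin m)) (Option (Fin m)) ℝ) (g : Matrix (Fin r) (Fin r) ℝ)
    (Λ : Option (Fin m) → Matrix (Fin r) (Fin r) ℝ) : ℝ :=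
  sumDiagMinors ρ (upperTensor g Λ * h⁻¹)

theorem inv_conj {κ : Type*} [Fintype κ] [DecidableEq κ] {d g : Matrix κ κ ℝ} :
    (d * g * d.transpose)⁻¹ = d⁻¹.transpose * g⁻¹ * d⁻¹ := by
  rw [Matrix.mul_inv_rev, Matrix.mul_inv_rev, Matrix.transpose_nonsing_inv, Matrix.mul_assoc]

/-- The trace of λ with respect to g is unchanged when both undergo the same congruence by d, and a
summand e g has trace r e, which the trace-free part removes. -/
theorem traceFree_gauge {g d : Matrix (Fin r) (Fin r) ℝ} (hg : IsUnit g.det)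
    (hgs : g.IsSymm)
    (hd : IsUnit d.det) (k : ℝ) (c : Matrix (Option (Fin m)) (Option (Fin m)) ℝ)
    (e : Option (Fin m) → ℝ) (Λ : Option (Fin m) → Matrix (Fin r) (Fin r) ℝ)
    (β : Option (Fin m)) :
    traceFree (d * g * d.transpose) (fun β => k • ∑ γ, c β γ • (d * Λ γ * d.transpose) +
      e β • (d * g * d.transpose)) β =
      k • ∑ γ, c β γ • (d * traceFree g Λ γ * d.transpose) := by
  -- The trace is divided by r; for r = 0 all the tensors are empty.
  rcases Nat.eq_zero_or_pos r with rfl | hr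
  · ext i; exact i.elim0
  have hr' : (r : ℝ) ≠ 0 := by positivity
  have hdt : IsUnit d.transpose.det := by rwa [Matrix.det_transpose]
  have key : ∀ X : Matrix (Fin r) (Fin r) ℝ,
      ((d * g * d.transpose)⁻¹ * (d * X * d.transpose).transpose).trace =
        (g⁻¹ * X.transpose).trace := by
    intro X
    rw [inv_conj, Matrix.transpose_mul, Matrix.transpose_mul, Matrix.transpose_transpose]
    have h1 : d⁻¹.transpose * g⁻¹ * d⁻¹ * (d * (X.transpose * d.transpose)) =
        d⁻¹.transpose * (g⁻¹ * X.transpose * d.transpose) := by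
      simp only [Matrix.mul_assoc]
      rw [Matrix.nonsing_inv_mul_cancel_left _ _ hd]
    rw [h1, Matrix.trace_mul_comm, Matrix.mul_assoc, Matrix.transpose_nonsing_inv,
      Matrix.mul_nonsing_inv _ hdt, Matrix.mul_one]
  have hgt : (g⁻¹ * g.transpose).trace = r := by
    rw [hgs.eq, Matrix.nonsing_inv_mul _ hg, Matrix.trace_one, Fintype.card_fin]
  simp only [traceFree_eq]
  simp only [Matrix.transpose_add, Matrix.transpose_smul, Matrix.transpose_sum, Matrix.mul_add,
    Matrix.mul_smul, Matrix.mul_sum, Matrix.trace_add, Matrix.trace_smul, Matrix.trace_sum, key,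
    hgt, Matrix.mul_sub, Matrix.sub_mul, Matrix.smul_mul, smul_sub, Finset.sum_sub_distrib,
    smul_eq_mul]
  simp only [smul_smul, ← Finset.sum_smul]
  have hs : ∑ i, c β i * (1 / (r : ℝ) * (g⁻¹ * (Λ i).transpose).trace) =
      1 / (r : ℝ) * ∑ i, c β i * (g⁻¹ * (Λ i).transpose).trace := by
    rw [Finset.mul_sum]
    exact Finset.sum_congr rfl fun γ _ => by ring
  rw [hs, add_sub_assoc, ← sub_smul, sub_eq_add_neg (k • _), ← neg_smul]
  congr 2
  field_simp
  ring

/-- The contraction over both pairs of tangential indices absorbs d; each of the two factors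
contributes one k and one c. -/
theorem upperTensor_gauge {g d : Matrix (Fin r) (Fin r) ℝ} (hg : IsUnit g.det)
    (hgs : g.IsSymm)
    (hd : IsUnit d.det) (k : ℝ) (c : Matrix (Option (Fin m)) (Option (Fin m)) ℝ)
    (e : Option (Fin m) → ℝ) (Λ : Option (Fin m) → Matrix (Fin r) (Fin r) ℝ) :
    upperTensor (d * g * d.transpose) (fun β => k • ∑ γ, c β γ • (d * Λ γ * d.transpose) +
      e β • (d * g * d.transpose)) = k ^ 2 • (c * upperTensor g Λ * c.transpose) := by
  have hdt : IsUnit d.transpose.det := by rwa [Matrix.det_transpose]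
  have key : ∀ X Y : Matrix (Fin r) (Fin r) ℝ,
      ((d * X * d.transpose).transpose * ((d * g * d.transpose)⁻¹ * (d * Y * d.transpose) *
        (d * g * d.transpose)⁻¹.transpose)).trace =
        (X.transpose * (g⁻¹ * Y * g⁻¹.transpose)).trace := by
    intro X Y
    have h1 : (d * g * d.transpose)⁻¹ * (d * Y * d.transpose) *
        (d * g * d.transpose)⁻¹.transpose =
        d⁻¹.transpose * (g⁻¹ * Y * g⁻¹.transpose) * d⁻¹ := by
      rw [inv_conj]
      simp only [Matrix.transpose_mul, Matrix.transpose_transpose, Matrix.mul_assoc]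
      rw [Matrix.nonsing_inv_mul_cancel_left _ _ hd, Matrix.transpose_nonsing_inv d,
        Matrix.mul_nonsing_inv_cancel_left _ _ hdt]
    have h2 : (d * X * d.transpose).transpose * (d⁻¹.transpose * (g⁻¹ * Y * g⁻¹.transpose) * d⁻¹)
        = d * (X.transpose * (g⁻¹ * Y * g⁻¹.transpose) * d⁻¹) := by
      simp only [Matrix.transpose_mul, Matrix.transpose_transpose, Matrix.mul_assoc]
      rw [Matrix.transpose_nonsing_inv d, Matrix.mul_nonsing_inv_cancel_left _ _ hdt]
    rw [h1, h2, Matrix.trace_mul_comm, Matrix.mul_assoc, Matrix.nonsing_inv_mul _ hd,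
      Matrix.mul_one]
  ext α β
  rw [upperTensor_eq_trace, traceFree_gauge hg hgs hd, traceFree_gauge hg hgs hd]
  simp only [Matrix.smul_apply, Matrix.mul_apply, Matrix.transpose_apply, smul_eq_mul,
    upperTensor_eq_trace]
  simp only [Matrix.transpose_smul, Matrix.transpose_sum, Matrix.mul_smul, Matrix.smul_mul,
    Matrix.trace_smul, Matrix.trace_sum, key, smul_eq_mul, Finset.sum_mul, Finset.mul_sum]
  refine Finset.sum_congr rfl fun x _ => Finset.sum_congr rfl fun y _ => ?_
  ring

/-- The product of the upper tensor with h⁻¹ is conjugated by c and multiplied by k². Sums of minors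
of order ρ are invariant under conjugation and homogeneous of degree ρ, which gives the weight 2ρ.
-/
theorem lowInv_gauge {g d : Matrix (Fin r) (Fin r) ℝ} (hg : IsUnit g.det) (hgs : g.IsSymm)
    (hd : IsUnit d.det) (k : ℝ) {c h : Matrix (Option (Fin m)) (Option (Fin m)) ℝ}
    (hc : IsUnit c.det) (ρ : ℕ)
    (e : Option (Fin m) → ℝ) (Λ : Option (Fin m) → Matrix (Fin r) (Fin r) ℝ) :
    lowInv ρ (c * h * c.transpose) (d * g * d.transpose)
      (fun β => k • ∑ γ, c β γ • (d * Λ γ * d.transpose) + e β • (d * g * d.transpose)) =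
      k ^ (2 * ρ) * lowInv ρ h g Λ := by
  have hct : IsUnit c.transpose.det := by rwa [Matrix.det_transpose]
  unfold lowInv
  rw [upperTensor_gauge hg hgs hd, inv_conj, Matrix.smul_mul, sumDiagMinors_smul, ← pow_mul]
  congr 1
  have : c * upperTensor g Λ * c.transpose * (c⁻¹.transpose * h⁻¹ * c⁻¹) =
      c * (upperTensor g Λ * h⁻¹ * c⁻¹) := by
    simp only [Matrix.mul_assoc]
    rw [Matrix.transpose_nonsing_inv c, Matrix.mul_nonsing_inv_cancel_left _ _ hct]
  rw [this, sumDiagMinors_mul_comm, Matrix.mul_assoc, Matrix.nonsing_inv_mul _ hc, Matrix.mul_one]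

/-- Lowering the first index of `λ^α_{pq}`. -/
def lowerIdx (h : Matrix (Option (Fin m)) (Option (Fin m)) ℝ)
    (Λ : Option (Fin m) → Matrix (Fin r) (Fin r) ℝ) : Option (Fin m) → Matrix (Fin r) (Fin r) ℝ :=
  fun β => ∑ γ, h β γ • Λ γ

theorem lowInv_lowerIdx {g : Matrix (Fin r) (Fin r) ℝ} (hg : IsUnit g.det) (hgs : g.IsSymm)
    {h : Matrix (Option (Fin m)) (Option (Fin m)) ℝ} (hh : IsUnit h.det) (hhs : h.IsSymm) (ρ : ℕ)
    (Λ : Option (Fin m) → Matrix (Fin r) (Fin r) ℝ) :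
    lowInv ρ h g (lowerIdx h Λ) = sumDiagMinors ρ (mixedTensor h g Λ) := by
  -- Lowering the index is the same linear change with c = h; it turns the upper tensor U into h U
  -- h, and multiplication by h⁻¹ leaves h U.
  have := upperTensor_gauge (d := 1) hg hgs (by simp) 1 h 0 Λ
  simp only [Matrix.one_mul, Matrix.transpose_one, Matrix.mul_one, one_smul, Pi.zero_apply,
    zero_smul, add_zero, one_pow] at this
  unfold lowInv lowerIdx mixedTensor
  rw [this, hhs.eq, Matrix.mul_assoc, Matrix.mul_nonsing_inv _ hh, Matrix.mul_one]

/-! ### Factorization of positive definite matrices and positivity of the relative invariant -/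

section

open scoped MatrixOrder Matrix.Norms.L2Operator

theorem exists_transpose_mul_self {κ : Type*} [Fintype κ] [DecidableEq κ] {M : Matrix κ κ ℝ}
    (hM : M.PosDef) : ∃ B : Matrix κ κ ℝ, IsUnit B ∧ M = B.transpose * B := by
  obtain ⟨B, hB, h⟩ := CStarAlgebra.isStrictlyPositive_iff_eq_star_mul_self.mp
    hM.isStrictlyPositive
  refine ⟨B, hB, ?_⟩
  rwa [Matrix.star_eq_conjTranspose, Matrix.conjTranspose_eq_transpose_of_trivial] at h

end

/-- With h = BᵀB, g⁻¹ = CᵀC and D = C ⊗ C, the matrix h U has the same sums of minors as Y Yᵀ for Y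
= B A Dᵀ. The factors B and D are invertible, so Y has the rank ρ of A. -/
theorem sumDiagMinors_mixedTensor_pos {g : Matrix (Fin r) (Fin r) ℝ} (hg : g.PosDef)
    {h : Matrix (Option (Fin m)) (Option (Fin m)) ℝ} (hh : h.PosDef) {ρ : ℕ}
    {Λ : Option (Fin m) → Matrix (Fin r) (Fin r) ℝ} (hΛ : (matA g Λ).rank = ρ) :
    0 < sumDiagMinors ρ (mixedTensor h g Λ) := by
  obtain ⟨B, hBu, hB⟩ := exists_transpose_mul_self hh
  obtain ⟨C, hCu, hC⟩ := exists_transpose_mul_self hg.inv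
  set D := Matrix.kroneckerMap (· * ·) C C with hD
  have hDu : IsUnit D.det := by
    rw [hD, Matrix.det_kronecker]
    exact ((Matrix.isUnit_iff_isUnit_det _).mp hCu).pow _ |>.mul
      (((Matrix.isUnit_iff_isUnit_det _).mp hCu).pow _)
  have hU : upperTensor g Λ = matA g Λ * D.transpose * (matA g Λ * D.transpose).transpose := by
    have : D.transpose * D = Matrix.kroneckerMap (· * ·) g⁻¹ g⁻¹ := by
      rw [hC, Matrix.mul_kronecker_mul]; rfl
    rw [Matrix.transpose_mul, Matrix.transpose_transpose, ← Matrix.mul_assoc,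
      Matrix.mul_assoc (matA g Λ), this]
    ext α β
    simp only [upperTensor, Matrix.of_apply, matA, Matrix.mul_apply, Matrix.transpose_apply,
      Matrix.kroneckerMap_apply, Fintype.sum_prod_type, Finset.sum_mul]
    rw [Finset.sum_comm]
    refine Finset.sum_congr rfl fun q _ => ?_
    rw [Finset.sum_congr rfl fun p _ => Finset.sum_comm, Finset.sum_comm]
    refine Finset.sum_congr rfl fun t _ => Finset.sum_congr rfl fun p _ =>
      Finset.sum_congr rfl fun s _ => ?_
    ring
  have hr : (B * (matA g Λ * D.transpose)).rank = ρ := by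
    rw [Matrix.rank_mul_eq_right_of_isUnit_det _ _ ((Matrix.isUnit_iff_isUnit_det _).mp hBu),
      Matrix.rank_mul_eq_left_of_isUnit_det _ _ (by rwa [Matrix.det_transpose]), hΛ]
  have := sumDiagMinors_mul_transpose_pos _ hr
  unfold mixedTensor
  rw [hU, hB, Matrix.mul_assoc, sumDiagMinors_mul_comm]
  convert this using 2
  rw [Matrix.transpose_mul (M := B)]
  simp only [Matrix.mul_assoc]

end Tensors

/-! ### Algebra of the scalar product -/

section Form

variable {n : ℕ}

theorem lform_add_right (x y z : LVec n) : lform x (y + z) = lform x y + lform x z := by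
  rw [lform_comm, lform_add_left, lform_comm y, lform_comm z]

theorem lform_smul_right (c : ℝ) (x z : LVec n) : lform x (c • z) = c * lform x z := by
  rw [lform_comm, lform_smul_left, lform_comm]

/-- The scalar product as a bilinear map. -/
def lformLin (n : ℕ) : LVec n →ₗ[ℝ] LVec n →ₗ[ℝ] ℝ :=
  LinearMap.mk₂ ℝ lform lform_add_left lform_smul_left lform_add_right lform_smul_right

@[simp] theorem lformLin_apply (x y : LVec n) : lformLin n x y = lform x y := rfl

/-- The scalar product as a continuous bilinear map. -/
def lformCLM (n : ℕ) : LVec n →L[ℝ] LVec n →L[ℝ] ℝ := (lformLin n).toContinuousBilinearMap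

theorem lform_zero_left (x : LVec n) : lform 0 x = 0 := by simp [lform]

theorem lform_zero_right (x : LVec n) : lform x 0 = 0 := by simp [lform]

theorem lform_neg_right (x y : LVec n) : lform x (-y) = -lform x y := by
  simp [← lformLin_apply]

theorem lform_sub_left (x y z : LVec n) : lform (x - y) z = lform x z - lform y z := by
  simp [← lformLin_apply]

theorem lform_sub_right (x y z : LVec n) : lform x (y - z) = lform x y - lform x z := by
  simp [← lformLin_apply]

theorem lform_finset_sum_left {κ : Type*} (s : Finset κ) (x : κ → LVec n) (z : LVec n) :
    lform (∑ j ∈ s, x j) z = ∑ j ∈ s, lform (x j) z := by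
  simp [← lformLin_apply]

theorem lform_finset_sum_right {κ : Type*} (s : Finset κ) (x : κ → LVec n) (z : LVec n) :
    lform z (∑ j ∈ s, x j) = ∑ j ∈ s, lform z (x j) := by
  simp [← lformLin_apply]

theorem lform_nondegenerate {x : LVec n} (h : ∀ y, lform x y = 0) : x = 0 := by
  have hs : ∀ i : Fin (n + 1), x i.castSucc = 0 := by
    intro i
    have := h (Pi.single i.castSucc 1)
    simp [lform, Pi.single_apply, (Fin.castSucc_lt_last i).ne'] at this
    exact this
  have hl : x (Fin.last (n + 1)) = 0 := by
    have := h (Pi.single (Fin.last (n + 1)) 1)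
    simp [lform, Fin.castSucc_ne_last] at this
    exact this
  funext i
  refine Fin.lastCases hl (fun i => hs i) i

/-- The scalar product is positive semidefinite on the orthogonal complement of an isotropic
vector `y`, and its kernel there is spanned by `y`. -/
theorem lform_self_nonneg_of_isotropic {y v : LVec n} (hy : y ≠ 0) (hyy : lform y y = 0)
    (hyv : lform y v = 0) : 0 ≤ lform v v ∧ (lform v v = 0 → ∃ c : ℝ, v = c • y) := by
  have hl : y (Fin.last (n + 1)) ≠ 0 := by
    intro hl
    apply hy
    simp only [lform, hl, mul_zero, sub_zero] at hyy
    have := (Finset.sum_eq_zero_iff_of_nonneg fun i _ => mul_self_nonneg (y i.castSucc)).mp hyy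
    funext i
    refine Fin.lastCases hl (fun i => ?_) i
    simpa using this i (Finset.mem_univ _)
  -- Subtracting c y removes the timelike coordinate of v. It does not change (v, v), because y is
  -- isotropic and orthogonal to v, and what remains is a sum of squares.
  set c := v (Fin.last (n + 1)) / y (Fin.last (n + 1)) with hc
  have h1 : lform v v = lform (v - c • y) (v - c • y) := by
    simp only [lform_sub_left, lform_sub_right, lform_smul_left, lform_smul_right, hyy, hyv,
      lform_comm v y]
    ring
  have h0 : (v - c • y) (Fin.last (n + 1)) = 0 := by
    simp [hc, hl]
  have h2 : lform (v - c • y) (v - c • y) =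
      ∑ i : Fin (n + 1), (v - c • y) i.castSucc * (v - c • y) i.castSucc := by
    rw [lform, h0]; ring
  rw [h1, h2]
  refine ⟨Finset.sum_nonneg fun i _ => mul_self_nonneg _, fun h => ⟨c, ?_⟩⟩
  have := (Finset.sum_eq_zero_iff_of_nonneg fun i _ => mul_self_nonneg _).mp h
  rw [← sub_eq_zero]
  funext i
  refine Fin.lastCases h0 (fun i => ?_) i
  simpa using this i (Finset.mem_univ _)

end Form

/-! ### Directional derivatives -/

section Calculus

variable {E : Type*} [NormedAddCommGroup E] [NormedSpace ℝ E]
  {G : Type*} [NormedAddCommGroup G] [NormedSpace ℝ G]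

/-- The derivative in the constant direction `u`. -/
def pd (u : E) (F : E → G) : E → G := fun t => fderiv ℝ F t u

theorem contDiffAt_pd {F : E → G} {q : E} (u : E) (hF : ContDiffAt ℝ ∞ F q) :
    ContDiffAt ℝ ∞ (pd u F) q :=
  (hF.fderiv_right (m := ∞) (by simp)).clm_apply contDiffAt_const

theorem differentiableAt_of_smooth {F : E → G} {q : E} (hF : ContDiffAt ℝ ∞ F q) :
    DifferentiableAt ℝ F q := hF.differentiableAt (by simp)

theorem pd_comm {F : E → G} {q : E} (u v : E) (hF : ContDiffAt ℝ ∞ F q) :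
    pd u (pd v F) q = pd v (pd u F) q := by
  have h : DifferentiableAt ℝ (fderiv ℝ F) q :=
    differentiableAt_of_smooth (hF.fderiv_right (m := ∞) (by simp))
  have key : ∀ a b : E, pd a (pd b F) q = fderiv ℝ (fderiv ℝ F) q a b := by
    intro a b
    have : HasFDerivAt (pd b F) ((fderiv ℝ (fderiv ℝ F) q).flip b) q := by
      have := h.hasFDerivAt.clm_apply (hasFDerivAt_const b q)
      rw [ContinuousLinearMap.comp_zero, zero_add] at this
      exact this
    rw [pd, this.fderiv]
    rfl
  rw [key, key]
  exact hF.isSymmSndFDerivAt (by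
    simp only [minSmoothness_of_isRCLikeNormedField]
    exact WithTop.coe_le_coe.mpr le_top) u v

theorem pd_congr {F F' : E → G} {q : E} (u : E) (h : F =ᶠ[𝓝 q] F') : pd u F q = pd u F' q := by
  rw [pd, pd, h.fderiv_eq]

theorem pd_eventually_congr {F F' : E → G} {q : E} (u : E) (h : F =ᶠ[𝓝 q] F') :
    pd u F =ᶠ[𝓝 q] pd u F' := by
  filter_upwards [h.fderiv (𝕜 := ℝ)] with t ht
  rw [pd, pd, ht]

theorem pd_const (u : E) (c : G) (q : E) : pd u (fun _ => c) q = 0 := by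
  simp [pd]

theorem pd_add {F F' : E → G} {q : E} (u : E) (hF : DifferentiableAt ℝ F q)
    (hF' : DifferentiableAt ℝ F' q) :
    pd u (fun t => F t + F' t) q = pd u F q + pd u F' q := by
  simp [pd, fderiv_fun_add hF hF']

theorem pd_sub {F F' : E → G} {q : E} (u : E) (hF : DifferentiableAt ℝ F q)
    (hF' : DifferentiableAt ℝ F' q) :
    pd u (fun t => F t - F' t) q = pd u F q - pd u F' q := by
  simp [pd, fderiv_fun_sub hF hF']

theorem pd_sum {κ : Type*} (s : Finset κ) {F : κ → E → G} {q : E} (u : E)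
    (hF : ∀ i ∈ s, DifferentiableAt ℝ (F i) q) :
    pd u (fun t => ∑ i ∈ s, F i t) q = ∑ i ∈ s, pd u (F i) q := by
  simp [pd, fderiv_fun_sum hF]

theorem pd_smul {c : E → ℝ} {F : E → G} {q : E} (u : E) (hc : DifferentiableAt ℝ c q)
    (hF : DifferentiableAt ℝ F q) :
    pd u (fun t => c t • F t) q = pd u c q • F q + c q • pd u F q := by
  simp only [pd, fderiv_fun_smul hc hF]
  simp [add_comm]

theorem pd_mul {c F : E → ℝ} {q : E} (u : E) (hc : DifferentiableAt ℝ c q)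
    (hF : DifferentiableAt ℝ F q) :
    pd u (fun t => c t * F t) q = pd u c q * F q + c q * pd u F q := by
  have := pd_smul u hc hF
  simpa only [smul_eq_mul] using this

variable {n : ℕ}

theorem _root_.ContDiffAt.lform {k : WithTop ℕ∞} {F F' : E → LVec n} {q : E}
    (hF : ContDiffAt ℝ k F q)
    (hF' : ContDiffAt ℝ k F' q) : ContDiffAt ℝ k (fun t => lform (F t) (F' t)) q :=
  ((lformCLM n).contDiff.contDiffAt.comp q hF).clm_apply hF'

theorem pd_lform {F F' : E → LVec n} {q : E} (u : E) (hF : DifferentiableAt ℝ F q)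
    (hF' : DifferentiableAt ℝ F' q) :
    pd u (fun t => lform (F t) (F' t)) q = lform (pd u F q) (F' q) + lform (F q) (pd u F' q) := by
  have : fderiv ℝ (fun t => lform (F t) (F' t)) q = _ :=
    (lformCLM n).fderiv_of_bilinear hF hF'
  rw [pd, this]
  simp only [add_apply, ContinuousLinearMap.precompR_apply,
    ContinuousLinearMap.precompL_apply]
  rw [add_comm]
  rfl

theorem contDiffAt_det {κ : Type*} [Fintype κ] [DecidableEq κ] {k : WithTop ℕ∞}
    {M : E → Matrix κ κ ℝ} {q : E} (hM : ∀ i j, ContDiffAt ℝ k (fun t => M t i j) q) :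
    ContDiffAt ℝ k (fun t => (M t).det) q := by
  simp only [Matrix.det_apply]
  refine ContDiffAt.sum fun σ _ => ContDiffAt.const_smul _ (contDiffAt_prod fun i _ => hM _ _)

theorem contDiffAt_matrix_inv {κ : Type*} [Fintype κ] [DecidableEq κ] {k : WithTop ℕ∞}
    {M : E → Matrix κ κ ℝ} {q : E} (hM : ∀ i j, ContDiffAt ℝ k (fun t => M t i j) q)
    (hq : (M q).det ≠ 0) (i j : κ) : ContDiffAt ℝ k (fun t => (M t)⁻¹ i j) q := by
  simp only [Matrix.inv_def, Matrix.smul_apply, smul_eq_mul, Ring.inverse_eq_inv',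
    Matrix.adjugate_apply]
  refine ((contDiffAt_det hM).inv hq).mul (contDiffAt_det fun a b => ?_)
  by_cases hab : a = j
  · subst hab
    simp only [Matrix.updateRow_self]
    exact contDiffAt_const
  · simp only [Matrix.updateRow_ne hab]
    exact hM _ _

/-- Smooth dependence of the solution of a linear system on its coefficients. -/
theorem contDiffAt_of_mulVec {κ : Type*} [Fintype κ] [DecidableEq κ]
    {M : E → Matrix κ κ ℝ} {c θ : E → κ → ℝ} {q : E}
    (hM : ∀ i j, ContDiffAt ℝ ∞ (fun t => M t i j) q) (hq : (M q).det ≠ 0)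
    (hθ : ∀ i, ContDiffAt ℝ ∞ (fun t => θ t i) q)
    (h : ∀ᶠ t in 𝓝 q, ∀ i, θ t i = ∑ j, M t i j * c t j) (i : κ) :
    ContDiffAt ℝ ∞ (fun t => c t i) q := by
  have h1 : ContDiffAt ℝ ∞ (fun t => ∑ j, (M t)⁻¹ i j * θ t j) q :=
    ContDiffAt.sum fun j _ => (contDiffAt_matrix_inv hM hq i j).mul (hθ j)
  refine h1.congr_of_eventuallyEq ?_
  filter_upwards [h, (contDiffAt_det hM).continuousAt.eventually_ne hq] with t ht hd
  have : θ t = (M t).mulVec (c t) := funext ht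
  have h2 : c t = (M t)⁻¹.mulVec (θ t) := by
    rw [this, Matrix.mulVec_mulVec, Matrix.nonsing_inv_mul _ (isUnit_iff_ne_zero.mpr hd),
      Matrix.one_mulVec]
  exact congrFun h2 i

end Calculus

/-! ### Conformal bases -/

section Bases

variable {m r : ℕ} {e : FrameIdx m r → LVec (m + r + 1)}

/-- The matrix `g_{αβ}`. -/
def norGram (e : FrameIdx m r → LVec (m + r + 1)) : Matrix (Option (Fin m)) (Option (Fin m)) ℝ :=
  Matrix.of fun α β => lform (e (normalIdx α)) (e (normalIdx β))

/-- The matrix `g_{pq}`. -/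
def tanGram (e : FrameIdx m r → LVec (m + r + 1)) : Matrix (Fin r) (Fin r) ℝ :=
  Matrix.of fun p s => lform (e (.mid (.inr p))) (e (.mid (.inr s)))

theorem norGram_isSymm : (norGram e).IsSymm := by
  ext α β; exact lform_comm _ _

theorem tanGram_isSymm : (tanGram e).IsSymm := by
  ext α β; exact lform_comm _ _

theorem IsConformalBasis.tanGram_posDef (he : IsConformalBasis e) : (tanGram e).PosDef :=
  he.posDef.submatrix Sum.inr_injective

/-- A_n is a unit vector orthogonal to all A_a, so the matrix is an orthogonal sum of (1) and a
principal block of (g_{ij}). -/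
theorem IsConformalBasis.norGram_posDef (he : IsConformalBasis e) : (norGram e).PosDef := by
  have h1 := he.posDef.submatrix (Sum.inl_injective (α := Fin m) (β := Fin r))
  refine Matrix.PosDef.of_dotProduct_mulVec_pos ?_ fun x hx => ?_
  · rw [Matrix.IsHermitian, Matrix.conjTranspose_eq_transpose_of_trivial]
    exact norGram_isSymm
  · have hexp : dotProduct (star x) ((norGram e).mulVec x) = x none * x none +
        dotProduct (star fun a => x (some a))
          (((gram e).submatrix Sum.inl Sum.inl).mulVec fun a => x (some a)) := by
      simp [dotProduct, Matrix.mulVec, norGram, Fintype.sum_option, normalIdx, gram, he.pt_pt,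
        he.mid_pt, lform_comm (e .pt)]
    rw [hexp]
    by_cases hs : (fun a => x (some a)) = 0
    · have hn : x none ≠ 0 := by
        intro hn
        apply hx
        funext o
        cases o with
        | none => exact hn
        | some a => exact congrFun hs a
      rw [hs]
      simpa using mul_self_pos.mpr hn
    · have := h1.dotProduct_mulVec_pos hs
      nlinarith [mul_self_nonneg (x none)]

/-- The decomposition of a vector with respect to an adapted conformal basis. -/
theorem IsConformalBasis.expand (he : IsConformalBasis e) (w : LVec (m + r + 1)) :
    w = coeff e w .zero • e .zero + ∑ α, coeff e w (normalIdx α) • e (normalIdx α) +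
      ∑ p, coeff e w (.mid (.inr p)) • e (.mid (.inr p)) + coeff e w .top • e .top := by
  conv_lhs => rw [sum_coeff he w]
  rw [Fintype.sum_sum_type, Fintype.sum_option]
  simp only [normalIdx]
  abel

theorem coeff_zero_eq (w : LVec (m + r + 1)) : coeff e w .zero = -lform w (e .top) := rfl

theorem coeff_pt_eq (w : LVec (m + r + 1)) : coeff e w .pt = lform w (e .pt) := rfl

theorem coeff_top_eq (w : LVec (m + r + 1)) : coeff e w .top = -lform w (e .zero) := rfl

theorem IsConformalBasis.zero_normal (he : IsConformalBasis e) (α : Option (Fin m)) :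
    lform (e .zero) (e (normalIdx α)) = 0 := by
  cases α with
  | none => exact he.zero_pt
  | some a => exact he.zero_mid _

theorem IsConformalBasis.normal_top (he : IsConformalBasis e) (α : Option (Fin m)) :
    lform (e (normalIdx α)) (e .top) = 0 := by
  cases α with
  | none => exact he.pt_top
  | some a => exact he.mid_top _

theorem IsConformalBasis.normal_tan (he : IsConformalBasis e)
    (ho : ∀ a p, lform (e (.mid (.inl a))) (e (.mid (.inr p))) = 0)
    (α : Option (Fin m)) (p : Fin r) :
    lform (e (normalIdx α)) (e (.mid (.inr p))) = 0 := by
  cases α with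
  | none => exact (lform_comm _ _).trans (he.mid_pt _)
  | some a => exact ho _ _

theorem IsConformalBasis.lform_tan (he : IsConformalBasis e)
    (ho : ∀ a p, lform (e (.mid (.inl a))) (e (.mid (.inr p))) = 0)
    (w : LVec (m + r + 1)) (p : Fin r) :
    lform w (e (.mid (.inr p))) = ∑ s, coeff e w (.mid (.inr s)) * tanGram e s p := by
  conv_lhs => rw [he.expand w]
  simp only [lform_add_left, lform_smul_left, lform_finset_sum_left, he.zero_mid,
    he.normal_tan ho, lform_comm (e .top), he.mid_top]
  simp [tanGram]

theorem IsConformalBasis.lform_normal (he : IsConformalBasis e)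
    (ho : ∀ a p, lform (e (.mid (.inl a))) (e (.mid (.inr p))) = 0)
    (w : LVec (m + r + 1)) (β : Option (Fin m)) :
    lform w (e (normalIdx β)) = ∑ γ, coeff e w (normalIdx γ) * norGram e γ β := by
  conv_lhs => rw [he.expand w]
  simp only [lform_add_left, lform_smul_left, lform_finset_sum_left, he.zero_normal,
    lform_comm (e (.mid (.inr _))), he.normal_tan ho, lform_comm (e .top), he.normal_top]
  simp [norGram]

theorem coeff_add (e : FrameIdx m r → LVec (m + r + 1)) (v w : LVec (m + r + 1))
    (ξ : FrameIdx m r) : coeff e (v + w) ξ = coeff e v ξ + coeff e w ξ := by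
  cases ξ <;> simp only [coeff, lform_add_left, mul_add, Finset.sum_add_distrib] <;> ring

theorem coeff_smul (e : FrameIdx m r → LVec (m + r + 1)) (c : ℝ) (w : LVec (m + r + 1))
    (ξ : FrameIdx m r) : coeff e (c • w) ξ = c * coeff e w ξ := by
  cases ξ with
  | mid i =>
    simp only [coeff, lform_smul_left, Finset.mul_sum]
    exact Finset.sum_congr rfl fun _ _ => by ring
  | _ => simp only [coeff, lform_smul_left, mul_neg]

/-- A component of a vector as a linear function. -/
def coeffLin (e : FrameIdx m r → LVec (m + r + 1)) (ξ : FrameIdx m r) :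
    LVec (m + r + 1) →ₗ[ℝ] ℝ where
  toFun w := coeff e w ξ
  map_add' v w := coeff_add e v w ξ
  map_smul' c w := coeff_smul e c w ξ

theorem IsConformalBasis.coeff_eq (he : IsConformalBasis e) {w : LVec (m + r + 1)} {c0 cn ct : ℝ}
    {c : Fin m ⊕ Fin r → ℝ}
    (hw : w = c0 • e .zero + ∑ i, c i • e (.mid i) + cn • e .pt + ct • e .top) :
    coeff e w .zero = c0 ∧ (∀ i, coeff e w (.mid i) = c i) ∧ coeff e w .pt = cn ∧
      coeff e w .top = ct := by
  have hdet : IsUnit (gram e).det := he.posDef.isUnit.map Matrix.detMonoidHom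
  have key : ∀ η, lform w (e η) = c0 * lform (e .zero) (e η) +
      ∑ i, c i * lform (e (.mid i)) (e η) + cn * lform (e .pt) (e η) +
      ct * lform (e .top) (e η) := by
    intro η
    rw [hw]
    simp only [lform_add_left, lform_smul_left, lform_finset_sum_left]
  refine ⟨?_, fun i => ?_, ?_, ?_⟩
  · rw [coeff_zero_eq, key]
    simp [he.zero_top, he.mid_top, he.pt_top, he.top_top]
  · have : ∀ j, lform w (e (.mid j)) = (gram e).mulVec c j := by
      intro j
      rw [key]
      simp only [he.zero_mid, lform_comm (e .pt), he.mid_pt, lform_comm (e .top), he.mid_top,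
        Matrix.mulVec, dotProduct, gram, Matrix.of_apply, mul_zero, zero_add, add_zero]
      exact Finset.sum_congr rfl fun k _ => by rw [lform_comm, mul_comm]
    have h2 : coeff e w (.mid i) = ((gram e)⁻¹.mulVec ((gram e).mulVec c)) i := by
      simp only [coeff, this]; rfl
    rw [h2, Matrix.mulVec_mulVec, Matrix.nonsing_inv_mul _ hdet, Matrix.one_mulVec]
  · rw [coeff_pt_eq, key]
    simp [he.zero_pt, he.mid_pt, he.pt_pt, lform_comm (e .top), he.pt_top]
  · rw [coeff_top_eq, key]
    simp [he.zero_zero, lform_comm (e .top), he.zero_top, lform_comm (e .pt), he.zero_pt,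
      lform_comm (e (.mid _)), he.zero_mid]

/-- A vector orthogonal to all elements of the hyperplane `e_0^⊥` is a multiple of `e_0`. -/
theorem IsConformalBasis.eq_smul_zero (he : IsConformalBasis e) {w : LVec (m + r + 1)}
    (h0 : lform w (e .zero) = 0) (hm : ∀ i, lform w (e (.mid i)) = 0)
    (hp : lform w (e .pt) = 0) : w = (-lform w (e .top)) • e .zero := by
  conv_lhs => rw [sum_coeff he w]
  simp [coeff, h0, hm, hp]

end Bases

/-! ### Smoothness and infinitesimal invariance of the relative invariant -/

section InvariantCalculus

variable {m r : ℕ} {X : Type*} [NormedAddCommGroup X] [NormedSpace ℝ X]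

theorem contDiffAt_traceFree {g : X → Matrix (Fin r) (Fin r) ℝ}
    {Λ : X → Option (Fin m) → Matrix (Fin r) (Fin r) ℝ} {x : X}
    (hg : ∀ p s, ContDiffAt ℝ ∞ (fun t => g t p s) x) (hgx : (g x).det ≠ 0)
    (hΛ : ∀ α p s, ContDiffAt ℝ ∞ (fun t => Λ t α p s) x) (α : Option (Fin m)) (p s : Fin r) :
    ContDiffAt ℝ ∞ (fun t => traceFree (g t) (Λ t) α p s) x := by
  simp only [traceFree, Matrix.sub_apply, Matrix.smul_apply, smul_eq_mul]
  exact (hΛ α p s).sub ((contDiffAt_const.mul (ContDiffAt.sum fun i _ => ContDiffAt.sum fun j _ =>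
    (contDiffAt_matrix_inv hg hgx i j).mul (hΛ α i j))).mul (hg p s))

theorem contDiffAt_upperTensor {g : X → Matrix (Fin r) (Fin r) ℝ}
    {Λ : X → Option (Fin m) → Matrix (Fin r) (Fin r) ℝ} {x : X}
    (hg : ∀ p s, ContDiffAt ℝ ∞ (fun t => g t p s) x) (hgx : (g x).det ≠ 0)
    (hΛ : ∀ α p s, ContDiffAt ℝ ∞ (fun t => Λ t α p s) x) (α β : Option (Fin m)) :
    ContDiffAt ℝ ∞ (fun t => upperTensor (g t) (Λ t) α β) x := by
  simp only [upperTensor, Matrix.of_apply]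
  exact ContDiffAt.sum fun i _ => ContDiffAt.sum fun j _ => ContDiffAt.sum fun k _ =>
    ContDiffAt.sum fun l _ => (((contDiffAt_matrix_inv hg hgx i j).mul
      (contDiffAt_matrix_inv hg hgx k l)).mul (contDiffAt_traceFree hg hgx hΛ α i k)).mul
      (contDiffAt_traceFree hg hgx hΛ β j l)

theorem contDiffAt_sumDiagMinors {κ : Type*} [Fintype κ] [DecidableEq κ] {M : X → Matrix κ κ ℝ}
    {x : X} (ρ : ℕ) (hM : ∀ i j, ContDiffAt ℝ ∞ (fun t => M t i j) x) :
    ContDiffAt ℝ ∞ (fun t => sumDiagMinors ρ (M t)) x := by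
  unfold sumDiagMinors
  exact ContDiffAt.sum fun S _ => contDiffAt_det fun i j => hM i j

theorem contDiffAt_lowInv {g : X → Matrix (Fin r) (Fin r) ℝ}
    {h : X → Matrix (Option (Fin m)) (Option (Fin m)) ℝ}
    {Λ : X → Option (Fin m) → Matrix (Fin r) (Fin r) ℝ} {x : X} (ρ : ℕ)
    (hh : ∀ p s, ContDiffAt ℝ ∞ (fun t => h t p s) x) (hhx : (h x).det ≠ 0)
    (hg : ∀ p s, ContDiffAt ℝ ∞ (fun t => g t p s) x) (hgx : (g x).det ≠ 0)
    (hΛ : ∀ α p s, ContDiffAt ℝ ∞ (fun t => Λ t α p s) x) :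
    ContDiffAt ℝ ∞ (fun t => lowInv ρ (h t) (g t) (Λ t)) x := by
  unfold lowInv
  refine contDiffAt_sumDiagMinors ρ fun i j => ?_
  simp only [Matrix.mul_apply]
  exact ContDiffAt.sum fun k _ => (contDiffAt_upperTensor hg hgx hΛ i k).mul
    (contDiffAt_matrix_inv hh hhx k j)

variable (m r) in
/-- The space of triples `(g_{αβ}, g_{pq}, λ_{βpq})`. -/
abbrev TensorTriple : Type :=
  (Option (Fin m) → Option (Fin m) → ℝ) × (Fin r → Fin r → ℝ) ×
    (Option (Fin m) → Fin r → Fin r → ℝ)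

/-- The relative invariant on the space of triples. -/
def tripleInv (ρ : ℕ) (x : TensorTriple m r) : ℝ :=
  lowInv ρ (Matrix.of x.1) (Matrix.of x.2.1) (fun β => Matrix.of (x.2.2 β))

theorem contDiffAt_tripleInv (ρ : ℕ) {x : TensorTriple m r} (hh : (Matrix.of x.1).det ≠ 0)
    (hg : (Matrix.of x.2.1).det ≠ 0) : ContDiffAt ℝ ∞ (tripleInv (m := m) (r := r) ρ) x := by
  have h1 : ∀ i j, ContDiffAt ℝ ∞ (fun y : TensorTriple m r => y.1 i j) x := fun i j =>
    (contDiff_apply_apply ℝ ℝ i j).contDiffAt.comp x contDiffAt_fst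
  have h2 : ∀ i j, ContDiffAt ℝ ∞ (fun y : TensorTriple m r => y.2.1 i j) x := fun i j =>
    (contDiff_apply_apply ℝ ℝ i j).contDiffAt.comp x (contDiffAt_fst.comp x contDiffAt_snd)
  have h3 : ∀ β i j, ContDiffAt ℝ ∞ (fun y : TensorTriple m r => y.2.2 β i j) x := fun β i j =>
    (contDiff_apply_apply ℝ ℝ i j).contDiffAt.comp x
      ((contDiff_apply ℝ (Fin r → Fin r → ℝ) β).contDiffAt.comp x
        (contDiffAt_snd.comp x contDiffAt_snd))
  have h4 := contDiffAt_lowInv (X := TensorTriple m r) (x := x) (h := fun x => Matrix.of x.1)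
    (g := fun x => Matrix.of x.2.1) (Λ := fun x β => Matrix.of (x.2.2 β)) ρ
    (fun i j => h1 i j) hh (fun i j => h2 i j) hg (fun β i j => h3 β i j)
  exact h4

theorem hasDerivAt_conj {κ : Type*} [Fintype κ] [DecidableEq κ] (Θ M : Matrix κ κ ℝ) (i j : κ) :
    HasDerivAt (fun τ : ℝ => ((1 + τ • Θ) * M * (1 + τ • Θ).transpose) i j)
      ((Θ * M + M * Θ.transpose) i j) 0 := by
  have h : ∀ τ : ℝ, ((1 + τ • Θ) * M * (1 + τ • Θ).transpose) i j =
      M i j + τ * (Θ * M + M * Θ.transpose) i j + τ ^ 2 * (Θ * M * Θ.transpose) i j := by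
    intro τ
    have : (1 + τ • Θ) * M * (1 + τ • Θ).transpose =
        M + τ • (Θ * M + M * Θ.transpose) + τ ^ 2 • (Θ * M * Θ.transpose) := by
      simp only [Matrix.transpose_add, Matrix.transpose_one, Matrix.transpose_smul, add_mul,
        mul_add, Matrix.smul_mul, Matrix.mul_smul, one_mul, mul_one, pow_two, smul_add, smul_smul]
      abel
    rw [this]
    simp only [Matrix.add_apply, Matrix.smul_apply, smul_eq_mul]
  simp only [h]
  have h1 := ((hasDerivAt_id (0 : ℝ)).mul_const ((Θ * M + M * Θ.transpose) i j)).const_add (M i j)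
  have h2 := ((hasDerivAt_id (0 : ℝ)).fun_pow 2).mul_const ((Θ * M * Θ.transpose) i j)
  have h3 := h1.fun_add h2
  simpa using h3

/-- The derivative of the relative invariant along the infinitesimal action of the structure
group. -/
theorem fderiv_tripleInv_orbit (ρ : ℕ) {h : Matrix (Option (Fin m)) (Option (Fin m)) ℝ}
    {g : Matrix (Fin r) (Fin r) ℝ} (Λ : Option (Fin m) → Matrix (Fin r) (Fin r) ℝ)
    (hh : h.det ≠ 0) (hg : g.det ≠ 0) (hgs : g.IsSymm)
    (Ω : Matrix (Option (Fin m)) (Option (Fin m)) ℝ) (Θ : Matrix (Fin r) (Fin r) ℝ) (w : ℝ)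
    (κ : Option (Fin m) → ℝ) :
    fderiv ℝ (tripleInv ρ) ((h, g, Λ) : TensorTriple m r)
      ((Ω * h + h * Ω.transpose : Matrix _ _ ℝ), (Θ * g + g * Θ.transpose : Matrix _ _ ℝ),
        fun β p s => (∑ γ, Ω β γ * Λ γ p s) + (Θ * Λ β + Λ β * Θ.transpose) p s - w * Λ β p s -
          κ β * g p s) = -(2 * ρ * w) * lowInv ρ h g Λ := by
  let C : ℝ → Matrix (Option (Fin m)) (Option (Fin m)) ℝ := fun τ => 1 + τ • Ω
  let D : ℝ → Matrix (Fin r) (Fin r) ℝ := fun τ => 1 + τ • Θ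
  -- A curve in the orbit of the structure group whose velocity at 0 is the given vector. By
  -- `lowInv_gauge` the invariant along it is (1 - τw)^{2ρ} times its initial value, and the chain
  -- rule compares the two derivatives.
  let χ : ℝ → TensorTriple m r := fun τ =>
    (C τ * h * (C τ).transpose, D τ * g * (D τ).transpose,
      fun β p s => ((1 - τ * w) • ∑ γ, C τ β γ • (D τ * Λ γ * (D τ).transpose) +
        (-(τ * κ β)) • (D τ * g * (D τ).transpose)) p s)
  have hχ0 : χ 0 = (h, g, Λ) := by
    simp only [χ, C, D, zero_smul, add_zero, Matrix.transpose_one, Matrix.mul_one, Matrix.one_mul,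
      zero_mul, sub_zero, one_smul, neg_zero]
    refine Prod.ext rfl (Prod.ext rfl (funext fun β => funext fun p => funext fun s => ?_))
    change (∑ γ, (1 : Matrix (Option (Fin m)) (Option (Fin m)) ℝ) β γ • Λ γ) p s = Λ β p s
    rw [Matrix.sum_apply]
    simp only [Matrix.smul_apply, smul_eq_mul, Matrix.one_apply, ite_mul, one_mul, zero_mul,
      Finset.sum_ite_eq, Finset.mem_univ, if_true]
  have hχ : HasDerivAt χ
      ((Ω * h + h * Ω.transpose : Matrix _ _ ℝ), (Θ * g + g * Θ.transpose : Matrix _ _ ℝ),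
        fun β p s => (∑ γ, Ω β γ * Λ γ p s) + (Θ * Λ β + Λ β * Θ.transpose) p s - w * Λ β p s -
          κ β * g p s) 0 := by
    refine HasDerivAt.prodMk (hasDerivAt_pi.mpr fun i => hasDerivAt_pi.mpr fun j =>
      hasDerivAt_conj Ω h i j) (HasDerivAt.prodMk (hasDerivAt_pi.mpr fun i =>
      hasDerivAt_pi.mpr fun j => hasDerivAt_conj Θ g i j) (hasDerivAt_pi.mpr fun β =>
      hasDerivAt_pi.mpr fun p => hasDerivAt_pi.mpr fun s => ?_))
    have h1 : HasDerivAt (fun τ : ℝ => 1 - τ * w) (-w) 0 := by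
      simpa using ((hasDerivAt_id (0 : ℝ)).mul_const w).const_sub 1
    have h2 : ∀ γ, HasDerivAt (fun τ : ℝ => C τ β γ) (Ω β γ) 0 := by
      intro γ
      have := ((hasDerivAt_id (0 : ℝ)).mul_const (Ω β γ)).const_add
        ((1 : Matrix (Option (Fin m)) (Option (Fin m)) ℝ) β γ)
      simpa [C] using this
    have h3 : HasDerivAt (fun τ : ℝ => -(τ * κ β)) (-κ β) 0 := by
      simpa using ((hasDerivAt_id (0 : ℝ)).mul_const (κ β)).fun_neg
    have h4 := (h1.fun_mul (HasDerivAt.fun_sum fun γ (_ : γ ∈ Finset.univ) =>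
      (h2 γ).fun_mul (hasDerivAt_conj Θ (Λ γ) p s))).fun_add
        (h3.fun_mul (hasDerivAt_conj Θ g p s))
    refine (h4.congr_deriv ?_).congr_of_eventuallyEq (Filter.Eventually.of_forall fun τ => ?_)
    · simp [C, Finset.sum_add_distrib, Matrix.one_apply]
      ring
    · simp only [D, Matrix.sum_apply, Matrix.add_apply, Matrix.smul_apply, smul_eq_mul]
  have hΨ : DifferentiableAt ℝ (tripleInv ρ) (χ 0) := by
    rw [hχ0]
    exact (contDiffAt_tripleInv ρ (x := (h, g, Λ)) hh hg).differentiableAt (by simp)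
  have hcomp := hΨ.hasFDerivAt.comp_hasDerivAt 0 hχ
  rw [hχ0] at hcomp
  -- The transformation law requires invertible 1 + τΩ and 1 + τΘ, which holds for small τ.
  have hdet : ∀ {κ : Type} [Fintype κ] [DecidableEq κ] (M : Matrix κ κ ℝ),
      ∀ᶠ τ in 𝓝 (0 : ℝ), IsUnit (1 + τ • M).det := by
    intro κ _ _ M
    have hc : ContDiffAt ℝ ∞ (fun τ : ℝ => (1 + τ • M).det) 0 := by
      refine contDiffAt_det fun i j => ?_
      simp only [Matrix.add_apply, Matrix.smul_apply, smul_eq_mul]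
      fun_prop
    filter_upwards [hc.continuousAt.eventually_ne
      (by simp : (1 + (0 : ℝ) • M).det ≠ 0)] with τ hτ
    exact isUnit_iff_ne_zero.mpr hτ
  have hpow : HasDerivAt (fun τ : ℝ => (1 - τ * w) ^ (2 * ρ) * lowInv ρ h g Λ)
      (-(2 * ρ * w) * lowInv ρ h g Λ) 0 := by
    have h1 : HasDerivAt (fun τ : ℝ => 1 - τ * w) (-w) 0 := by
      simpa using ((hasDerivAt_id (0 : ℝ)).mul_const w).const_sub 1
    refine ((h1.pow (2 * ρ)).mul_const (lowInv ρ h g Λ)).congr_deriv ?_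
    simp
  refine hcomp.unique (hpow.congr_of_eventuallyEq ?_)
  filter_upwards [hdet Ω, hdet Θ] with τ h1 h2
  exact lowInv_gauge (isUnit_iff_ne_zero.mpr hg) hgs h2 (1 - τ * w) h1 ρ (fun β => -(τ * κ β)) Λ

end InvariantCalculus

/-! ### Adapted frames over open subsets of a vector space -/

section LocalTheory

variable {m r : ℕ} {E : Type*} [NormedAddCommGroup E] [NormedSpace ℝ E]

/-- The forms `ω_ξ^η` of a moving frame over a vector space. -/
def om (A : FrameIdx m r → E → LVec (m + r + 1)) (ξ η : FrameIdx m r) (u t : E) : ℝ :=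
  coeff (fun ζ => A ζ t) (pd u (A ξ) t) η

theorem om_add (A : FrameIdx m r → E → LVec (m + r + 1)) (ξ η : FrameIdx m r) (u v t : E) :
    om A ξ η (u + v) t = om A ξ η u t + om A ξ η v t := by
  simp only [om, pd, map_add, coeff_add]

theorem om_smul (A : FrameIdx m r → E → LVec (m + r + 1)) (ξ η : FrameIdx m r) (c : ℝ) (v t : E) :
    om A ξ η (c • v) t = c * om A ξ η v t := by
  simp only [om, pd, map_smul, coeff_smul]

/-- The forms `ω_ξ^η` as linear functions of the direction. -/
def omLin (A : FrameIdx m r → E → LVec (m + r + 1)) (ξ η : FrameIdx m r) (t : E) : E →ₗ[ℝ] ℝ where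
  toFun u := om A ξ η u t
  map_add' u v := om_add A ξ η u v t
  map_smul' c v := om_smul A ξ η c v t

@[simp] theorem omLin_apply (A : FrameIdx m r → E → LVec (m + r + 1)) (ξ η : FrameIdx m r)
    (t u : E) : omLin A ξ η t u = om A ξ η u t := rfl

/-- An adapted frame of an immersed lightlike hypersurface with reduced rank, over an open subset
of a vector space. -/
structure LocalFrame (A : FrameIdx m r → E → LVec (m + r + 1)) (U : Set E) : Prop where
  isOpen : IsOpen U
  smooth : ∀ ξ, ∀ t ∈ U, ContDiffAt ℝ ∞ (A ξ) t
  basis : ∀ t ∈ U, IsConformalBasis fun ξ => A ξ t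
  orthogonal : ∀ t ∈ U, ∀ a p, lform (A (.mid (.inl a)) t) (A (.mid (.inr p)) t) = 0
  normal_zero : ∀ t ∈ U, ∀ α u, lform (pd u (A (normalIdx α)) t) (A .zero t) = 0
  surj : ∀ t ∈ U, ∀ w, lform w (A .zero t) = 0 → lform w (A .pt t) = 0 → ∃ u, pd u (A .pt) t = w
  indep : ∀ t ∈ U, ∀ c : Fin r → ℝ, ∃ u, ∀ p, om A .zero (.mid (.inr p)) u t = c p

theorem lform_pd_of_const {n : ℕ} {F F' : E → LVec n} {t : E} (u : E) {c : ℝ}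
    (hF : ContDiffAt ℝ ∞ F t)
    (hF' : ContDiffAt ℝ ∞ F' t) (hc : ∀ᶠ s in 𝓝 t, lform (F s) (F' s) = c) :
    lform (pd u F t) (F' t) = -lform (F t) (pd u F' t) := by
  have h1 := pd_lform u (differentiableAt_of_smooth hF) (differentiableAt_of_smooth hF')
  have h2 : pd u (fun s => lform (F s) (F' s)) t = 0 := by
    rw [pd_congr u (F' := fun _ => c) hc, pd_const]
  linarith

namespace LocalFrame

variable {A : FrameIdx m r → E → LVec (m + r + 1)} {U : Set E} (h : LocalFrame A U) {t : E}
  (ht : t ∈ U)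

include h in
theorem congr {A' : FrameIdx m r → E → LVec (m + r + 1)} {U' : Set E} (hU' : IsOpen U')
    (hsub : U' ⊆ U) (hA : ∀ ξ, ∀ t ∈ U', A' ξ t = A ξ t) : LocalFrame A' U' := by
  have hev : ∀ ξ, ∀ t ∈ U', A' ξ =ᶠ[𝓝 t] A ξ := fun ξ t ht =>
    Filter.eventuallyEq_of_mem (hU'.mem_nhds ht) fun s hs => hA ξ s hs
  have hpd : ∀ ξ u, ∀ t ∈ U', pd u (A' ξ) t = pd u (A ξ) t := fun ξ u t ht =>
    pd_congr u (hev ξ t ht)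
  have hfun : ∀ t ∈ U', (fun ξ => A' ξ t) = fun ξ => A ξ t := fun t ht =>
    funext fun ξ => hA ξ t ht
  refine ⟨hU', fun ξ t ht => (h.smooth ξ t (hsub ht)).congr_of_eventuallyEq (hev ξ t ht),
    fun t ht => ?_, fun t ht a p => ?_, fun t ht α u => ?_, fun t ht w h1 h2 => ?_,
    fun t ht c => ?_⟩
  · rw [hfun t ht]; exact h.basis t (hsub ht)
  · rw [hA _ t ht, hA _ t ht]; exact h.orthogonal t (hsub ht) a p
  · rw [hpd _ _ t ht, hA _ t ht]; exact h.normal_zero t (hsub ht) α u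
  · rw [hA _ t ht] at h1 h2
    obtain ⟨u, hu⟩ := h.surj t (hsub ht) w h1 h2
    exact ⟨u, by rw [hpd _ _ t ht, hu]⟩
  · obtain ⟨u, hu⟩ := h.indep t (hsub ht) c
    refine ⟨u, fun p => ?_⟩
    rw [om, hpd _ _ t ht, hfun t ht]
    exact hu p

include h ht

theorem eventually_mem : ∀ᶠ s in 𝓝 t, s ∈ U := h.isOpen.mem_nhds ht

theorem diff (ξ : FrameIdx m r) : DifferentiableAt ℝ (A ξ) t :=
  differentiableAt_of_smooth (h.smooth ξ t ht)

theorem contDiffAt_gram (i j : Fin m ⊕ Fin r) :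
    ContDiffAt ℝ ∞ (fun s => gram (fun ζ => A ζ s) i j) t :=
  (h.smooth _ t ht).lform (h.smooth _ t ht)

theorem contDiffAt_coeff {w : E → LVec (m + r + 1)} (hw : ContDiffAt ℝ ∞ w t) (η : FrameIdx m r) :
    ContDiffAt ℝ ∞ (fun s => coeff (fun ζ => A ζ s) (w s) η) t := by
  cases η with
  | zero => exact (hw.lform (h.smooth _ t ht)).neg
  | pt => exact hw.lform (h.smooth _ t ht)
  | top => exact (hw.lform (h.smooth _ t ht)).neg
  | mid i =>
    refine ContDiffAt.sum fun j _ => ContDiffAt.mul ?_ (hw.lform (h.smooth _ t ht))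
    exact contDiffAt_matrix_inv (fun i j => h.contDiffAt_gram ht i j)
      (h.basis t ht).posDef.det_pos.ne' i j

theorem contDiffAt_om (ξ η : FrameIdx m r) (u : E) : ContDiffAt ℝ ∞ (om A ξ η u) t :=
  h.contDiffAt_coeff ht (contDiffAt_pd u (h.smooth ξ t ht)) η

theorem lform_pd (ξ η : FrameIdx m r) {c : ℝ} (hc : ∀ s ∈ U, lform (A ξ s) (A η s) = c) (u : E) :
    lform (pd u (A ξ) t) (A η t) = -lform (A ξ t) (pd u (A η) t) :=
  lform_pd_of_const u (h.smooth _ t ht) (h.smooth _ t ht)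
    ((h.eventually_mem ht).mono fun s hs => hc s hs)

theorem pd_zero_normal (α : Option (Fin m)) (u : E) :
    lform (pd u (A .zero) t) (A (normalIdx α) t) = 0 := by
  rw [h.lform_pd ht .zero (normalIdx α) (c := 0) (fun s hs => (h.basis s hs).zero_normal α),
    lform_comm, h.normal_zero t ht, neg_zero]

theorem pd_zero_zero (u : E) : lform (pd u (A .zero) t) (A .zero t) = 0 := by
  have := h.lform_pd ht .zero .zero (c := 0) (fun s hs => (h.basis s hs).zero_zero) u
  rw [lform_comm (A .zero t)] at this
  linarith

/-- In an adapted basis the A_α are orthogonal to all other basis vectors, so the A_α-components of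
w follow from its products with the A_β by inverting (g_{αβ}). -/
theorem eq_zero_of_lform_normal {w : LVec (m + r + 1)}
    (hw : ∀ β, lform w (A (normalIdx β) t) = 0) (α : Option (Fin m)) :
    coeff (fun ζ => A ζ t) w (normalIdx α) = 0 := by
  have hb := h.basis t ht
  have hdet : IsUnit (norGram fun ζ => A ζ t).det := isUnit_iff_ne_zero.mpr hb.norGram_posDef.det_pos.ne'
  have h1 : Matrix.vecMul (fun γ => coeff (fun ζ => A ζ t) w (normalIdx γ))
      (norGram fun ζ => A ζ t) = 0 := by
    funext β
    simpa [Matrix.vecMul, dotProduct] using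
      (hb.lform_normal (h.orthogonal t ht) w β).symm.trans (hw β)
  have h2 := congrArg (fun x => Matrix.vecMul x (norGram fun ζ => A ζ t)⁻¹) h1
  simp only [Matrix.vecMul_vecMul, Matrix.mul_nonsing_inv _ hdet, Matrix.vecMul_one,
    Matrix.zero_vecMul] at h2
  exact congrFun h2 α

theorem eq_zero_of_lform_tan {w : LVec (m + r + 1)}
    (hw : ∀ p, lform w (A (.mid (.inr p)) t) = 0) (s : Fin r) :
    coeff (fun ζ => A ζ t) w (.mid (.inr s)) = 0 := by
  have hb := h.basis t ht
  have hdet : IsUnit (tanGram fun ζ => A ζ t).det := isUnit_iff_ne_zero.mpr hb.tanGram_posDef.det_pos.ne'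
  have h1 : Matrix.vecMul (fun γ => coeff (fun ζ => A ζ t) w (.mid (.inr γ)))
      (tanGram fun ζ => A ζ t) = 0 := by
    funext β
    simpa [Matrix.vecMul, dotProduct] using
      (hb.lform_tan (h.orthogonal t ht) w β).symm.trans (hw β)
  have h2 := congrArg (fun x => Matrix.vecMul x (tanGram fun ζ => A ζ t)⁻¹) h1
  simp only [Matrix.vecMul_vecMul, Matrix.mul_nonsing_inv _ hdet, Matrix.vecMul_one,
    Matrix.zero_vecMul] at h2
  exact congrFun h2 s

/-- A_0 is isotropic, and (dA_0, A_α) = -(A_0, dA_α) = 0 because ω_α^{n+1} = 0; only the A_0- and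
A_p-components survive. Thus the directions annihilated by all ω_0^p are those in which the point
A_0 stands still. -/
theorem pd_zero (u : E) : pd u (A .zero) t = om A .zero .zero u t • A .zero t +
    ∑ p, om A .zero (.mid (.inr p)) u t • A (.mid (.inr p)) t := by
  conv_lhs => rw [(h.basis t ht).expand (pd u (A .zero) t)]
  have h1 : coeff (fun ζ => A ζ t) (pd u (A .zero) t) .top = 0 := by
    rw [coeff_top_eq, h.pd_zero_zero ht, neg_zero]
  simp only [h1, h.eq_zero_of_lform_normal ht fun β => h.pd_zero_normal ht β u, zero_smul,
    Finset.sum_const_zero, add_zero]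
  rfl

theorem coeff_self_zero (ξ : FrameIdx m r) : coeff (fun ζ => A ζ t) (A .zero t) ξ =
    match ξ with | .zero => 1 | _ => 0 := by
  have := (h.basis t ht).coeff_eq (w := A .zero t) (c0 := 1) (cn := 0) (ct := 0) (c := 0) (by simp)
  cases ξ with
  | zero => exact this.1
  | mid i => exact this.2.1 i
  | pt => exact this.2.2.1
  | top => exact this.2.2.2

theorem coeff_self_mid (i : Fin m ⊕ Fin r) (ξ : FrameIdx m r) :
    coeff (fun ζ => A ζ t) (A (.mid i) t) ξ =
    match ξ with | .mid j => if j = i then 1 else 0 | _ => 0 := by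
  have := (h.basis t ht).coeff_eq (w := A (.mid i) t) (c0 := 0) (cn := 0) (ct := 0)
    (c := fun j => if j = i then 1 else 0) (by simp)
  cases ξ with
  | zero => exact this.1
  | mid i => exact this.2.1 i
  | pt => exact this.2.2.1
  | top => exact this.2.2.2

theorem pd_pd_zero (u v : E) : pd u (pd v (A .zero)) t =
    pd u (om A .zero .zero v) t • A .zero t + om A .zero .zero v t • pd u (A .zero) t +
    ∑ p, (pd u (om A .zero (.mid (.inr p)) v) t • A (.mid (.inr p)) t +
      om A .zero (.mid (.inr p)) v t • pd u (A (.mid (.inr p))) t) := by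
  have hev : pd v (A .zero) =ᶠ[𝓝 t] fun s => om A .zero .zero v s • A .zero s +
      ∑ p, om A .zero (.mid (.inr p)) v s • A (.mid (.inr p)) s := by
    filter_upwards [h.eventually_mem ht] with s hs using h.pd_zero hs v
  have hd := fun ξ η => differentiableAt_of_smooth (h.contDiffAt_om ht ξ η v)
  rw [pd_congr u hev, pd_add u ((hd _ _).fun_smul (h.diff ht _))
    (DifferentiableAt.fun_sum fun p _ => (hd _ _).fun_smul (h.diff ht _)),
    pd_smul u (hd _ _) (h.diff ht _), pd_sum _ u fun p _ => (hd _ _).fun_smul (h.diff ht _)]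
  congr 1
  exact Finset.sum_congr rfl fun p _ => pd_smul u (hd _ _) (h.diff ht _)

/-- The second fundamental forms `(d²A_0, A_α)`. -/
theorem second_form (u v : E) (α : Option (Fin m)) :
    lform (pd u (pd v (A .zero)) t) (A (normalIdx α) t) =
    ∑ p, om A .zero (.mid (.inr p)) v t *
      lform (pd u (A (.mid (.inr p))) t) (A (normalIdx α) t) := by
  rw [h.pd_pd_zero ht u v]
  simp only [lform_add_left, lform_smul_left, lform_finset_sum_left, (h.basis t ht).zero_normal,
    h.pd_zero_normal ht, lform_comm (A (.mid (.inr _)) t),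
    (h.basis t ht).normal_tan (h.orthogonal t ht), mul_zero, zero_add]

theorem second_form_symm (u v : E) (α : Option (Fin m)) :
    ∑ p, om A .zero (.mid (.inr p)) v t *
      lform (pd u (A (.mid (.inr p))) t) (A (normalIdx α) t) =
    ∑ p, om A .zero (.mid (.inr p)) u t *
      lform (pd v (A (.mid (.inr p))) t) (A (normalIdx α) t) := by
  rw [← h.second_form ht, ← h.second_form ht, pd_comm u v (h.smooth _ t ht)]

/-- In the symmetry relation take u dual to ω_0^p: one side becomes the required product, the other
carries the factors ω_0^q(v) = 0. This is why the ω_p^α are combinations of the ω_0^q, that is, why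
λ exists. -/
theorem lform_tan_normal_of_kernel {v : E} (hv : ∀ p, om A .zero (.mid (.inr p)) v t = 0)
    (p : Fin r) (α : Option (Fin m)) :
    lform (pd v (A (.mid (.inr p))) t) (A (normalIdx α) t) = 0 := by
  obtain ⟨u, hu⟩ := h.indep t ht (Pi.single p 1)
  have := h.second_form_symm ht u v α
  simp only [hv, hu, Pi.single_apply] at this
  simpa using this.symm

theorem om_tan_normal_of_kernel {v : E} (hv : ∀ p, om A .zero (.mid (.inr p)) v t = 0)
    (p : Fin r) (α : Option (Fin m)) : om A (.mid (.inr p)) (normalIdx α) v t = 0 :=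
  h.eq_zero_of_lform_normal ht (h.lform_tan_normal_of_kernel ht hv p) α

/-- There are directions dual to the forms `ω_0^p`. -/
theorem exists_dual : ∃ W : Fin r → E, ∀ p s, om A .zero (.mid (.inr p)) (W s) t =
    if p = s then 1 else 0 := by
  choose W hW using fun s : Fin r => h.indep t ht (fun p => if p = s then 1 else 0)
  exact ⟨W, fun p s => hW s p⟩

omit h ht in
theorem om_eq_sum_of_vanish {W : Fin r → E}
    (hW : ∀ p s, om A .zero (.mid (.inr p)) (W s) t = if p = s then 1 else 0)
    (ℓ : E →ₗ[ℝ] ℝ) (hℓ : ∀ v, (∀ p, om A .zero (.mid (.inr p)) v t = 0) → ℓ v = 0) (u : E) :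
    ℓ u = ∑ s, ℓ (W s) * om A .zero (.mid (.inr s)) u t := by
  have h1 := hℓ (u - ∑ s, om A .zero (.mid (.inr s)) u t • W s) fun p => by
    rw [← omLin_apply, map_sub, map_sum]
    simp only [map_smul, smul_eq_mul, omLin_apply, hW]
    simp
  rw [map_sub, map_sum, sub_eq_zero] at h1
  rw [h1]
  exact Finset.sum_congr rfl fun s _ => by rw [map_smul, smul_eq_mul, mul_comm]

/-- A one-form vanishing along the generators is a combination of the `ω_0^p`. -/
theorem exists_coeff_of_vanish (ℓ : E →ₗ[ℝ] ℝ)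
    (hℓ : ∀ v, (∀ p, om A .zero (.mid (.inr p)) v t = 0) → ℓ v = 0) :
    ∃ c : Fin r → ℝ, ∀ u, ℓ u = ∑ s, c s * om A .zero (.mid (.inr s)) u t := by
  obtain ⟨W, hW⟩ := h.exists_dual ht
  exact ⟨_, om_eq_sum_of_vanish hW ℓ hℓ⟩

/-- The coefficients of a smooth one-form with respect to the `ω_0^p` are smooth. -/
theorem contDiffAt_of_combination {θ : E → E → ℝ} {c : E → Fin r → ℝ}
    (hθ : ∀ u, ContDiffAt ℝ ∞ (θ u) t)
    (hc : ∀ s ∈ U, ∀ u, θ u s = ∑ p, c s p * om A .zero (.mid (.inr p)) u s) (p : Fin r) :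
    ContDiffAt ℝ ∞ (fun s => c s p) t := by
  obtain ⟨W, hW⟩ := h.exists_dual ht
  -- The directions W are constant and dual to the ω_0^p at t only, so the matrix ω_0^j(W_i) is the
  -- identity at t and invertible nearby; the coefficients solve a smooth linear system.
  refine contDiffAt_of_mulVec (M := fun s => Matrix.of fun i j => om A .zero (.mid (.inr j)) (W i) s)
    (θ := fun s i => θ (W i) s) (fun i j => h.contDiffAt_om ht .zero (.mid (.inr j)) (W i)) ?_
    (fun i => hθ _) ?_ p
  · have : (Matrix.of fun i j => om A .zero (.mid (.inr j)) (W i) t) =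
        (1 : Matrix (Fin r) (Fin r) ℝ) := by
      ext i j
      simp [hW, Matrix.one_apply, eq_comm]
    simp [this]
  · filter_upwards [h.eventually_mem ht] with s hs i
    rw [hc s hs]
    exact Finset.sum_congr rfl fun j _ => mul_comm _ _

end LocalFrame

/-- `Λ` is the family of coefficients `λ^α_{ps}` at `t`. -/
def LamAt (A : FrameIdx m r → E → LVec (m + r + 1)) (t : E)
    (Λ : Option (Fin m) → Matrix (Fin r) (Fin r) ℝ) : Prop :=
  ∀ α p u, om A (.mid (.inr p)) (normalIdx α) u t =
    ∑ s, Λ α p s * om A .zero (.mid (.inr s)) u t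

/-! ### The tensor λ as a second fundamental form of A_0 -/

namespace LocalFrame

variable {A : FrameIdx m r → E → LVec (m + r + 1)} {U : Set E} (h : LocalFrame A U) {t : E}
  (ht : t ∈ U)

include h

theorem exists_lamAt (t : E) (ht : t ∈ U) : ∃ Λ, LamAt A t Λ := by
  have : ∀ α p, ∃ c : Fin r → ℝ, ∀ u, om A (.mid (.inr p)) (normalIdx α) u t =
      ∑ s, c s * om A .zero (.mid (.inr s)) u t := fun α p =>
    h.exists_coeff_of_vanish ht (omLin A (.mid (.inr p)) (normalIdx α) t)
      fun v hv => h.om_tan_normal_of_kernel ht hv p α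
  choose c hc using this
  exact ⟨fun α => Matrix.of (c α), fun α p u => hc α p u⟩

include ht

theorem lform_tan_normal {Λ : Option (Fin m) → Matrix (Fin r) (Fin r) ℝ} (hΛ : LamAt A t Λ)
    (p : Fin r) (β : Option (Fin m)) (u : E) :
    lform (pd u (A (.mid (.inr p))) t) (A (normalIdx β) t) =
      ∑ s, lowerIdx (norGram fun ζ => A ζ t) Λ β p s * om A .zero (.mid (.inr s)) u t := by
  rw [(h.basis t ht).lform_normal (h.orthogonal t ht)]
  have : ∀ γ, coeff (fun ζ => A ζ t) (pd u (A (.mid (.inr p))) t) (normalIdx γ) =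
      ∑ s, Λ γ p s * om A .zero (.mid (.inr s)) u t := fun γ => hΛ γ p u
  simp only [this, lowerIdx, Matrix.sum_apply, Matrix.smul_apply, smul_eq_mul, Finset.sum_mul]
  rw [Finset.sum_comm]
  refine Finset.sum_congr rfl fun s _ => Finset.sum_congr rfl fun γ _ => ?_
  rw [norGram_isSymm.apply β γ]
  ring

theorem lowerIdx_symm {Λ : Option (Fin m) → Matrix (Fin r) (Fin r) ℝ} (hΛ : LamAt A t Λ)
    (β : Option (Fin m)) (p s : Fin r) : lowerIdx (norGram fun ζ => A ζ t) Λ β p s =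
      lowerIdx (norGram fun ζ => A ζ t) Λ β s p := by
  obtain ⟨W, hW⟩ := h.exists_dual ht
  have := h.second_form_symm ht (W s) (W p) β
  simpa [h.lform_tan_normal ht hΛ, hW] using this

theorem lamAt_isSymm {Λ : Option (Fin m) → Matrix (Fin r) (Fin r) ℝ} (hΛ : LamAt A t Λ)
    (α : Option (Fin m)) : (Λ α).IsSymm := by
  have hdet : IsUnit (norGram fun ζ => A ζ t).det :=
    isUnit_iff_ne_zero.mpr (h.basis t ht).norGram_posDef.det_pos.ne'
  ext p s
  have h1 : (norGram fun ζ => A ζ t).mulVec (fun γ => Λ γ s p - Λ γ p s) = 0 := by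
    funext β
    have := h.lowerIdx_symm ht hΛ β s p
    simp only [lowerIdx, Matrix.sum_apply, Matrix.smul_apply, smul_eq_mul] at this
    simp only [Matrix.mulVec, dotProduct, mul_sub, Finset.sum_sub_distrib, this, sub_self,
      Pi.zero_apply]
  have h2 := congrArg (fun x => Matrix.mulVec (norGram fun ζ => A ζ t)⁻¹ x) h1
  simp only [Matrix.mulVec_mulVec, Matrix.nonsing_inv_mul _ hdet, Matrix.one_mulVec,
    Matrix.mulVec_zero] at h2
  exact sub_eq_zero.mp (congrFun h2 α)

theorem contDiffAt_lam {Λ : E → Option (Fin m) → Matrix (Fin r) (Fin r) ℝ}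
    (hΛ : ∀ s ∈ U, LamAt A s (Λ s)) (α : Option (Fin m)) (p s : Fin r) :
    ContDiffAt ℝ ∞ (fun t => Λ t α p s) t :=
  h.contDiffAt_of_combination ht (θ := om A (.mid (.inr p)) (normalIdx α))
    (c := fun t s => Λ t α p s) (fun u => h.contDiffAt_om ht _ _ u) (fun s hs u => hΛ s hs α p u) s

theorem contDiffAt_norGram (α β : Option (Fin m)) :
    ContDiffAt ℝ ∞ (fun s => norGram (fun ζ => A ζ s) α β) t :=
  (h.smooth _ t ht).lform (h.smooth _ t ht)

theorem contDiffAt_tanGram (p s : Fin r) :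
    ContDiffAt ℝ ∞ (fun s' => tanGram (fun ζ => A ζ s') p s) t :=
  (h.smooth _ t ht).lform (h.smooth _ t ht)

theorem contDiffAt_lowerIdx {Λ : E → Option (Fin m) → Matrix (Fin r) (Fin r) ℝ}
    (hΛ : ∀ s ∈ U, LamAt A s (Λ s)) (β : Option (Fin m)) (p s : Fin r) :
    ContDiffAt ℝ ∞ (fun t => lowerIdx (norGram fun ζ => A ζ t) (Λ t) β p s) t := by
  simp only [lowerIdx, Matrix.sum_apply, Matrix.smul_apply, smul_eq_mul]
  exact ContDiffAt.sum fun γ _ => (h.contDiffAt_norGram ht β γ).mul (h.contDiffAt_lam ht hΛ γ p s)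

/-- The covariant components are second derivatives of A_0 paired with A_β. Therefore the symmetry
of higher derivatives, changes of frame and contact are all studied on λ_{βpq} rather than on
λ^α_{pq}. -/
theorem second_form_eq {Λ : Option (Fin m) → Matrix (Fin r) (Fin r) ℝ} (hΛ : LamAt A t Λ)
    (β : Option (Fin m)) (u v : E) :
    lform (pd u (pd v (A .zero)) t) (A (normalIdx β) t) =
      ∑ p, ∑ s, lowerIdx (norGram fun ζ => A ζ t) Λ β p s * om A .zero (.mid (.inr p)) v t *
        om A .zero (.mid (.inr s)) u t := by
  rw [h.second_form ht]
  refine Finset.sum_congr rfl fun p _ => ?_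
  rw [h.lform_tan_normal ht hΛ, Finset.mul_sum]
  exact Finset.sum_congr rfl fun s _ => by ring

theorem pd_norGram (u : E) (α β : Option (Fin m)) :
    pd u (fun s => norGram (fun ζ => A ζ s) α β) t =
      ∑ γ, om A (normalIdx α) (normalIdx γ) u t * norGram (fun ζ => A ζ t) γ β +
      ∑ γ, norGram (fun ζ => A ζ t) α γ * om A (normalIdx β) (normalIdx γ) u t := by
  have := pd_lform u (h.diff ht (normalIdx α)) (h.diff ht (normalIdx β))
  refine this.trans ?_
  rw [lform_comm (A (normalIdx α) t), (h.basis t ht).lform_normal (h.orthogonal t ht),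
    (h.basis t ht).lform_normal (h.orthogonal t ht)]
  congr 1
  refine Finset.sum_congr rfl fun γ _ => ?_
  rw [norGram_isSymm.apply α γ, mul_comm]
  rfl

theorem pd_tanGram (u : E) (p s : Fin r) :
    pd u (fun s' => tanGram (fun ζ => A ζ s') p s) t =
      ∑ q, om A (.mid (.inr p)) (.mid (.inr q)) u t * tanGram (fun ζ => A ζ t) q s +
      ∑ q, tanGram (fun ζ => A ζ t) p q * om A (.mid (.inr s)) (.mid (.inr q)) u t := by
  have := pd_lform u (h.diff ht (.mid (.inr p))) (h.diff ht (.mid (.inr s)))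
  refine this.trans ?_
  rw [lform_comm (A (.mid (.inr p)) t), (h.basis t ht).lform_tan (h.orthogonal t ht),
    (h.basis t ht).lform_tan (h.orthogonal t ht)]
  congr 1
  refine Finset.sum_congr rfl fun γ _ => ?_
  rw [tanGram_isSymm.apply p γ, mul_comm]
  rfl

theorem lform_pd_zero_pd_zero (u v : E) : lform (pd u (A .zero) t) (pd v (A .zero) t) =
    ∑ p, ∑ s, tanGram (fun ζ => A ζ t) p s * om A .zero (.mid (.inr p)) u t *
      om A .zero (.mid (.inr s)) v t := by
  rw [h.pd_zero ht u, h.pd_zero ht v]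
  simp only [lform_add_left, lform_add_right, lform_smul_left, lform_smul_right,
    lform_finset_sum_left, lform_finset_sum_right, (h.basis t ht).zero_zero,
    (h.basis t ht).zero_mid, lform_comm (A (.mid _) t) (A .zero t), mul_zero, add_zero,
    Finset.sum_const_zero, zero_add]
  simp only [Finset.mul_sum]
  rw [Finset.sum_comm]
  refine Finset.sum_congr rfl fun p _ => ?_
  refine Finset.sum_congr rfl fun s _ => ?_
  simp only [tanGram, Matrix.of_apply]
  ring

/-! #### Derivatives along the generators -/

variable {v : E} (hv : ∀ p, om A .zero (.mid (.inr p)) v t = 0)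

include hv

theorem pd_zero_of_kernel : pd v (A .zero) t = om A .zero .zero v t • A .zero t := by
  rw [h.pd_zero ht v]
  simp [hv]

theorem pd_tan_of_kernel (p : Fin r) : pd v (A (.mid (.inr p))) t =
    om A (.mid (.inr p)) .zero v t • A .zero t +
      ∑ s, om A (.mid (.inr p)) (.mid (.inr s)) v t • A (.mid (.inr s)) t := by
  conv_lhs => rw [(h.basis t ht).expand (pd v (A (.mid (.inr p))) t)]
  have h1 : coeff (fun ζ => A ζ t) (pd v (A (.mid (.inr p))) t) .top = 0 := by
    rw [coeff_top_eq, h.lform_pd ht (.mid (.inr p)) .zero (c := 0)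
      (fun s hs => (lform_comm _ _).trans ((h.basis s hs).zero_mid _)),
      h.pd_zero_of_kernel ht hv, lform_smul_right, lform_comm, (h.basis t ht).zero_mid]
    simp
  have h2 : ∀ α, coeff (fun ζ => A ζ t) (pd v (A (.mid (.inr p))) t) (normalIdx α) = 0 :=
    fun α => h.om_tan_normal_of_kernel ht hv p α
  simp only [h1, h2, zero_smul, Finset.sum_const_zero, add_zero]
  rfl

/-- The A_p-components of dA_β are dual to the ω_p^β, which vanish along the generator. With
`pd_zero_of_kernel` this shows that the span of A_0 and the A_α is stationary along itself. -/
theorem pd_normal_of_kernel (β : Option (Fin m)) : pd v (A (normalIdx β)) t =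
    om A (normalIdx β) .zero v t • A .zero t +
      ∑ γ, om A (normalIdx β) (normalIdx γ) v t • A (normalIdx γ) t := by
  conv_lhs => rw [(h.basis t ht).expand (pd v (A (normalIdx β)) t)]
  have h1 : coeff (fun ζ => A ζ t) (pd v (A (normalIdx β)) t) .top = 0 := by
    rw [coeff_top_eq, h.normal_zero t ht, neg_zero]
  have h2 : ∀ s, coeff (fun ζ => A ζ t) (pd v (A (normalIdx β)) t) (.mid (.inr s)) = 0 := by
    refine h.eq_zero_of_lform_tan ht fun p => ?_
    rw [h.lform_pd ht (normalIdx β) (.mid (.inr p)) (c := 0)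
      (fun s hs => (h.basis s hs).normal_tan (h.orthogonal s hs) β p), lform_comm,
      h.lform_tan_normal_of_kernel ht hv, neg_zero]
  simp only [h1, h2, zero_smul, Finset.sum_const_zero, add_zero]
  rfl

/-- The structure equation for dω_0^s, read off from the A_s-component of ∂_v∂_w A_0 = ∂_w∂_v A_0.
The constant direction v annihilates the ω_0^p only at t, so the derivative of ω_0^s(v) need not
vanish. -/
theorem bracket_of_kernel (w : E) (s : Fin r) :
    pd w (om A .zero (.mid (.inr s)) v) t = pd v (om A .zero (.mid (.inr s)) w) t +
      ∑ p, om A .zero (.mid (.inr p)) w t * om A (.mid (.inr p)) (.mid (.inr s)) v t -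
      om A .zero .zero v t * om A .zero (.mid (.inr s)) w t := by
  have key : ∀ a b : E, coeff (fun ζ => A ζ t) (pd a (pd b (A .zero)) t) (.mid (.inr s)) =
      om A .zero .zero b t * om A .zero (.mid (.inr s)) a t +
      (pd a (om A .zero (.mid (.inr s)) b) t +
        ∑ p, om A .zero (.mid (.inr p)) b t * om A (.mid (.inr p)) (.mid (.inr s)) a t) := by
    intro a b
    rw [h.pd_pd_zero ht a b]
    simp only [coeff_add, coeff_smul, h.coeff_self_zero ht]
    have : coeff (fun ζ => A ζ t) (∑ p, (pd a (om A .zero (.mid (.inr p)) b) t •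
        A (.mid (.inr p)) t + om A .zero (.mid (.inr p)) b t • pd a (A (.mid (.inr p))) t))
        (.mid (.inr s)) = ∑ p, (pd a (om A .zero (.mid (.inr p)) b) t * (if s = p then 1 else 0) +
          om A .zero (.mid (.inr p)) b t * om A (.mid (.inr p)) (.mid (.inr s)) a t) := by
      change coeffLin (fun ζ => A ζ t) (.mid (.inr s)) _ = _
      rw [map_sum]
      refine Finset.sum_congr rfl fun p _ => ?_
      change coeff (fun ζ => A ζ t) _ (.mid (.inr s)) = _
      simp only [coeff_add, coeff_smul, h.coeff_self_mid ht, Sum.inr.injEq]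
      rfl
    rw [this, Finset.sum_add_distrib]
    simp
    exact Or.inl rfl
  have h1 := key v w
  rw [pd_comm v w (h.smooth _ t ht), key w v] at h1
  simp only [hv, zero_mul, Finset.sum_const_zero, mul_zero] at h1
  linarith

/-- The derivative of the tensor `λ_{βpq}` along the generator. -/
theorem pd_lowerIdx_of_kernel {Λ : E → Option (Fin m) → Matrix (Fin r) (Fin r) ℝ}
    (hΛ : ∀ s ∈ U, LamAt A s (Λ s)) (β : Option (Fin m)) (i j : Fin r) :
    pd v (fun s => lowerIdx (norGram fun ζ => A ζ s) (Λ s) β i j) t =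
      ∑ γ, om A (normalIdx β) (normalIdx γ) v t *
        lowerIdx (norGram fun ζ => A ζ t) (Λ t) γ i j +
      (∑ s, om A (.mid (.inr i)) (.mid (.inr s)) v t *
        lowerIdx (norGram fun ζ => A ζ t) (Λ t) β s j +
       ∑ s, lowerIdx (norGram fun ζ => A ζ t) (Λ t) β i s *
        om A (.mid (.inr j)) (.mid (.inr s)) v t) -
      om A .zero .zero v t * lowerIdx (norGram fun ζ => A ζ t) (Λ t) β i j -
      om A (normalIdx β) .zero v t * tanGram (fun ζ => A ζ t) i j := by
  obtain ⟨W, hW⟩ := h.exists_dual ht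
  set Lo : E → Fin r → Fin r → ℝ :=
    fun s i j => lowerIdx (norGram fun ζ => A ζ s) (Λ s) β i j with hLo
  have hLd : ∀ i j, DifferentiableAt ℝ (fun s => Lo s i j) t := fun i j =>
    differentiableAt_of_smooth (h.contDiffAt_lowerIdx ht hΛ β i j)
  have hod : ∀ ξ η u, DifferentiableAt ℝ (om A ξ η u) t := fun ξ η u =>
    differentiableAt_of_smooth (h.contDiffAt_om ht ξ η u)
  have hb := h.basis t ht
  obtain ⟨u, hu⟩ : ∃ u, ∀ p, om A .zero (.mid (.inr p)) u t = if p = j then 1 else 0 :=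
    ⟨W j, fun p => hW p j⟩
  -- The constant directions w and u, dual at t to ω_0^i and ω_0^j, isolate the component λ_{βij}.
  obtain ⟨w, hw⟩ : ∃ w, ∀ p, om A .zero (.mid (.inr p)) w t = if p = i then 1 else 0 :=
    ⟨W i, fun p => hW p i⟩
  have hform : ∀ a b : E, (fun s => lform (pd a (pd b (A .zero)) s) (A (normalIdx β) s)) =ᶠ[𝓝 t]
      fun s => ∑ p, ∑ q, Lo s p q * om A .zero (.mid (.inr p)) b s *
        om A .zero (.mid (.inr q)) a s := by
    intro a b
    filter_upwards [h.eventually_mem ht] with s hs using h.second_form_eq hs (hΛ s hs) β a b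
  have hder : ∀ c a b : E,
      lform (pd c (pd a (pd b (A .zero))) t) (A (normalIdx β) t) +
        lform (pd a (pd b (A .zero)) t) (pd c (A (normalIdx β)) t) =
      ∑ p, ∑ q, ((pd c (fun s => Lo s p q) t * om A .zero (.mid (.inr p)) b t +
        Lo t p q * pd c (om A .zero (.mid (.inr p)) b) t) * om A .zero (.mid (.inr q)) a t +
        Lo t p q * om A .zero (.mid (.inr p)) b t * pd c (om A .zero (.mid (.inr q)) a) t) := by
    intro c a b
    rw [← pd_lform c (differentiableAt_of_smooth (contDiffAt_pd a (contDiffAt_pd b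
      (h.smooth _ t ht)))) (h.diff ht _), pd_congr c (hform a b)]
    have hd1 : ∀ p q, DifferentiableAt ℝ
        (fun s => Lo s p q * om A .zero (.mid (.inr p)) b s) t := fun p q =>
      (hLd p q).fun_mul (hod _ _ _)
    rw [pd_sum _ c fun p _ => DifferentiableAt.fun_sum fun q _ => (hd1 p q).fun_mul (hod _ _ _)]
    refine Finset.sum_congr rfl fun p _ => ?_
    rw [pd_sum _ c fun q _ => (hd1 p q).fun_mul (hod _ _ _)]
    refine Finset.sum_congr rfl fun q _ => ?_
    rw [pd_mul c (hd1 p q) (hod _ _ _), pd_mul c (hLd p q) (hod _ _ _)]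
  -- Both identities contain the same third derivative ∂_v∂_u∂_w A_0. In the first the derivative of
  -- λ along v appears; in the second the derivative of λ drops out, since it is multiplied by
  -- ω_0^q(v) = 0.
  have h1 := hder v u w
  have h2 := hder u v w
  rw [pd_comm u v (contDiffAt_pd w (h.smooth _ t ht))] at h2
  have hA0 : lform (A .zero t) (pd u (A (normalIdx β)) t) = 0 := by
    rw [lform_comm, h.normal_zero t ht]
  have hAp : ∀ p, lform (A (.mid (.inr p)) t) (pd u (A (normalIdx β)) t) = -Lo t p j := by
    intro p
    have := h.lform_pd ht (.mid (.inr p)) (normalIdx β) (c := 0)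
      (fun s hs => (lform_comm _ _).trans ((h.basis s hs).normal_tan (h.orthogonal s hs) β p)) u
    rw [h.lform_tan_normal ht (hΛ t ht)] at this
    simp only [hu] at this
    simp only [mul_ite, mul_one, mul_zero, Finset.sum_ite_eq', Finset.mem_univ, if_true] at this
    simp only [hLo, this, neg_neg]
  have e1 : lform (pd v (pd w (A .zero)) t) (pd u (A (normalIdx β)) t) =
      -∑ p, Lo t p j * pd v (om A .zero (.mid (.inr p)) w) t -
        ∑ s, om A (.mid (.inr i)) (.mid (.inr s)) v t * Lo t s j := by
    rw [h.pd_pd_zero ht v w]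
    simp only [h.pd_zero_of_kernel ht hv, h.pd_tan_of_kernel ht hv, lform_add_left,
      lform_smul_left, lform_finset_sum_left, hA0, hAp, hw]
    simp only [mul_zero, mul_neg, zero_add, ite_mul, one_mul, zero_mul, Finset.sum_add_distrib,
      Finset.sum_neg_distrib, Finset.sum_ite_eq', Finset.mem_univ, if_true, mul_comm (Lo t _ j)]
    ring
  have e2 : lform (pd u (pd w (A .zero)) t) (pd v (A (normalIdx β)) t) =
      -(om A (normalIdx β) .zero v t * tanGram (fun ζ => A ζ t) i j) +
      ∑ γ, om A (normalIdx β) (normalIdx γ) v t *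
        lowerIdx (norGram fun ζ => A ζ t) (Λ t) γ i j := by
    -- (∂_w A_0, A_0) vanishes identically, so differentiation along u produces the metric; this is
    -- the source of the term with g_{ij}.
    have e3 : lform (pd u (pd w (A .zero)) t) (A .zero t) = -tanGram (fun ζ => A ζ t) i j := by
      have := lform_pd_of_const u (contDiffAt_pd w (h.smooth .zero t ht)) (h.smooth .zero t ht)
        (c := 0) ((h.eventually_mem ht).mono fun s hs => h.pd_zero_zero hs w)
      rw [this, h.lform_pd_zero_pd_zero ht]
      simp [hu, hw]
    rw [h.pd_normal_of_kernel ht hv]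
    simp only [lform_add_right, lform_smul_right, lform_finset_sum_right, e3,
      h.second_form_eq ht (hΛ t ht), hu, hw]
    simp only [mul_ite, mul_one, mul_zero, Finset.sum_ite_eq', Finset.mem_univ, if_true, mul_neg]
  rw [e2] at h1
  rw [e1] at h2
  -- This replaces the derivatives of ω_0^q(v) along u, which the second identity still contains.
  have hbr := h.bracket_of_kernel ht hv u
  simp only [hbr] at h2
  simp only [hv, hu, hw] at h1 h2
  simp only [mul_add, mul_sub, mul_ite, ite_mul, mul_one, one_mul, mul_zero, zero_mul,
    zero_add, Finset.sum_add_distrib, Finset.sum_sub_distrib, Finset.sum_ite_eq',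
    Finset.mem_univ, if_true, Finset.sum_const_zero, Finset.sum_ite_irrel] at h1 h2
  change pd v (fun s => Lo s i j) t = _
  linarith

end LocalFrame

end LocalTheory

/-! ### The relative invariant of a frame and the normalized isotropic vector -/

section LocalScreen

variable {m r : ℕ} {E : Type*} [NormedAddCommGroup E] [NormedSpace ℝ E]

theorem pd_clm {G G' : Type*} [NormedAddCommGroup G] [NormedSpace ℝ G] [NormedAddCommGroup G']
    [NormedSpace ℝ G'] (L : G →L[ℝ] G') {F : E → G} {t : E} (u : E)
    (hF : DifferentiableAt ℝ F t) : pd u (fun s => L (F s)) t = L (pd u F t) := by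
  have := (L.hasFDerivAt.comp t hF.hasFDerivAt).fderiv
  exact congrArg (fun f => f u) this

theorem pd_apply {ι G : Type*} [Fintype ι] [NormedAddCommGroup G] [NormedSpace ℝ G]
    {F : E → ι → G} {t : E} (u : E)
    (hF : DifferentiableAt ℝ F t) (i : ι) : pd u F t i = pd u (fun s => F s i) t :=
  (pd_clm (ContinuousLinearMap.proj (R := ℝ) (φ := fun _ : ι => G) i) u hF).symm

/-- The triple `(g_{αβ}, g_{pq}, λ_{βpq})` of a moving frame. -/
def frameTriple (A : FrameIdx m r → E → LVec (m + r + 1))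
    (Λ : E → Option (Fin m) → Matrix (Fin r) (Fin r) ℝ) (t : E) : TensorTriple m r :=
  (fun α β => norGram (fun ζ => A ζ t) α β, fun p q => tanGram (fun ζ => A ζ t) p q,
    fun β p q => lowerIdx (norGram fun ζ => A ζ t) (Λ t) β p q)

/-- The relative invariant of a moving frame over a vector space. -/
def locInv (ρ : ℕ) (A : FrameIdx m r → E → LVec (m + r + 1))
    (Λ : E → Option (Fin m) → Matrix (Fin r) (Fin r) ℝ) (t : E) : ℝ :=
  sumDiagMinors ρ (mixedTensor (norGram fun ζ => A ζ t) (tanGram fun ζ => A ζ t) (Λ t))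

/-- The form `da / (2 ρ a) + ω_0^0`. -/
def theta (ρ : ℕ) (A : FrameIdx m r → E → LVec (m + r + 1))
    (Λ : E → Option (Fin m) → Matrix (Fin r) (Fin r) ℝ) (u t : E) : ℝ :=
  pd u (locInv ρ A Λ) t / (2 * (ρ : ℝ) * locInv ρ A Λ t) + om A .zero .zero u t

/-- The normalization `a^{1/2ρ} A_0` of the isotropic vector `A_0`. -/
def normZero (ρ : ℕ) (A : FrameIdx m r → E → LVec (m + r + 1))
    (Λ : E → Option (Fin m) → Matrix (Fin r) (Fin r) ℝ) (t : E) : LVec (m + r + 1) :=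
  (locInv ρ A Λ t) ^ ((1 : ℝ) / (2 * ρ : ℕ)) • A .zero t

/-- A local frame together with the tensor `λ^α_{pq}` and a nonvanishing relative invariant. -/
structure LocalScreen (ρ : ℕ) (A : FrameIdx m r → E → LVec (m + r + 1)) (U : Set E)
    (Λ : E → Option (Fin m) → Matrix (Fin r) (Fin r) ℝ) : Prop where
  frame : LocalFrame A U
  lam : ∀ t ∈ U, LamAt A t (Λ t)
  pos : ∀ t ∈ U, 0 < locInv ρ A Λ t
  ne : ρ ≠ 0

namespace LocalScreen

variable {ρ : ℕ} {A : FrameIdx m r → E → LVec (m + r + 1)} {U : Set E}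
  {Λ : E → Option (Fin m) → Matrix (Fin r) (Fin r) ℝ}

omit [NormedAddCommGroup E] [NormedSpace ℝ E] in
-- This presents a as a fixed smooth function on a finite-dimensional space composed with the triple
-- of the frame, so that da is given by the chain rule.
theorem locInv_eq {t : E} (hb : IsConformalBasis fun ζ => A ζ t) :
    locInv ρ A Λ t = tripleInv ρ (frameTriple A Λ t) :=
  (lowInv_lowerIdx (isUnit_iff_ne_zero.mpr hb.tanGram_posDef.det_pos.ne') tanGram_isSymm
    (isUnit_iff_ne_zero.mpr hb.norGram_posDef.det_pos.ne') norGram_isSymm ρ (Λ t)).symm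

omit [NormedAddCommGroup E] [NormedSpace ℝ E] in
theorem contDiffAt_tripleInv_frame {t : E} (hb : IsConformalBasis fun ζ => A ζ t) :
    ContDiffAt ℝ ∞ (tripleInv ρ) (frameTriple A Λ t) :=
  contDiffAt_tripleInv (m := m) (r := r) ρ (x := frameTriple A Λ t)
    hb.norGram_posDef.det_pos.ne' hb.tanGram_posDef.det_pos.ne'

variable (h : LocalScreen ρ A U Λ) {t : E} (ht : t ∈ U)

include h ht

theorem contDiffAt_frameTriple : ContDiffAt ℝ ∞ (frameTriple A Λ) t := by
  refine ContDiffAt.prodMk (contDiffAt_pi.mpr fun α => contDiffAt_pi.mpr fun β =>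
    h.frame.contDiffAt_norGram ht α β) (ContDiffAt.prodMk (contDiffAt_pi.mpr fun p =>
    contDiffAt_pi.mpr fun s => h.frame.contDiffAt_tanGram ht p s) (contDiffAt_pi.mpr fun β =>
    contDiffAt_pi.mpr fun p => contDiffAt_pi.mpr fun s =>
      h.frame.contDiffAt_lowerIdx ht h.lam β p s))

theorem locInv_eventuallyEq :
    locInv ρ A Λ =ᶠ[𝓝 t] fun s => tripleInv ρ (frameTriple A Λ s) := by
  filter_upwards [h.frame.eventually_mem ht] with s hs using locInv_eq (h.frame.basis s hs)

theorem contDiffAt_locInv : ContDiffAt ℝ ∞ (locInv ρ A Λ) t :=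
  ((contDiffAt_tripleInv_frame (h.frame.basis t ht)).comp t
    (h.contDiffAt_frameTriple ht)).congr_of_eventuallyEq (h.locInv_eventuallyEq ht)

theorem pd_locInv (u : E) : pd u (locInv ρ A Λ) t =
    fderiv ℝ (tripleInv ρ) (frameTriple A Λ t) (pd u (frameTriple A Λ) t) := by
  rw [pd_congr u (h.locInv_eventuallyEq ht)]
  have h1 := (contDiffAt_tripleInv_frame (ρ := ρ) (Λ := Λ)
    (h.frame.basis t ht)).differentiableAt (by simp)
  have h2 := differentiableAt_of_smooth (h.contDiffAt_frameTriple ht)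
  have := (h1.hasFDerivAt.comp t h2.hasFDerivAt).fderiv
  exact congrArg (fun f => f u) this

theorem pd_frameTriple (u : E) : pd u (frameTriple A Λ) t =
    (fun α β => pd u (fun s => norGram (fun ζ => A ζ s) α β) t,
      fun p q => pd u (fun s => tanGram (fun ζ => A ζ s) p q) t,
      fun β p q => pd u (fun s => lowerIdx (norGram fun ζ => A ζ s) (Λ s) β p q) t) := by
  have hd := differentiableAt_of_smooth (h.contDiffAt_frameTriple ht)
  have d1 : DifferentiableAt ℝ (fun s => (frameTriple A Λ s).1) t := hd.fst
  have d2 : DifferentiableAt ℝ (fun s => (frameTriple A Λ s).2.1) t := hd.snd.fst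
  have d3 : DifferentiableAt ℝ (fun s => (frameTriple A Λ s).2.2) t := hd.snd.snd
  refine Prod.ext ?_ (Prod.ext ?_ ?_)
  · have := pd_clm (ContinuousLinearMap.fst ℝ _ _) u hd
    refine this.symm.trans ?_
    funext i j
    change pd u (fun s => (frameTriple A Λ s).1) t i j = _
    rw [pd_apply u d1, pd_apply u (differentiableAt_pi.mp d1 i)]
    rfl
  · have := pd_clm ((ContinuousLinearMap.fst ℝ _ _).comp (ContinuousLinearMap.snd ℝ _ _)) u hd
    refine this.symm.trans ?_
    funext i j
    change pd u (fun s => (frameTriple A Λ s).2.1) t i j = _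
    rw [pd_apply u d2, pd_apply u (differentiableAt_pi.mp d2 i)]
    rfl
  · have := pd_clm ((ContinuousLinearMap.snd ℝ _ _).comp (ContinuousLinearMap.snd ℝ _ _)) u hd
    refine this.symm.trans ?_
    funext β i j
    change pd u (fun s => (frameTriple A Λ s).2.2) t β i j = _
    have d4 := differentiableAt_pi.mp d3 β
    rw [pd_apply u d3, pd_apply u d4, pd_apply u (differentiableAt_pi.mp d4 i)]
    rfl

/-- Along a generator the triple moves by the infinitesimal action with parameters ω_α^β(v),
ω_p^q(v), ω_0^0(v) and ω_β^0(v); only the scaling ω_0^0(v) affects a. -/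
theorem pd_locInv_of_kernel {v : E} (hv : ∀ p, om A .zero (.mid (.inr p)) v t = 0) :
    pd v (locInv ρ A Λ) t = -(2 * ρ * om A .zero .zero v t) * locInv ρ A Λ t := by
  have hb := h.frame.basis t ht
  rw [h.pd_locInv ht, h.pd_frameTriple ht, locInv_eq hb]
  have := fderiv_tripleInv_orbit (m := m) (r := r) ρ (lowerIdx (norGram fun ζ => A ζ t) (Λ t))
    hb.norGram_posDef.det_pos.ne' hb.tanGram_posDef.det_pos.ne' tanGram_isSymm
    (Matrix.of fun α β => om A (normalIdx α) (normalIdx β) v t)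
    (Matrix.of fun p q => om A (.mid (.inr p)) (.mid (.inr q)) v t) (om A .zero .zero v t)
    (fun β => om A (normalIdx β) .zero v t)
  refine Eq.trans ?_ this
  congr 1
  refine Prod.ext ?_ (Prod.ext ?_ ?_)
  · funext α β
    change pd v (fun s => norGram (fun ζ => A ζ s) α β) t = _
    rw [h.frame.pd_norGram ht]
    simp only [Matrix.add_apply, Matrix.mul_apply, Matrix.of_apply, Matrix.transpose_apply]
  · funext p q
    change pd v (fun s => tanGram (fun ζ => A ζ s) p q) t = _
    rw [h.frame.pd_tanGram ht]
    simp only [Matrix.add_apply, Matrix.mul_apply, Matrix.of_apply, Matrix.transpose_apply]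
  · funext β p q
    change pd v (fun s => lowerIdx (norGram fun ζ => A ζ s) (Λ s) β p q) t = _
    rw [h.frame.pd_lowerIdx_of_kernel ht hv h.lam]
    simp only [Matrix.add_apply, Matrix.mul_apply, Matrix.of_apply, Matrix.transpose_apply]

theorem theta_of_kernel {v : E} (hv : ∀ p, om A .zero (.mid (.inr p)) v t = 0) :
    theta ρ A Λ v t = 0 := by
  have hρ : (ρ : ℝ) ≠ 0 := Nat.cast_ne_zero.mpr h.ne
  have ha := (h.pos t ht).ne'
  rw [theta, h.pd_locInv_of_kernel ht hv]
  field_simp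
  ring

omit ht in
theorem exists_mu : ∃ μ : E → Fin r → ℝ, ∀ t ∈ U, ∀ u,
    theta ρ A Λ u t = ∑ p, μ t p * om A .zero (.mid (.inr p)) u t := by
  have : ∀ t ∈ U, ∃ c : Fin r → ℝ, ∀ u,
      theta ρ A Λ u t = ∑ p, c p * om A .zero (.mid (.inr p)) u t := by
    intro t ht
    let ℓ : E →ₗ[ℝ] ℝ := (2 * (ρ : ℝ) * locInv ρ A Λ t)⁻¹ •
      (fderiv ℝ (locInv ρ A Λ) t).toLinearMap + omLin A .zero .zero t
    have hℓ : ∀ u, ℓ u = theta ρ A Λ u t := by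
      intro u
      simp only [ℓ, theta, pd, LinearMap.add_apply, LinearMap.smul_apply, smul_eq_mul,
        omLin_apply, ContinuousLinearMap.coe_coe, div_eq_inv_mul]
    obtain ⟨c, hc⟩ := h.frame.exists_coeff_of_vanish ht ℓ fun v hv => by
      rw [hℓ, h.theta_of_kernel ht hv]
    exact ⟨c, fun u => by rw [← hℓ, hc]⟩
  choose! μ hμ using this
  exact ⟨μ, hμ⟩

theorem contDiffAt_theta (u : E) : ContDiffAt ℝ ∞ (theta ρ A Λ u) t := by
  have hρ : (ρ : ℝ) ≠ 0 := Nat.cast_ne_zero.mpr h.ne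
  exact ((contDiffAt_pd u (h.contDiffAt_locInv ht)).div
    (contDiffAt_const.mul (h.contDiffAt_locInv ht))
    (mul_ne_zero (mul_ne_zero two_ne_zero hρ) (h.pos t ht).ne')).add (h.frame.contDiffAt_om ht _ _ _)

theorem contDiffAt_mu {μ : E → Fin r → ℝ} (hμ : ∀ t ∈ U, ∀ u,
    theta ρ A Λ u t = ∑ p, μ t p * om A .zero (.mid (.inr p)) u t) (p : Fin r) :
    ContDiffAt ℝ ∞ (fun s => μ s p) t :=
  h.frame.contDiffAt_of_combination ht (fun u => h.contDiffAt_theta ht u) hμ p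

theorem contDiffAt_power :
    ContDiffAt ℝ ∞ (fun s => (locInv ρ A Λ s) ^ ((1 : ℝ) / (2 * ρ : ℕ))) t :=
  (h.contDiffAt_locInv ht).rpow_const_of_ne (h.pos t ht).ne'

theorem contDiffAt_normZero : ContDiffAt ℝ ∞ (normZero ρ A Λ) t :=
  (h.contDiffAt_power ht).smul (h.frame.smooth _ t ht)

/-- The exponent 1/(2ρ) makes the logarithmic derivative of the factor equal to da/(2ρa), which
combines with ω_0^0 from dA_0 into the form that defines μ. -/
theorem pd_normZero (u : E) : pd u (normZero ρ A Λ) t =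
    (locInv ρ A Λ t) ^ ((1 : ℝ) / (2 * ρ : ℕ)) • (theta ρ A Λ u t • A .zero t +
      ∑ p, om A .zero (.mid (.inr p)) u t • A (.mid (.inr p)) t) := by
  have hρ : (ρ : ℝ) ≠ 0 := Nat.cast_ne_zero.mpr h.ne
  have ha := h.pos t ht
  have h1 := pd_smul u (differentiableAt_of_smooth (h.contDiffAt_power ht)) (h.frame.diff ht .zero)
  have h2 : pd u (fun s => (locInv ρ A Λ s) ^ ((1 : ℝ) / (2 * ρ : ℕ))) t =
      (locInv ρ A Λ t) ^ ((1 : ℝ) / (2 * ρ : ℕ)) *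
        (pd u (locInv ρ A Λ) t / (2 * (ρ : ℝ) * locInv ρ A Λ t)) := by
    have := ((differentiableAt_of_smooth (h.contDiffAt_locInv ht)).hasFDerivAt.rpow_const
      (p := (1 : ℝ) / (2 * ρ : ℕ)) (Or.inl ha.ne')).fderiv
    rw [pd, this]
    simp only [smul_apply, smul_eq_mul, Real.rpow_sub_one ha.ne', pd, Nat.cast_mul,
      Nat.cast_ofNat]
    field_simp
  refine h1.trans ?_
  rw [h2, h.frame.pd_zero ht, theta]
  module

/-- The normalizing subspace is spanned by the derivatives of the normalized isotropic vector. -/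
theorem span_pd_normZero {μ : Fin r → ℝ}
    (hμ : ∀ u, theta ρ A Λ u t = ∑ p, μ p * om A .zero (.mid (.inr p)) u t) :
    Submodule.span ℝ (Set.range fun p => A (.mid (.inr p)) t + μ p • A .zero t) =
      Submodule.span ℝ (Set.range fun u => pd u (normZero ρ A Λ) t) := by
  have hpd : ∀ u, pd u (normZero ρ A Λ) t = (locInv ρ A Λ t) ^ ((1 : ℝ) / (2 * ρ : ℕ)) •
      ∑ p, om A .zero (.mid (.inr p)) u t • (A (.mid (.inr p)) t + μ p • A .zero t) := by
    intro u
    rw [h.pd_normZero ht, hμ, Finset.sum_smul, ← Finset.sum_add_distrib]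
    congr 1
    refine Finset.sum_congr rfl fun p _ => ?_
    module
  obtain ⟨W, hW⟩ := h.frame.exists_dual ht
  have hc : (locInv ρ A Λ t) ^ ((1 : ℝ) / (2 * ρ : ℕ)) ≠ 0 :=
    (Real.rpow_pos_of_pos (h.pos t ht) _).ne'
  apply le_antisymm
  · rw [Submodule.span_le]
    rintro _ ⟨p, rfl⟩
    have : A (.mid (.inr p)) t + μ p • A .zero t =
        ((locInv ρ A Λ t) ^ ((1 : ℝ) / (2 * ρ : ℕ)))⁻¹ • pd (W p) (normZero ρ A Λ) t := by
      rw [hpd, inv_smul_smul₀ hc]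
      simp only [hW, ite_smul, one_smul, zero_smul, Finset.sum_ite_eq', Finset.mem_univ, if_true]
    rw [SetLike.mem_coe]
    simp only [this]
    exact Submodule.smul_mem _ _ (Submodule.subset_span ⟨W p, rfl⟩)
  · rw [Submodule.span_le]
    rintro _ ⟨u, rfl⟩
    rw [SetLike.mem_coe]
    simp only [hpd]
    exact Submodule.smul_mem _ _ (Submodule.sum_mem _ fun p _ =>
      Submodule.smul_mem _ _ (Submodule.subset_span ⟨p, rfl⟩))

/-- The normalizing subspace does not change along the generators. -/
theorem pd_normPt_mem {μ : E → Fin r → ℝ} (hμ : ∀ t ∈ U, ∀ u,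
    theta ρ A Λ u t = ∑ p, μ t p * om A .zero (.mid (.inr p)) u t)
    {v : E} (hv : ∀ p, om A .zero (.mid (.inr p)) v t = 0) (j : Fin r) :
    pd v (fun s => A (.mid (.inr j)) s + μ s j • A .zero s) t ∈
      Submodule.span ℝ (Set.range fun p => A (.mid (.inr p)) t + μ t p • A .zero t) := by
  set S := Submodule.span ℝ (Set.range fun p => A (.mid (.inr p)) t + μ t p • A .zero t)
  set c : E → ℝ := fun s => (locInv ρ A Λ s) ^ ((1 : ℝ) / (2 * ρ : ℕ)) with hcdef
  set C : Fin r → E → LVec (m + r + 1) := fun p s => A (.mid (.inr p)) s + μ s p • A .zero s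
    with hC
  have hCS : ∀ p, C p t ∈ S := fun p => Submodule.subset_span ⟨p, rfl⟩
  have hc : c t ≠ 0 := (Real.rpow_pos_of_pos (h.pos t ht) _).ne'
  have hcd : DifferentiableAt ℝ c t := differentiableAt_of_smooth (h.contDiffAt_power ht)
  have hCd : ∀ p, DifferentiableAt ℝ (C p) t := fun p =>
    (h.frame.diff ht _).add ((differentiableAt_of_smooth (h.contDiffAt_mu ht hμ p)).smul
      (h.frame.diff ht _))
  have hod : ∀ u p, DifferentiableAt ℝ (om A .zero (.mid (.inr p)) u) t := fun u p =>
    differentiableAt_of_smooth (h.frame.contDiffAt_om ht _ _ u)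
  have hev : ∀ u, pd u (normZero ρ A Λ) =ᶠ[𝓝 t] fun s =>
      ∑ p, (c s * om A .zero (.mid (.inr p)) u s) • C p s := by
    intro u
    filter_upwards [h.frame.eventually_mem ht] with s hs
    rw [h.pd_normZero hs, hμ s hs, Finset.sum_smul, ← Finset.sum_add_distrib, Finset.smul_sum]
    refine Finset.sum_congr rfl fun p _ => ?_
    simp only [hC, hcdef]
    module
  have hder : ∀ u w, pd w (pd u (normZero ρ A Λ)) t =
      ∑ p, (pd w (fun s => c s * om A .zero (.mid (.inr p)) u s) t • C p t +
        (c t * om A .zero (.mid (.inr p)) u t) • pd w (C p) t) := by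
    intro u w
    rw [pd_congr w (hev u), pd_sum _ w fun p _ => (hcd.fun_mul (hod u p)).fun_smul (hCd p)]
    exact Finset.sum_congr rfl fun p _ => pd_smul w (hcd.fun_mul (hod u p)) (hCd p)
  obtain ⟨W, hW⟩ := h.frame.exists_dual ht
  -- Compare the two orders of differentiation along v and W_j, the latter dual to ω_0^j. In one
  -- order ∂_v C_j appears with a nonzero factor next to combinations of the C_p; in the other all
  -- ∂C_p are multiplied by ω_0^p(v) = 0.
  have h1 := hder (W j) v
  rw [pd_comm v (W j) (h.contDiffAt_normZero ht), hder v (W j)] at h1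
  simp only [hv, hW, mul_zero, zero_smul, add_zero, mul_ite, mul_one, ite_smul,
    Finset.sum_add_distrib, Finset.sum_ite_eq', Finset.mem_univ, if_true] at h1
  have h2 : c t • pd v (C j) t ∈ S := by
    rw [← sub_eq_iff_eq_add'] at h1
    rw [← h1]
    exact Submodule.sub_mem _
      (Submodule.sum_mem _ fun p _ => Submodule.smul_mem _ _ (hCS p))
      (Submodule.sum_mem _ fun p _ => Submodule.smul_mem _ _ (hCS p))
  exact (Submodule.smul_mem_iff _ hc).mp h2

end LocalScreen

/-! ### Independence of the choice of the adapted frame -/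

namespace LocalFrame

variable {A A' : FrameIdx m r → E → LVec (m + r + 1)} {U : Set E}

/-- A_0' is orthogonal to x and to all dx, hence to the whole hyperplane η = A_0^⊥, whose orthogonal
complement is the line of A_0. The factor c between the two normalizations of x is smooth and
nonzero, so it does no harm. -/
theorem exists_zero_eq_smul (h : LocalFrame A U) (h' : LocalFrame A' U)
    (hpt : ∀ t ∈ U, ∃ c : ℝ, A' .pt t = c • A .pt t) {t : E} (ht : t ∈ U) :
    A' .zero t = (-lform (A' .zero t) (A .top t)) • A .zero t ∧
      lform (A' .zero t) (A .top t) ≠ 0 := by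
  have hb := h.basis t ht
  have hb' := h'.basis t ht
  let c : E → ℝ := fun s => lform (A' .pt s) (A .pt s)
  have hc : ∀ s ∈ U, A' .pt s = c s • A .pt s := by
    intro s hs
    obtain ⟨d, hd⟩ := hpt s hs
    have : c s = d := by
      simp only [c, hd, lform_smul_left, (h.basis s hs).pt_pt, mul_one]
    rw [this, hd]
  have hcne : c t ≠ 0 := by
    intro h0
    have := hb'.pt_pt
    simp only [hc t ht, h0, zero_smul, lform_zero_left] at this
    exact zero_ne_one this
  have hcd : DifferentiableAt ℝ c t :=
    differentiableAt_of_smooth ((h'.smooth _ t ht).lform (h.smooth _ t ht))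
  have h0 : lform (A' .zero t) (A .pt t) = 0 := by
    have := hb'.zero_pt
    simp only [hc t ht, lform_smul_right] at this
    exact (mul_eq_zero.mp this).resolve_left hcne
  have h1 : ∀ u, lform (A' .zero t) (pd u (A .pt) t) = 0 := by
    intro u
    have h2 := h'.normal_zero t ht none u
    have h3 : pd u (A' .pt) t = pd u c t • A .pt t + c t • pd u (A .pt) t := by
      rw [← pd_smul u hcd (h.diff ht _)]
      exact pd_congr u ((h.eventually_mem ht).mono hc)
    simp only [normalIdx] at h2
    rw [lform_comm, h3, lform_add_right, lform_smul_right, lform_smul_right, h0, mul_zero,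
      zero_add] at h2
    exact (mul_eq_zero.mp h2).resolve_left hcne
  have h2 : ∀ w, lform w (A .zero t) = 0 → lform w (A .pt t) = 0 → lform (A' .zero t) w = 0 := by
    intro w hw hw'
    obtain ⟨u, rfl⟩ := h.surj t ht w hw hw'
    exact h1 u
  have h3 := hb.eq_smul_zero (w := A' .zero t) (h2 _ hb.zero_zero hb.zero_pt)
    (fun i => h2 _ (by rw [lform_comm]; exact hb.zero_mid i) (hb.mid_pt i)) h0
  refine ⟨h3, fun h4 => ?_⟩
  rw [h4, neg_zero, zero_smul] at h3
  have := hb'.zero_top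
  simp only [h3, lform_zero_left] at this
  norm_num at this

end LocalFrame

namespace LocalScreen

variable {ρ : ℕ} {A A' : FrameIdx m r → E → LVec (m + r + 1)} {U : Set E}
  {Λ Λ' : E → Option (Fin m) → Matrix (Fin r) (Fin r) ℝ}

/-- A change of adapted frame acts on the triple through the group of `lowInv_gauge`: A_0' = s A_0,
while A_β' and A_p' are combinations of the A_γ, respectively the A_q, up to multiples κ_β A_0 and
multiples of A_0. The factor k is s⁻¹: one s comes from A_0' and two s⁻¹ from the directions dual to
the new forms. -/
theorem locInv_change (h : LocalScreen ρ A U Λ) (h' : LocalScreen ρ A' U Λ')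
    (hpt : ∀ t ∈ U, ∃ c : ℝ, A' .pt t = c • A .pt t) {t : E} (ht : t ∈ U) :
    locInv ρ A' Λ' t = (-lform (A' .zero t) (A .top t))⁻¹ ^ (2 * ρ) * locInv ρ A Λ t := by
  have hf := h.frame
  have hf' := h'.frame
  have hb := hf.basis t ht
  have hb' := hf'.basis t ht
  have ho := hf.orthogonal t ht
  have ho' := hf'.orthogonal t ht
  let s : E → ℝ := fun x => -lform (A' .zero x) (A .top x)
  have hs0 : ∀ x ∈ U, A' .zero x = s x • A .zero x := fun x hx =>
    (hf.exists_zero_eq_smul hf' hpt hx).1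
  have hsne : s t ≠ 0 := neg_ne_zero.mpr (hf.exists_zero_eq_smul hf' hpt ht).2
  have hsm : ContDiffAt ℝ ∞ s t := ((hf'.smooth _ t ht).lform (hf.smooth _ t ht)).neg
  have hsx : ∀ x ∈ U, ContDiffAt ℝ ∞ s x := fun x hx =>
    ((hf'.smooth _ x hx).lform (hf.smooth _ x hx)).neg
  have hpd : ∀ u, ∀ x ∈ U, pd u (A' .zero) x = pd u s x • A .zero x + s x • pd u (A .zero) x := by
    intro u x hx
    rw [← pd_smul u (differentiableAt_of_smooth (hsx x hx)) (hf.diff hx _)]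
    exact pd_congr u ((hf.eventually_mem hx).mono hs0)
  obtain ⟨W, hW⟩ := hf.exists_dual ht
  obtain ⟨W', hW'⟩ := hf'.exists_dual ht
  have hAp : ∀ p, A (.mid (.inr p)) t = pd (W p) (A .zero) t - om A .zero .zero (W p) t • A .zero t := by
    intro p
    rw [hf.pd_zero ht]
    simp [hW]
  have hAp' : ∀ p, A' (.mid (.inr p)) t =
      pd (W' p) (A' .zero) t - om A' .zero .zero (W' p) t • A' .zero t := by
    intro p
    rw [hf'.pd_zero ht]
    simp [hW']
  have n0 : ∀ β, lform (A' (normalIdx β) t) (A .zero t) = 0 := by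
    intro β
    have := hb'.zero_normal β
    simp only [hs0 t ht, lform_smul_left] at this
    rw [lform_comm]
    exact (mul_eq_zero.mp this).resolve_left hsne
  -- Being orthogonal to A_0 and to all its derivatives, A_β' has no A_p-component in the old frame.
  have nd : ∀ β u, lform (A' (normalIdx β) t) (pd u (A .zero) t) = 0 := by
    intro β u
    have := hf'.pd_zero_normal ht β u
    rw [lform_comm, hpd u t ht, lform_add_right, lform_smul_right, lform_smul_right, n0, mul_zero,
      zero_add] at this
    exact (mul_eq_zero.mp this).resolve_left hsne
  let e : FrameIdx m r → LVec (m + r + 1) := fun ζ => A ζ t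
  let c : Matrix (Option (Fin m)) (Option (Fin m)) ℝ :=
    Matrix.of fun β γ => coeff e (A' (normalIdx β) t) (normalIdx γ)
  let κ : Option (Fin m) → ℝ := fun β => coeff e (A' (normalIdx β) t) .zero
  let d : Matrix (Fin r) (Fin r) ℝ :=
    Matrix.of fun p q => coeff e (A' (.mid (.inr p)) t) (.mid (.inr q))
  have hnor : ∀ β, A' (normalIdx β) t = κ β • A .zero t + ∑ γ, c β γ • A (normalIdx γ) t := by
    intro β
    conv_lhs => rw [hb.expand (A' (normalIdx β) t)]
    have h1 : coeff e (A' (normalIdx β) t) .top = 0 := by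
      rw [coeff_top_eq]
      exact neg_eq_zero.mpr (n0 β)
    have h2 : ∀ p, coeff e (A' (normalIdx β) t) (.mid (.inr p)) = 0 :=
      hf.eq_zero_of_lform_tan ht fun p => by
        rw [hAp, lform_sub_right, lform_smul_right, nd, n0, mul_zero, sub_zero]
    change _ + ∑ p, coeff e (A' (normalIdx β) t) _ • _ + coeff e (A' (normalIdx β) t) .top • _ = _
    simp only [h1, h2, zero_smul, Finset.sum_const_zero, add_zero]
    rfl
  have htan : ∀ p, A' (.mid (.inr p)) t = coeff e (A' (.mid (.inr p)) t) .zero • A .zero t +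
      ∑ q, d p q • A (.mid (.inr q)) t := by
    intro p
    conv_lhs => rw [hb.expand (A' (.mid (.inr p)) t)]
    have h1 : coeff e (A' (.mid (.inr p)) t) .top = 0 := by
      rw [coeff_top_eq, neg_eq_zero]
      have := hb'.zero_mid (.inr p)
      simp only [hs0 t ht, lform_smul_left] at this
      rw [lform_comm]
      exact (mul_eq_zero.mp this).resolve_left hsne
    have h2 : ∀ γ, coeff e (A' (.mid (.inr p)) t) (normalIdx γ) = 0 :=
      hf.eq_zero_of_lform_normal ht fun β => by
        rw [hAp', hpd _ t ht, hs0 t ht]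
        simp only [lform_sub_left, lform_add_left, lform_smul_left, hb.zero_normal,
          hf.pd_zero_normal ht, mul_zero, add_zero, sub_zero]
    change _ + ∑ γ, coeff e (A' (.mid (.inr p)) t) _ • _ + _ +
      coeff e (A' (.mid (.inr p)) t) .top • _ = _
    simp only [h1, h2, zero_smul, Finset.sum_const_zero, add_zero]
    rfl
  have hh : norGram (fun ζ => A' ζ t) = c * norGram (fun ζ => A ζ t) * c.transpose := by
    ext β β'
    simp only [norGram, Matrix.of_apply, Matrix.mul_apply, Matrix.transpose_apply]
    rw [hnor β, hnor β']
    simp only [lform_add_left, lform_add_right, lform_smul_left, lform_smul_right,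
      lform_finset_sum_left, lform_finset_sum_right, hb.zero_normal, hb.zero_zero,
      lform_comm (A (normalIdx _) t) (A .zero t), mul_zero, Finset.sum_const_zero, zero_add,
      Finset.mul_sum, Finset.sum_mul]
    refine Finset.sum_congr rfl fun γ _ => Finset.sum_congr rfl fun γ' _ => ?_
    ring
  have hg : tanGram (fun ζ => A' ζ t) = d * tanGram (fun ζ => A ζ t) * d.transpose := by
    ext p p'
    simp only [tanGram, Matrix.of_apply, Matrix.mul_apply, Matrix.transpose_apply]
    rw [htan p, htan p']
    simp only [lform_add_left, lform_add_right, lform_smul_left, lform_smul_right,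
      lform_finset_sum_left, lform_finset_sum_right, hb.zero_mid, hb.zero_zero,
      lform_comm (A (.mid _) t) (A .zero t), mul_zero, Finset.sum_const_zero, zero_add,
      Finset.mul_sum, Finset.sum_mul]
    refine Finset.sum_congr rfl fun γ _ => Finset.sum_congr rfl fun γ' _ => ?_
    ring
  have hgdet : (tanGram fun ζ => A' ζ t).det ≠ 0 := hb'.tanGram_posDef.det_pos.ne'
  have hhdet : (norGram fun ζ => A' ζ t).det ≠ 0 := hb'.norGram_posDef.det_pos.ne'
  have hdu : IsUnit d.det := by
    rw [hg, Matrix.det_mul, Matrix.det_mul] at hgdet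
    exact isUnit_iff_ne_zero.mpr (left_ne_zero_of_mul (left_ne_zero_of_mul hgdet))
  have hcu : IsUnit c.det := by
    rw [hh, Matrix.det_mul, Matrix.det_mul] at hhdet
    exact isUnit_iff_ne_zero.mpr (left_ne_zero_of_mul (left_ne_zero_of_mul hhdet))
  -- Comparison of the A_q-components of dA_0' = ds A_0 + s dA_0 along the directions dual to the
  -- new forms.
  have hwt : ∀ i q, om A .zero (.mid (.inr q)) (W' i) t = (s t)⁻¹ * d i q := by
    intro i q
    have h1 : coeff e (pd (W' i) (A' .zero) t) (.mid (.inr q)) = d i q := by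
      rw [hf'.pd_zero ht]
      simp only [hW', ite_smul, one_smul, zero_smul, Finset.sum_ite_eq', Finset.mem_univ, if_true]
      rw [coeff_add, coeff_smul, hs0 t ht, coeff_smul, hf.coeff_self_zero ht]
      simp [d]
    rw [hpd _ t ht, coeff_add, coeff_smul, coeff_smul, hf.coeff_self_zero ht] at h1
    simp only [mul_zero, zero_add] at h1
    rw [← h1, inv_mul_cancel_left₀ hsne]
    rfl
  have hsec : ∀ u w β, lform (pd u (pd w (A' .zero)) t) (A' (normalIdx β) t) =
      s t * (∑ γ, c β γ * lform (pd u (pd w (A .zero)) t) (A (normalIdx γ) t) -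
        κ β * lform (pd w (A .zero) t) (pd u (A .zero) t)) := by
    intro u w β
    have h1 : pd u (pd w (A' .zero)) t = pd u (pd w s) t • A .zero t + pd w s t • pd u (A .zero) t +
        (pd u s t • pd w (A .zero) t + s t • pd u (pd w (A .zero)) t) := by
      have hd1 := differentiableAt_of_smooth (contDiffAt_pd w hsm)
      have hd2 := differentiableAt_of_smooth (contDiffAt_pd w (hf.smooth .zero t ht))
      rw [pd_congr u ((hf.eventually_mem ht).mono (hpd w)),
        pd_add u (hd1.fun_smul (hf.diff ht _)) ((differentiableAt_of_smooth hsm).fun_smul hd2),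
        pd_smul u hd1 (hf.diff ht _), pd_smul u (differentiableAt_of_smooth hsm) hd2]
    -- The A_0-component κ_β of A_β' thus contributes a multiple of the metric, which the trace-free
    -- part of λ discards.
    have h2 : lform (pd u (pd w (A .zero)) t) (A .zero t) =
        -lform (pd w (A .zero) t) (pd u (A .zero) t) :=
      lform_pd_of_const u (contDiffAt_pd w (hf.smooth .zero t ht)) (hf.smooth .zero t ht)
        (c := 0) ((hf.eventually_mem ht).mono fun x hx => hf.pd_zero_zero hx w)
    have h3 : lform (pd u (pd w (A' .zero)) t) (A' (normalIdx β) t) =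
        s t * lform (pd u (pd w (A .zero)) t) (A' (normalIdx β) t) := by
      rw [h1, lform_add_left, lform_add_left, lform_add_left, lform_smul_left, lform_smul_left,
        lform_smul_left, lform_smul_left, lform_comm (A .zero t), n0,
        lform_comm (pd u (A .zero) t), nd, lform_comm (pd w (A .zero) t), nd]
      ring
    rw [h3, hnor β, lform_add_right, lform_smul_right, lform_finset_sum_right, h2]
    simp only [lform_smul_right]
    ring
  have hΛ : lowerIdx (norGram fun ζ => A' ζ t) (Λ' t) = fun β => (s t)⁻¹ • ∑ γ, c β γ •
      (d * lowerIdx (norGram fun ζ => A ζ t) (Λ t) γ * d.transpose) +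
      (-(s t)⁻¹ * κ β) • (d * tanGram (fun ζ => A ζ t) * d.transpose) := by
    funext β
    ext i j
    have h1 := hf'.second_form_eq ht (h'.lam t ht) β (W' j) (W' i)
    rw [hsec] at h1
    simp only [hf.second_form_eq ht (h.lam t ht), hf.lform_pd_zero_pd_zero ht, hwt, hW', mul_ite,
      mul_one, mul_zero, Finset.sum_ite_eq', Finset.mem_univ, if_true] at h1
    rw [← h1]
    simp only [Matrix.add_apply, Matrix.smul_apply, Matrix.sum_apply, Matrix.mul_apply,
      Matrix.transpose_apply, smul_eq_mul, mul_sub]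
    rw [sub_eq_add_neg]
    congr 1
    · simp only [Finset.mul_sum, Finset.sum_mul]
      refine Finset.sum_congr rfl fun γ _ => ?_
      rw [Finset.sum_comm]
      refine Finset.sum_congr rfl fun q _ => Finset.sum_congr rfl fun p _ => ?_
      field_simp
    · simp only [Finset.mul_sum, Finset.sum_mul, ← Finset.sum_neg_distrib]
      rw [Finset.sum_comm]
      refine Finset.sum_congr rfl fun q _ => Finset.sum_congr rfl fun p _ => ?_
      field_simp
  rw [locInv_eq hb', locInv_eq hb]
  change lowInv ρ (norGram fun ζ => A' ζ t) (tanGram fun ζ => A' ζ t)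
    (lowerIdx (norGram fun ζ => A' ζ t) (Λ' t)) = _
  rw [hΛ, hh, hg]
  exact lowInv_gauge (isUnit_iff_ne_zero.mpr hb.tanGram_posDef.det_pos.ne') tanGram_isSymm hdu
    (s t)⁻¹ hcu ρ _ _

/-- The normalized isotropic vector depends on the frame up to sign only. -/
theorem exists_sign_normZero (h : LocalScreen ρ A U Λ) (h' : LocalScreen ρ A' U Λ')
    (hpt : ∀ t ∈ U, ∃ c : ℝ, A' .pt t = c • A .pt t) {t : E} (ht : t ∈ U) :
    ∃ ε : ℝ, ε ≠ 0 ∧ normZero ρ A' Λ' =ᶠ[𝓝 t] fun x => ε • normZero ρ A Λ x := by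
  let s : E → ℝ := fun x => -lform (A' .zero x) (A .top x)
  have hs0 : ∀ x ∈ U, A' .zero x = s x • A .zero x := fun x hx =>
    (h.frame.exists_zero_eq_smul h'.frame hpt hx).1
  have hsne : s t ≠ 0 := neg_ne_zero.mpr (h.frame.exists_zero_eq_smul h'.frame hpt ht).2
  have hsm : ContDiffAt ℝ ∞ s t := ((h'.frame.smooth _ t ht).lform (h.frame.smooth _ t ht)).neg
  -- The factor s is continuous and nonzero, so its sign is locally constant.
  have hsgn : ∀ᶠ x in 𝓝 t, |s x|⁻¹ * s x = |s t|⁻¹ * s t := by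
    rcases lt_or_gt_of_ne hsne with hlt | hgt
    · filter_upwards [hsm.continuousAt.eventually_lt_const hlt] with x hx
      have hneg : ∀ y : ℝ, y < 0 → |y|⁻¹ * y = -1 := fun y hy => by
        rw [abs_of_neg hy, inv_neg, neg_mul, inv_mul_cancel₀ hy.ne]
      rw [hneg _ hx, hneg _ hlt]
    · filter_upwards [hsm.continuousAt.eventually_const_lt hgt] with x hx
      rw [abs_of_pos hgt, abs_of_pos hx]
      field_simp
  refine ⟨|s t|⁻¹ * s t, mul_ne_zero (inv_ne_zero (abs_ne_zero.mpr hsne)) hsne, ?_⟩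
  filter_upwards [hsgn, h.frame.eventually_mem ht] with x hx hxU
  have h2 : locInv ρ A' Λ' x = (s x)⁻¹ ^ (2 * ρ) * locInv ρ A Λ x := h.locInv_change h' hpt hxU
  have h3 : A' .zero x = s x • A .zero x := hs0 x hxU
  rw [← hx, normZero, normZero, h2, h3]
  -- The exponent 2ρ is even, so the root of order 2ρ of the factor is |s|⁻¹; against A_0' = s A_0
  -- only the sign of s remains.
  have h1 : (s x)⁻¹ ^ (2 * ρ) = |s x|⁻¹ ^ (2 * ρ) := by
    rw [← abs_inv, Even.pow_abs (even_two_mul ρ)]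
  rw [h1, Real.mul_rpow (by positivity) (h.pos x hxU).le, one_div,
    Real.pow_rpow_inv_natCast (by positivity) (by have := h.ne; omega)]
  module

theorem normSubspace_unique (h : LocalScreen ρ A U Λ) (h' : LocalScreen ρ A' U Λ')
    (hpt : ∀ t ∈ U, ∃ c : ℝ, A' .pt t = c • A .pt t) {t : E} (ht : t ∈ U) {μ μ' : Fin r → ℝ}
    (hμ : ∀ u, theta ρ A Λ u t = ∑ p, μ p * om A .zero (.mid (.inr p)) u t)
    (hμ' : ∀ u, theta ρ A' Λ' u t = ∑ p, μ' p * om A' .zero (.mid (.inr p)) u t) :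
    Submodule.span ℝ (Set.range fun p => A' (.mid (.inr p)) t + μ' p • A' .zero t) =
      Submodule.span ℝ (Set.range fun p => A (.mid (.inr p)) t + μ p • A .zero t) := by
  rw [h.span_pd_normZero ht hμ, h'.span_pd_normZero ht hμ']
  obtain ⟨ε, hε, hev⟩ := h.exists_sign_normZero h' hpt ht
  have hpd : ∀ u, pd u (normZero ρ A' Λ') t = ε • pd u (normZero ρ A Λ) t := by
    intro u
    rw [pd_congr u hev, pd_smul u (differentiableAt_const ε)
      (differentiableAt_of_smooth (h.contDiffAt_normZero ht)), pd_const, zero_smul, zero_add]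
  apply le_antisymm <;> rw [Submodule.span_le] <;> rintro _ ⟨u, rfl⟩ <;> rw [SetLike.mem_coe]
  · simp only [hpd]
    exact Submodule.smul_mem _ _ (Submodule.subset_span ⟨u, rfl⟩)
  · have : pd u (normZero ρ A Λ) t = ε⁻¹ • pd u (normZero ρ A' Λ') t := by
      rw [hpd, inv_smul_smul₀ hε]
    simp only [this]
    exact Submodule.smul_mem _ _ (Submodule.subset_span ⟨u, rfl⟩)

end LocalScreen

end LocalScreen

/-! ### Lightlike frames and the rank of `ν` -/

section LightFrames

variable {m r : ℕ}

/-- The coordinate space of a hypersurface of dimension `m + r + 1`. -/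
abbrev Par (m r : ℕ) : Type := EuclideanSpace ℝ (Fin (m + r + 1))

/-- A smooth frame associated with the points `A_n` of an immersed lightlike hypersurface, over an
open subset of the coordinate space. -/
structure LightFrame (A : FrameIdx m r → Par m r → LVec (m + r + 1)) (U : Set (Par m r)) :
    Prop where
  isOpen : IsOpen U
  smooth : ∀ ξ, ∀ t ∈ U, ContDiffAt ℝ ∞ (A ξ) t
  basis : ∀ t ∈ U, IsConformalBasis fun ξ => A ξ t
  tangent : ∀ t ∈ U, ∀ u, lform (pd u (A .pt) t) (A .zero t) = 0
  inj : ∀ t ∈ U, ∀ u, pd u (A .pt) t = 0 → u = 0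

/-- `ν` is the matrix of coefficients in `ω_i^{n+1} = ν_{ij} ω_n^j` at `t`. -/
def NuAt (A : FrameIdx m r → Par m r → LVec (m + r + 1)) (t : Par m r)
    (ν : Matrix (Fin m ⊕ Fin r) (Fin m ⊕ Fin r) ℝ) : Prop :=
  ∀ i u, om A (.mid i) .top u t = ∑ j, ν i j * om A .pt (.mid j) u t

namespace LightFrame

variable {A : FrameIdx m r → Par m r → LVec (m + r + 1)} {U : Set (Par m r)}
  (h : LightFrame A U) {t : Par m r} (ht : t ∈ U)

include h ht

theorem eventually_mem : ∀ᶠ s in 𝓝 t, s ∈ U := h.isOpen.mem_nhds ht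

theorem lform_pd_pt_pt (u : Par m r) : lform (pd u (A .pt) t) (A .pt t) = 0 := by
  have := lform_pd_of_const u (h.smooth .pt t ht) (h.smooth .pt t ht)
    ((h.eventually_mem ht).mono fun s hs => (h.basis s hs).pt_pt)
  rw [lform_comm (A .pt t)] at this
  linarith

theorem lform_pd_zero_zero (u : Par m r) : lform (pd u (A .zero) t) (A .zero t) = 0 := by
  have := lform_pd_of_const u (h.smooth .zero t ht) (h.smooth .zero t ht)
    ((h.eventually_mem ht).mono fun s hs => (h.basis s hs).zero_zero)
  rw [lform_comm (A .zero t)] at this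
  linarith

theorem lform_pd_zero_pt (u : Par m r) : lform (pd u (A .zero) t) (A .pt t) = 0 := by
  rw [lform_pd_of_const u (h.smooth .zero t ht) (h.smooth .pt t ht)
    ((h.eventually_mem ht).mono fun s hs => (h.basis s hs).zero_pt), lform_comm,
    h.tangent t ht, neg_zero]

theorem pd_pt (u : Par m r) : pd u (A .pt) t = om A .pt .zero u t • A .zero t +
    ∑ i, om A .pt (.mid i) u t • A (.mid i) t := by
  conv_lhs => rw [sum_coeff (h.basis t ht) (pd u (A .pt) t)]
  rw [coeff_pt_eq, coeff_top_eq, h.lform_pd_pt_pt ht, h.tangent t ht, neg_zero, zero_smul,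
    zero_smul, add_zero, add_zero]
  rfl

/-- An immersion depends on m + r + 1 parameters, as many as there are components along A_0 and the
A_i, so injectivity of dA_n gives surjectivity onto their span. -/
theorem surj (w : LVec (m + r + 1)) (h0 : lform w (A .zero t) = 0) (hp : lform w (A .pt t) = 0) :
    ∃ u, pd u (A .pt) t = w := by
  let Ψ : Par m r →ₗ[ℝ] ℝ × (Fin m ⊕ Fin r → ℝ) :=
    (omLin A .pt .zero t).prod (LinearMap.pi fun i => omLin A .pt (.mid i) t)
  have hinj : Function.Injective Ψ := by
    rw [injective_iff_map_eq_zero]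
    intro u hu
    refine h.inj t ht u ?_
    have h1 : om A .pt .zero u t = 0 := congrArg Prod.fst hu
    have h2 : ∀ i, om A .pt (.mid i) u t = 0 := fun i => congrFun (congrArg Prod.snd hu) i
    rw [h.pd_pt ht, h1]
    simp [h2]
  have hsurj : Function.Surjective Ψ := by
    refine (LinearMap.injective_iff_surjective_of_finrank_eq_finrank ?_).mp hinj
    simp
    omega
  obtain ⟨u, hu⟩ := hsurj (coeff (fun ζ => A ζ t) w .zero, fun i => coeff (fun ζ => A ζ t) w (.mid i))
  refine ⟨u, ?_⟩
  have h1 : om A .pt .zero u t = coeff (fun ζ => A ζ t) w .zero := congrArg Prod.fst hu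
  have h2 : ∀ i, om A .pt (.mid i) u t = coeff (fun ζ => A ζ t) w (.mid i) :=
    fun i => congrFun (congrArg Prod.snd hu) i
  conv_rhs => rw [sum_coeff (h.basis t ht) w]
  rw [h.pd_pt ht, h1, coeff_pt_eq, coeff_top_eq, h0, hp]
  simp [h2]

/-- The symmetry of the second fundamental form of the hypersurface. -/
theorem second_form_symm (u v : Par m r) :
    lform (pd u (A .pt) t) (pd v (A .zero) t) = lform (pd v (A .pt) t) (pd u (A .zero) t) := by
  have key : ∀ a b : Par m r, lform (pd a (pd b (A .pt)) t) (A .zero t) =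
      -lform (pd b (A .pt) t) (pd a (A .zero) t) := fun a b =>
    lform_pd_of_const a (contDiffAt_pd b (h.smooth .pt t ht)) (h.smooth .zero t ht)
      ((h.eventually_mem ht).mono fun s hs => h.tangent s hs b)
  have h1 := key v u
  rw [pd_comm v u (h.smooth .pt t ht), key u v] at h1
  linarith

theorem pd_zero (u : Par m r) : pd u (A .zero) t = om A .zero .zero u t • A .zero t +
    ∑ i, om A .zero (.mid i) u t • A (.mid i) t := by
  conv_lhs => rw [sum_coeff (h.basis t ht) (pd u (A .zero) t)]
  rw [coeff_pt_eq, coeff_top_eq, h.lform_pd_zero_pt ht, h.lform_pd_zero_zero ht, neg_zero,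
    zero_smul, zero_smul, add_zero, add_zero]
  rfl

theorem om_mid_top (i : Fin m ⊕ Fin r) (u : Par m r) :
    om A (.mid i) .top u t = lform (A (.mid i) t) (pd u (A .zero) t) := by
  rw [om, coeff_top_eq, lform_pd_of_const u (h.smooth (.mid i) t ht) (h.smooth .zero t ht)
    (c := 0) ((h.eventually_mem ht).mono fun s hs => by rw [lform_comm, (h.basis s hs).zero_mid]),
    neg_neg]

/-- Directions dual to the forms `ω_n^i`. -/
theorem exists_dual : ∃ W : Fin m ⊕ Fin r → Par m r, ∀ i, pd (W i) (A .pt) t = A (.mid i) t := by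
  have hb := h.basis t ht
  choose W hW using fun i => h.surj ht (A (.mid i) t)
    (by rw [lform_comm, hb.zero_mid]) (hb.mid_pt i)
  exact ⟨W, hW⟩

/-- By the symmetry of the second form, (A_i, dA_0(u)) is the product of dA_n(u) with the derivative
of A_0 in a fixed direction, which is visibly a combination of the ω_n^j(u). -/
theorem exists_nuAt : ∃ ν, NuAt A t ν := by
  obtain ⟨W, hW⟩ := h.exists_dual ht
  refine ⟨Matrix.of fun i j => lform (A (.mid j) t) (pd (W i) (A .zero) t), fun i u => ?_⟩
  rw [h.om_mid_top ht, ← hW i, h.second_form_symm ht, h.pd_pt ht, lform_add_left, lform_smul_left,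
    lform_comm (A .zero t), h.lform_pd_zero_zero ht, mul_zero, zero_add, lform_finset_sum_left]
  refine Finset.sum_congr rfl fun j _ => ?_
  rw [lform_smul_left, mul_comm]
  rfl

/-- The rank of `ν` is the rank of the system of the forms `ω_i^{n+1}`. -/
theorem rank_nu {ν : Matrix (Fin m ⊕ Fin r) (Fin m ⊕ Fin r) ℝ} (hν : NuAt A t ν) :
    ν.rank = Module.finrank ℝ (LinearMap.range (LinearMap.pi fun i => omLin A (.mid i) .top t)) := by
  have h1 : ∀ u, (LinearMap.pi fun i => omLin A (.mid i) .top t) u =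
      ν.mulVecLin (fun j => om A .pt (.mid j) u t) := fun u => funext fun i => hν i u
  have h2 : ∀ c : Fin m ⊕ Fin r → ℝ, ∃ u, (fun j => om A .pt (.mid j) u t) = c := by
    intro c
    have hb := h.basis t ht
    obtain ⟨u, hu⟩ := h.surj ht (∑ i, c i • A (.mid i) t)
      (by simp only [lform_comm _ (A .zero t), lform_finset_sum_right, lform_smul_right,
        hb.zero_mid, mul_zero, Finset.sum_const_zero])
      (by simp only [lform_finset_sum_left, lform_smul_left, hb.mid_pt, mul_zero,
        Finset.sum_const_zero])
    refine ⟨u, funext fun j => ?_⟩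
    rw [om, hu]
    exact (hb.coeff_eq (c0 := 0) (cn := 0) (ct := 0) (c := c) (by simp)).2.1 j
  have h3 : LinearMap.range ν.mulVecLin =
      LinearMap.range (LinearMap.pi fun i => omLin A (.mid i) .top t) := by
    ext x
    simp only [LinearMap.mem_range]
    constructor
    · rintro ⟨c, rfl⟩
      obtain ⟨u, rfl⟩ := h2 c
      exact ⟨u, h1 u⟩
    · rintro ⟨u, rfl⟩
      exact ⟨_, (h1 u).symm⟩
  rw [Matrix.rank, h3]

end LightFrame

/-- A light frame with quasidiagonal `g_{ij}` and `ν_{ij}`, the rank of `ν` being `r`, is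
a local frame. -/
theorem LightFrame.toLocalFrame {A : FrameIdx m r → Par m r → LVec (m + r + 1)} {U : Set (Par m r)}
    (h : LightFrame A U)
    (ho : ∀ t ∈ U, ∀ a p, lform (A (.mid (.inl a)) t) (A (.mid (.inr p)) t) = 0)
    (hk : ∀ t ∈ U, ∀ a u, om A (.mid (.inl a)) .top u t = 0)
    (hr : ∀ t ∈ U, ∀ ν, NuAt A t ν → ν.rank = r) : LocalFrame A U where
  isOpen := h.isOpen
  smooth := h.smooth
  basis := h.basis
  orthogonal := ho
  normal_zero t ht α u := by
    cases α with
    | none => exact h.tangent t ht u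
    | some a => exact neg_eq_zero.mp (hk t ht a u)
  surj t ht := h.surj ht
  indep t ht c := by
    obtain ⟨ν, hν⟩ := h.exists_nuAt ht
    have hrank := h.rank_nu ht hν
    rw [hr t ht ν hν] at hrank
    set R := LinearMap.range (LinearMap.pi fun i => omLin A (.mid i) .top t) with hR
    -- The forms ω_a^{n+1} vanish, so the last r coordinates are injective on the range of all
    -- ω_i^{n+1}; this range has dimension r, so they are also onto. Inverting g_{pq} then makes the
    -- ω_0^p independent.
    let π : R →ₗ[ℝ] (Fin r → ℝ) :=
      (LinearMap.pi fun p => LinearMap.proj (Sum.inr p)).comp R.subtype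
    have hinj : Function.Injective π := by
      rw [injective_iff_map_eq_zero]
      rintro ⟨x, u, rfl⟩ hx
      refine Subtype.ext (funext fun i => ?_)
      cases i with
      | inl a => exact hk t ht a u
      | inr p => exact congrFun hx p
    have hsurj : Function.Surjective π := by
      refine (LinearMap.injective_iff_surjective_of_finrank_eq_finrank ?_).mp hinj
      rw [← hrank]
      simp
    obtain ⟨⟨_, u, rfl⟩, hu⟩ := hsurj ((tanGram fun ζ => A ζ t).mulVec c)
    have hu' : ∀ p, lform (A (.mid (.inr p)) t) (pd u (A .zero) t) =
        (tanGram fun ζ => A ζ t).mulVec c p := by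
      intro p
      rw [← h.om_mid_top ht]
      exact congrFun hu p
    have h1 : (tanGram fun ζ => A ζ t).mulVec (fun p => om A .zero (.mid (.inr p)) u t) =
        (tanGram fun ζ => A ζ t).mulVec c := by
      funext p
      rw [← hu', h.pd_zero ht, lform_add_right, lform_smul_right, lform_comm _ (A .zero t),
        (h.basis t ht).zero_mid, mul_zero, zero_add, lform_finset_sum_right,
        Fintype.sum_sum_type]
      simp only [lform_smul_right, lform_comm (A (.mid (.inr _)) t) (A (.mid (.inl _)) t),
        ho t ht, mul_zero, Finset.sum_const_zero, zero_add, Matrix.mulVec, dotProduct]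
      exact Finset.sum_congr rfl fun q _ => mul_comm _ _
    have hdet : IsUnit (tanGram fun ζ => A ζ t).det :=
      isUnit_iff_ne_zero.mpr (h.basis t ht).tanGram_posDef.det_pos.ne'
    have h2 := congrArg (fun x => (tanGram fun ζ => A ζ t)⁻¹.mulVec x) h1
    simp only [Matrix.mulVec_mulVec, Matrix.nonsing_inv_mul _ hdet, Matrix.one_mulVec] at h2
    exact ⟨u, fun p => congrFun h2 p⟩

end LightFrames

/-! ### Passage from manifolds to coordinate spaces -/

section Transfer

variable {m r : ℕ} {N : Type*} [TopologicalSpace N]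
  [ChartedSpace (EuclideanSpace ℝ (Fin (m + r + 1))) N]

/-- Smooth coordinates on an open part of a manifold. -/
abbrev Coords (m r : ℕ) (N : Type*) [TopologicalSpace N]
    [ChartedSpace (EuclideanSpace ℝ (Fin (m + r + 1))) N] : Type _ :=
  PartialDiffeomorph (𝓡 (m + r + 1)) (𝓡 (m + r + 1)) (Par m r) N ∞

/-- The coordinates given by the preferred chart at a point. -/
def chartCoords [IsManifold (𝓡 (m + r + 1)) ∞ N] (q : N) : Coords m r N where
  toPartialEquiv := (chartAt (Par m r) q).symm.toPartialEquiv
  open_source := (chartAt (Par m r) q).symm.open_source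
  open_target := (chartAt (Par m r) q).symm.open_target
  contMDiffOn_toFun := contMDiffOn_chart_symm
  contMDiffOn_invFun := contMDiffOn_chart

theorem exists_coords [IsManifold (𝓡 (m + r + 1)) ∞ N] (q : N) :
    ∃ (Φ : Coords m r N) (t : Par m r), t ∈ Φ.source ∧ Φ t = q := by
  refine ⟨chartCoords q, chartAt (Par m r) q q, ?_, ?_⟩
  · exact (chartAt (Par m r) q).map_source (mem_chart_source _ q)
  · exact (chartAt (Par m r) q).left_inv (mem_chart_source _ q)

namespace Coords

variable (Φ : Coords m r N) {t : Par m r}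

/-- The differential of the coordinates. -/
def d (t : Par m r) (u : Par m r) : TangentSpace (𝓡 (m + r + 1)) (Φ t) :=
  mfderiv (𝓡 (m + r + 1)) (𝓡 (m + r + 1)) Φ t u

theorem d_bijective (ht : t ∈ Φ.source) : Function.Bijective (Φ.d t) :=
  ((Φ.isLocalDiffeomorphAt _ _ _ ht).mfderivToContinuousLinearEquiv (by simp)).bijective

theorem preimage_isOpen {W : Set N} (hW : IsOpen W) : IsOpen (Φ.source ∩ Φ ⁻¹' W) :=
  Φ.toOpenPartialHomeomorph.isOpen_inter_preimage hW

variable {G : Type*} [NormedAddCommGroup G] [NormedSpace ℝ G]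

theorem contMDiffAt_iff (ht : t ∈ Φ.source) {F : N → G} :
    ContMDiffAt (𝓡 (m + r + 1)) 𝓘(ℝ, G) ∞ F (Φ t) ↔ ContDiffAt ℝ ∞ (fun s => F (Φ s)) t := by
  constructor
  · intro hF
    exact (hF.comp t (Φ.contMDiffOn.contMDiffAt (Φ.open_source.mem_nhds ht))).contDiffAt
  · intro hF
    have ht' : Φ t ∈ Φ.target := Φ.map_source ht
    have h1 : ContMDiffAt (𝓡 (m + r + 1)) (𝓡 (m + r + 1)) ∞ Φ.symm (Φ t) :=
      Φ.symm.contMDiffOn.contMDiffAt (Φ.open_target.mem_nhds ht')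
    have h2 : Φ.symm (Φ t) = t := Φ.left_inv ht
    have h3 : ContMDiffAt (𝓡 (m + r + 1)) 𝓘(ℝ, G) ∞ (fun s => F (Φ s)) (Φ.symm (Φ t)) := by
      rw [h2]; exact hF.contMDiffAt
    refine (h3.comp (Φ t) h1).congr_of_eventuallyEq ?_
    filter_upwards [Φ.open_target.mem_nhds ht'] with q hq
    exact congrArg F (Φ.right_inv hq).symm

theorem contDiffAt_of_contMDiffOn (ht : t ∈ Φ.source) {F : N → G} {W : Set N} (hW : IsOpen W)
    (hF : ContMDiffOn (𝓡 (m + r + 1)) 𝓘(ℝ, G) ∞ F W) (htW : Φ t ∈ W) :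
    ContDiffAt ℝ ∞ (fun s => F (Φ s)) t :=
  (Φ.contMDiffAt_iff ht).mp (hF.contMDiffAt (hW.mem_nhds htW))

theorem dAt_d (ht : t ∈ Φ.source) {F : N → G} (hF : ContDiffAt ℝ ∞ (fun s => F (Φ s)) t)
    (u : Par m r) : dAt (n := m + r + 1) F (Φ t) (Φ.d t u) = pd u (fun s => F (Φ s)) t := by
  have h1 : MDifferentiableAt (𝓡 (m + r + 1)) 𝓘(ℝ, G) F (Φ t) :=
    ((Φ.contMDiffAt_iff ht).mpr hF).mdifferentiableAt (by simp)
  have h2 := mfderiv_comp t h1 (Φ.mdifferentiableAt (by simp) ht)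
  have h3 : mfderiv (𝓡 (m + r + 1)) 𝓘(ℝ, G) (F ∘ Φ) t = fderiv ℝ (F ∘ Φ) t := mfderiv_eq_fderiv
  rw [h3] at h2
  exact (congrArg (fun L => L u) h2).symm

end Coords

/-- A moving frame read in coordinates. -/
def pull (A : FrameIdx m r → N → LVec (m + r + 1)) (Φ : Coords m r N) :
    FrameIdx m r → Par m r → LVec (m + r + 1) := fun ξ t => A ξ (Φ t)

/-- The moving frame on a manifold with a given expression in coordinates. -/
def push (A : FrameIdx m r → Par m r → LVec (m + r + 1)) (Φ : Coords m r N) :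
    FrameIdx m r → N → LVec (m + r + 1) := fun ξ q => A ξ (Φ.symm q)

theorem pull_push (A : FrameIdx m r → Par m r → LVec (m + r + 1)) (Φ : Coords m r N)
    {t : Par m r} (ht : t ∈ Φ.source) (ξ : FrameIdx m r) : pull (push A Φ) Φ ξ t = A ξ t :=
  congrArg (A ξ) (Φ.left_inv ht)

/-! ### The defining relations of ν, λ and μ in coordinates -/

section Pull

variable {A : FrameIdx m r → N → LVec (m + r + 1)} {Φ : Coords m r N} {t : Par m r}
  (ht : t ∈ Φ.source)

include ht

theorem omega_d {ξ : FrameIdx m r} (hA : ContDiffAt ℝ ∞ (pull A Φ ξ) t) (η : FrameIdx m r)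
    (u : Par m r) : omega A (Φ t) ξ η (Φ.d t u) = om (pull A Φ) ξ η u t := by
  rw [omega, Φ.dAt_d ht hA]
  rfl

theorem forall_tangent {P : TangentSpace (𝓡 (m + r + 1)) (Φ t) → Prop} :
    (∀ v, P v) ↔ ∀ u, P (Φ.d t u) :=
  (Φ.d_bijective ht).surjective.forall

theorem isNu_iff (hA : ∀ ξ, ContDiffAt ℝ ∞ (pull A Φ ξ) t)
    (ν : Matrix (Fin m ⊕ Fin r) (Fin m ⊕ Fin r) ℝ) : IsNu A (Φ t) ν ↔ NuAt (pull A Φ) t ν := by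
  simp only [IsNu, NuAt, forall_tangent ht, omega_d ht (hA _)]

theorem isLambda_iff (hA : ∀ ξ, ContDiffAt ℝ ∞ (pull A Φ ξ) t)
    (Λ : Option (Fin m) → Matrix (Fin r) (Fin r) ℝ) :
    IsLambda A (Φ t) Λ ↔ LamAt (pull A Φ) t Λ := by
  simp only [IsLambda, LamAt, forall_tangent ht, omega_d ht (hA _)]

theorem isMu_iff (hA : ∀ ξ, ContDiffAt ℝ ∞ (pull A Φ ξ) t) {ρ : ℕ}
    {Λ : N → Option (Fin m) → Matrix (Fin r) (Fin r) ℝ}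
    (hΛ : ContDiffAt ℝ ∞ (locInv ρ (pull A Φ) fun s => Λ (Φ s)) t) (μ : Fin r → ℝ) :
    IsMu ρ A Λ (Φ t) μ ↔ ∀ u, theta ρ (pull A Φ) (fun s => Λ (Φ s)) u t =
      ∑ p, μ p * om (pull A Φ) .zero (.mid (.inr p)) u t := by
  have h1 : ∀ u, dAt (n := m + r + 1) (relInv ρ A Λ) (Φ t) (Φ.d t u) =
      pd u (locInv ρ (pull A Φ) fun s => Λ (Φ s)) t := fun u => Φ.dAt_d ht hΛ u
  simp only [IsMu, forall_tangent ht, omega_d ht (hA _), h1]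
  rfl

end Pull

variable {f : N → ℙ ℝ (LVec (m + r + 1))}

/-- If two normalized representations of a hypersurface are proportional, they are immersions
simultaneously. -/
theorem pd_eq_zero_of_smul {n : ℕ} {E : Type*} [NormedAddCommGroup E] [NormedSpace ℝ E]
    {F G : E → LVec n} {t : E}
    (hF : ContDiffAt ℝ ∞ F t) (hG : ContDiffAt ℝ ∞ G t) (hF1 : ∀ᶠ s in 𝓝 t, lform (F s) (F s) = 1)
    (hG1 : ∀ᶠ s in 𝓝 t, lform (G s) (G s) = 1)
    (h : ∀ᶠ s in 𝓝 t, ∃ c : ℝ, G s = c • F s) {u : E} (hu : pd u G t = 0) : pd u F t = 0 := by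
  set c : E → ℝ := fun s => lform (G s) (F s) with hc
  have hcG : ∀ᶠ s in 𝓝 t, G s = c s • F s := by
    filter_upwards [h, hF1] with s ⟨d, hd⟩ h1
    rw [hc]
    simp only [hd, lform_smul_left, h1, mul_one]
  have hcd : ContDiffAt ℝ ∞ c t := hG.lform hF
  have h1 : pd u G t = pd u c t • F t + c t • pd u F t := by
    rw [pd_congr u hcG, pd_smul u (differentiableAt_of_smooth hcd) (differentiableAt_of_smooth hF)]
  have h2 : lform (pd u F t) (F t) = 0 := by
    have := lform_pd_of_const u hF hF hF1
    rw [lform_comm (F t)] at this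
    linarith
  rw [hu] at h1
  -- (dF, F) = 0 and (F, F) = 1, so the product with F isolates dc.
  have h3 : pd u c t = 0 := by
    have := congrArg (fun w => lform w (F t)) h1
    simp only [lform_zero_left, lform_add_left, lform_smul_left, h2, hF1.self_of_nhds, mul_one,
      mul_zero, add_zero] at this
    exact this.symm
  rw [h3, zero_smul, zero_add] at h1
  refine (smul_eq_zero.mp h1.symm).resolve_left fun h0 => ?_
  have := hG1.self_of_nhds
  rw [hcG.self_of_nhds, h0, zero_smul, lform_zero_left] at this
  exact zero_ne_one this

theorem exists_smul_of_span_eq {V : Type*} [AddCommGroup V] [Module ℝ V] {x y : V}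
    {S : Submodule ℝ V} (hx : S = Submodule.span ℝ {x}) (hy : S = Submodule.span ℝ {y}) :
    ∃ c : ℝ, y = c • x := by
  have : y ∈ Submodule.span ℝ {x} := by
    rw [← hx, hy]; exact Submodule.mem_span_singleton_self y
  obtain ⟨c, hc⟩ := Submodule.mem_span_singleton.mp this
  exact ⟨c, hc.symm⟩

/-- In coordinates, a hypersurface has a normalized immersed representation. -/
theorem IsLightlikeHypersurface.exists_lift (hf : IsLightlikeHypersurface f) (Φ : Coords m r N)
    {t : Par m r} (ht : t ∈ Φ.source) : ∃ (U : Set (Par m r)) (F : Par m r → LVec (m + r + 1)),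
      IsOpen U ∧ t ∈ U ∧ U ⊆ Φ.source ∧ (∀ s ∈ U, ContDiffAt ℝ ∞ F s) ∧
      (∀ s ∈ U, lform (F s) (F s) = 1) ∧
      (∀ s ∈ U, (f (Φ s)).submodule = Submodule.span ℝ {F s}) ∧
      (∀ s ∈ U, ∀ u, pd u F s = 0 → u = 0) ∧
      ∀ s ∈ U, ∃ y : LVec (m + r + 1), y ≠ 0 ∧ lform y y = 0 ∧ lform y (F s) = 0 ∧
        ∀ u, lform y (pd u F s) = 0 := by
  obtain ⟨W, F, hWo, htW, hF, hW⟩ := hf (Φ t)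
  have hsm : ∀ s ∈ Φ.source ∩ Φ ⁻¹' W, ContDiffAt ℝ ∞ (fun s => F (Φ s)) s := fun s hs =>
    Φ.contDiffAt_of_contMDiffOn hs.1 hWo hF.smooth hs.2
  refine ⟨Φ.source ∩ Φ ⁻¹' W, fun s => F (Φ s), Φ.preimage_isOpen hWo, ⟨ht, htW⟩,
    Set.inter_subset_left, hsm, fun s hs => hF.unit _ hs.2, fun s hs => hF.lift _ hs.2,
    fun s hs u hu => ?_, fun s hs => ?_⟩
  · rw [← Φ.dAt_d hs.1 (hsm s hs)] at hu
    have h0 : Φ.d s u = 0 := (hW _ hs.2).1 (hu.trans (map_zero _).symm)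
    refine (Φ.d_bijective hs.1).injective (h0.trans ?_)
    exact (map_zero (mfderiv (𝓡 (m + r + 1)) (𝓡 (m + r + 1)) Φ s)).symm
  · obtain ⟨y, hy0, hyy, hy⟩ := (hW _ hs.2).2
    refine ⟨y, hy0, hyy, hy _ (Submodule.mem_sup_left (Submodule.mem_span_singleton_self _)),
      fun u => ?_⟩
    rw [← Φ.dAt_d hs.1 (hsm s hs)]
    exact hy _ (Submodule.mem_sup_right ⟨_, rfl⟩)

theorem IsLightlikeFrame.contDiffAt_pull {W : Set N} {A : FrameIdx m r → N → LVec (m + r + 1)}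
    (hA : IsLightlikeFrame f W A) {Φ : Coords m r N} {t : Par m r} (ht : t ∈ Φ.source)
    (htW : Φ t ∈ W) (ξ : FrameIdx m r) : ContDiffAt ℝ ∞ (pull A Φ ξ) t :=
  Φ.contDiffAt_of_contMDiffOn ht hA.isOpen (hA.smooth ξ) htW

theorem IsLightlikeFrame.lightFrame (hf : IsLightlikeHypersurface f) {W : Set N}
    {A : FrameIdx m r → N → LVec (m + r + 1)} (hA : IsLightlikeFrame f W A) (Φ : Coords m r N) :
    LightFrame (pull A Φ) (Φ.source ∩ Φ ⁻¹' W) where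
  isOpen := Φ.preimage_isOpen hA.isOpen
  smooth ξ t ht := hA.contDiffAt_pull ht.1 ht.2 ξ
  basis t ht := hA.basis _ ht.2
  tangent t ht u := by
    have := hA.tangent _ ht.2 (Φ.d t u)
    rw [omega_d ht.1 (hA.contDiffAt_pull ht.1 ht.2 _)] at this
    exact neg_eq_zero.mp this
  inj t ht u hu := by
    obtain ⟨U, F, hUo, htU, -, hFs, hF1, hFl, hFi, -⟩ := hf.exists_lift Φ ht.1
    have hW : ∀ᶠ s in 𝓝 t, s ∈ Φ.source ∩ Φ ⁻¹' W :=
      (Φ.preimage_isOpen hA.isOpen).mem_nhds ht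
    have hU : ∀ᶠ s in 𝓝 t, s ∈ U := hUo.mem_nhds htU
    refine hFi t htU u (pd_eq_zero_of_smul (hFs t htU)
      (hA.contDiffAt_pull ht.1 ht.2 .pt) (hU.mono hF1)
      (hW.mono fun s hs => (hA.basis _ hs.2).pt_pt) ?_ hu)
    filter_upwards [hW, hU] with s hs hs'
    exact exists_smul_of_span_eq (hFl s hs') (hA.lift _ hs.2)

theorem IsAdaptedFrame.localFrame (hf : IsLightlikeHypersurface f) (hr : HasReducedRank m r f)
    {W : Set N} {A : FrameIdx m r → N → LVec (m + r + 1)} (hA : IsAdaptedFrame f W A)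
    (Φ : Coords m r N) : LocalFrame (pull A Φ) (Φ.source ∩ Φ ⁻¹' W) :=
  (hA.toIsLightlikeFrame.lightFrame hf Φ).toLocalFrame (fun t ht => hA.orthogonal _ ht.2)
    (fun _ ht a u => by
      rw [← omega_d ht.1 (hA.contDiffAt_pull ht.1 ht.2 _)]
      exact hA.kernel _ ht.2 a _)
    (fun _ ht ν hν => hr W A hA.toIsLightlikeFrame _ ht.2 ν
      ((isNu_iff ht.1 (hA.contDiffAt_pull ht.1 ht.2) ν).mpr hν))

theorem IsAdaptedFrame.pull_localScreen (hf : IsLightlikeHypersurface f)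
    (hr : HasReducedRank m r f) {ρ : ℕ} (hρ : ρ ≠ 0) (hM : HasMatrixRank ρ f)
    {W : Set N} {A : FrameIdx m r → N → LVec (m + r + 1)} (hA : IsAdaptedFrame f W A)
    {Λ : N → Option (Fin m) → Matrix (Fin r) (Fin r) ℝ} (hΛ : ∀ q ∈ W, IsLambda A q (Λ q))
    (Φ : Coords m r N) :
    LocalScreen ρ (pull A Φ) (Φ.source ∩ Φ ⁻¹' W) (fun t => Λ (Φ t)) where
  frame := hA.localFrame hf hr Φ
  lam _ ht := (isLambda_iff ht.1 (hA.contDiffAt_pull ht.1 ht.2) _).mp (hΛ _ ht.2)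
  pos _ ht := sumDiagMinors_mixedTensor_pos (hA.basis _ ht.2).tanGram_posDef
    (hA.basis _ ht.2).norGram_posDef (hM W A hA _ ht.2 _ (hΛ _ ht.2))
  ne := hρ

/-! ### Passage from coordinate spaces to manifolds -/

theorem push_isOpen {U : Set (Par m r)} (hU : IsOpen U) (Φ : Coords m r N) :
    IsOpen (Φ.target ∩ Φ.symm ⁻¹' U) :=
  Φ.symm.toOpenPartialHomeomorph.isOpen_inter_preimage hU

theorem mem_push {U : Set (Par m r)} {Φ : Coords m r N} (hU : U ⊆ Φ.source) {q : N} :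
    q ∈ Φ.target ∩ Φ.symm ⁻¹' U ↔ ∃ t ∈ U, Φ t = q := by
  constructor
  · rintro ⟨h1, h2⟩
    exact ⟨_, h2, Φ.right_inv h1⟩
  · rintro ⟨t, ht, rfl⟩
    refine ⟨Φ.map_source (hU ht), ?_⟩
    have : Φ.symm (Φ t) = t := Φ.left_inv (hU ht)
    rwa [Set.mem_preimage, this]

theorem contDiffAt_pull_push {A : FrameIdx m r → Par m r → LVec (m + r + 1)} {Φ : Coords m r N}
    {t : Par m r} (ht : t ∈ Φ.source) {ξ : FrameIdx m r} (hA : ContDiffAt ℝ ∞ (A ξ) t) :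
    ContDiffAt ℝ ∞ (pull (push A Φ) Φ ξ) t :=
  hA.congr_of_eventuallyEq (Filter.eventuallyEq_of_mem (Φ.open_source.mem_nhds ht)
    fun _ hs => pull_push A Φ hs ξ)

theorem om_pull_push {A : FrameIdx m r → Par m r → LVec (m + r + 1)} {Φ : Coords m r N}
    {t : Par m r} (ht : t ∈ Φ.source) (ξ η : FrameIdx m r) (u : Par m r) :
    om (pull (push A Φ) Φ) ξ η u t = om A ξ η u t := by
  have h1 : (fun ζ => pull (push A Φ) Φ ζ t) = fun ζ => A ζ t :=
    funext fun ζ => pull_push A Φ ht ζ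
  rw [om, h1, pd_congr u (Filter.eventuallyEq_of_mem (Φ.open_source.mem_nhds ht)
    fun _ hs => pull_push A Φ hs ξ)]
  rfl

theorem LightFrame.isLightlikeFrame {A : FrameIdx m r → Par m r → LVec (m + r + 1)} {U : Set (Par m r)}
    (hA : LightFrame A U) {Φ : Coords m r N} (hU : U ⊆ Φ.source)
    (hl : ∀ t ∈ U, (f (Φ t)).submodule = Submodule.span ℝ {A .pt t}) :
    IsLightlikeFrame f (Φ.target ∩ Φ.symm ⁻¹' U) (push A Φ) where
  isOpen := push_isOpen hA.isOpen Φ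
  smooth ξ q hq := by
    obtain ⟨t, ht, rfl⟩ := (mem_push hU).mp hq
    exact ((Φ.contMDiffAt_iff (hU ht)).mpr
      (contDiffAt_pull_push (hU ht) (hA.smooth ξ t ht))).contMDiffWithinAt
  basis q hq := hA.basis _ hq.2
  lift q hq := by
    obtain ⟨t, ht, rfl⟩ := (mem_push hU).mp hq
    rw [hl t ht]
    exact congrArg (fun x => Submodule.span ℝ {x}) (pull_push A Φ (hU ht) .pt).symm
  tangent q hq := by
    obtain ⟨t, ht, rfl⟩ := (mem_push hU).mp hq
    rw [forall_tangent (hU ht)]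
    intro u
    rw [omega_d (hU ht) (contDiffAt_pull_push (hU ht) (hA.smooth _ t ht)), om_pull_push (hU ht)]
    exact neg_eq_zero.mpr (hA.tangent t ht u)

/-- The rank hypothesis speaks about frames on the manifold; a frame constructed in coordinates is
first transported there. -/
theorem HasReducedRank.rank_nu (hr : HasReducedRank m r f)
    {A : FrameIdx m r → Par m r → LVec (m + r + 1)} {U : Set (Par m r)}
    (hA : LightFrame A U) {Φ : Coords m r N} (hU : U ⊆ Φ.source)
    (hl : ∀ t ∈ U, (f (Φ t)).submodule = Submodule.span ℝ {A .pt t}) {t : Par m r} (ht : t ∈ U)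
    {ν : Matrix (Fin m ⊕ Fin r) (Fin m ⊕ Fin r) ℝ} (hν : NuAt A t ν) : ν.rank = r := by
  refine hr _ _ (hA.isLightlikeFrame hU hl) (Φ t) ((mem_push hU).mpr ⟨t, ht, rfl⟩) ν ?_
  rw [isNu_iff (hU ht) fun ξ => contDiffAt_pull_push (hU ht) (hA.smooth ξ t ht)]
  simpa only [NuAt, om_pull_push (hU ht)] using hν

/-- The same dimension count as in `LightFrame.surj`, in the opposite direction. -/
theorem LocalFrame.inj {A : FrameIdx m r → Par m r → LVec (m + r + 1)} {U : Set (Par m r)}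
    (hA : LocalFrame A U) {t : Par m r} (ht : t ∈ U) {u : Par m r} (hu : pd u (A .pt) t = 0) :
    u = 0 := by
  let Ψ : Par m r →ₗ[ℝ] ℝ × (Fin m ⊕ Fin r → ℝ) :=
    (omLin A .pt .zero t).prod (LinearMap.pi fun i => omLin A .pt (.mid i) t)
  have hb := hA.basis t ht
  have hsurj : Function.Surjective Ψ := by
    rintro ⟨c, d⟩
    obtain ⟨u, hu⟩ := hA.surj t ht (c • A .zero t + ∑ i, d i • A (.mid i) t)
      (by simp only [lform_comm _ (A .zero t), lform_add_right, lform_finset_sum_right,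
        lform_smul_right, hb.zero_mid, hb.zero_zero, mul_zero, Finset.sum_const_zero, add_zero])
      (by simp only [lform_add_left, lform_finset_sum_left, lform_smul_left, hb.mid_pt,
        hb.zero_pt, mul_zero, Finset.sum_const_zero, add_zero])
    have := hb.coeff_eq (w := pd u (A .pt) t) (c0 := c) (cn := 0) (ct := 0) (c := d)
      (by rw [hu]; simp)
    exact ⟨u, Prod.ext this.1 (funext this.2.1)⟩
  have hinj : Function.Injective Ψ := by
    refine (LinearMap.injective_iff_surjective_of_finrank_eq_finrank ?_).mpr hsurj
    simp
    omega
  refine hinj (Eq.trans ?_ (map_zero Ψ).symm)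
  refine Prod.ext ?_ (funext fun i => ?_)
  · change coeff (fun ζ => A ζ t) (pd u (A .pt) t) .zero = 0
    rw [hu, ← zero_smul ℝ (0 : LVec (m + r + 1)), coeff_smul, zero_mul]
  · change coeff (fun ζ => A ζ t) (pd u (A .pt) t) (.mid i) = 0
    rw [hu, ← zero_smul ℝ (0 : LVec (m + r + 1)), coeff_smul, zero_mul]

theorem LocalFrame.toLightFrame {A : FrameIdx m r → Par m r → LVec (m + r + 1)}
    {U : Set (Par m r)} (hA : LocalFrame A U) : LightFrame A U where
  isOpen := hA.isOpen
  smooth := hA.smooth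
  basis := hA.basis
  tangent t ht u := hA.normal_zero t ht none u
  inj _ ht _ hu := hA.inj ht hu

theorem LocalFrame.isAdaptedFrame {A : FrameIdx m r → Par m r → LVec (m + r + 1)} {U : Set (Par m r)}
    (hA : LocalFrame A U) {Φ : Coords m r N} (hU : U ⊆ Φ.source)
    (hl : ∀ t ∈ U, (f (Φ t)).submodule = Submodule.span ℝ {A .pt t}) :
    IsAdaptedFrame f (Φ.target ∩ Φ.symm ⁻¹' U) (push A Φ) where
  toIsLightlikeFrame := hA.toLightFrame.isLightlikeFrame hU hl
  orthogonal q hq := hA.orthogonal _ hq.2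
  kernel q hq a := by
    obtain ⟨t, ht, rfl⟩ := (mem_push hU).mp hq
    rw [forall_tangent (hU ht)]
    intro u
    rw [omega_d (hU ht) (contDiffAt_pull_push (hU ht) (hA.smooth _ t ht)), om_pull_push (hU ht)]
    exact neg_eq_zero.mpr (hA.normal_zero t ht (some a) u)

end Transfer

/-! ### The screen plane and the generator at a point -/

section Pointwise

variable {m r : ℕ} {e : FrameIdx m r → LVec (m + r + 1)}

theorem IsConformalBasis.coeff_self (he : IsConformalBasis e) (ξ η : FrameIdx m r) :
    (ξ = η → coeff e (e ξ) η = 1) ∧ (ξ ≠ η → coeff e (e ξ) η = 0) := by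
  classical
  have := he.coeff_eq (w := e ξ) (c0 := if ξ = .zero then 1 else 0)
    (cn := if ξ = .pt then 1 else 0) (ct := if ξ = .top then 1 else 0)
    (c := fun i => if ξ = .mid i then 1 else 0) (by
      cases ξ <;> simp only [reduceCtorEq, if_true, if_false, one_smul, zero_smul,
        Finset.sum_const_zero, zero_add, add_zero, FrameIdx.mid.injEq, ite_smul,
        Finset.sum_ite_eq, Finset.mem_univ])
  obtain ⟨h1, h2, h3, h4⟩ := this
  cases η with
  | zero => rw [h1]; exact ⟨fun h => if_pos h, fun h => if_neg h⟩
  | mid i => rw [h2]; exact ⟨fun h => if_pos h, fun h => if_neg h⟩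
  | pt => rw [h3]; exact ⟨fun h => if_pos h, fun h => if_neg h⟩
  | top => rw [h4]; exact ⟨fun h => if_pos h, fun h => if_neg h⟩

theorem normalIdx_ne_top (α : Option (Fin m)) : (normalIdx α : FrameIdx m r) ≠ .top := by
  cases α <;> simp [normalIdx]

theorem normalIdx_ne_tan (α : Option (Fin m)) (p : Fin r) :
    (normalIdx α : FrameIdx m r) ≠ .mid (.inr p) := by
  cases α <;> simp [normalIdx]

/-- The generator is cut out by the equations `x^p = 0`, `x^{n+1} = 0`. -/
theorem IsConformalBasis.mem_generator_iff (he : IsConformalBasis e) {w : LVec (m + r + 1)} :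
    w ∈ Submodule.span ℝ {e .zero} ⊔ Submodule.span ℝ (Set.range fun α => e (normalIdx α)) ↔
      coeff e w .top = 0 ∧ ∀ p, coeff e w (.mid (.inr p)) = 0 := by
  constructor
  · intro hw
    have hle : Submodule.span ℝ {e .zero} ⊔ Submodule.span ℝ (Set.range fun α => e (normalIdx α)) ≤
        LinearMap.ker (coeffLin e .top) ⊓ ⨅ p, LinearMap.ker (coeffLin e (.mid (.inr p))) := by
      rw [sup_le_iff, Submodule.span_le, Submodule.span_le]
      refine ⟨?_, ?_⟩
      · rintro _ rfl
        simp only [SetLike.mem_coe, Submodule.mem_inf, Submodule.mem_iInf, LinearMap.mem_ker]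
        exact ⟨(he.coeff_self .zero .top).2 (by simp),
          fun p => (he.coeff_self .zero (.mid (.inr p))).2 (by simp)⟩
      · rintro _ ⟨α, rfl⟩
        simp only [SetLike.mem_coe, Submodule.mem_inf, Submodule.mem_iInf, LinearMap.mem_ker]
        exact ⟨(he.coeff_self _ _).2 (normalIdx_ne_top α),
          fun p => (he.coeff_self _ _).2 (normalIdx_ne_tan α p)⟩
    have := hle hw
    simp only [Submodule.mem_inf, Submodule.mem_iInf, LinearMap.mem_ker] at this
    exact this
  · rintro ⟨h1, h2⟩
    rw [he.expand w, h1]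
    simp only [h2, zero_smul, Finset.sum_const_zero, add_zero]
    exact Submodule.add_mem_sup (Submodule.smul_mem _ _ (Submodule.mem_span_singleton_self _))
      (Submodule.sum_mem _ fun α _ => Submodule.smul_mem _ _ (Submodule.subset_span ⟨α, rfl⟩))

variable {T : Type*} [AddCommGroup T] [Module ℝ T] {J : T →ₗ[ℝ] LVec (m + r + 1)}

/-- The position of the planes `x ∧ ζ` and `L`. -/
theorem IsConformalBasis.screen_position (he : IsConformalBasis e) (μ : Fin r → ℝ)
    (hJ : Function.Injective J)
    (hrange : ∀ w, w ∈ LinearMap.range J ↔ lform w (e .zero) = 0 ∧ lform w (e .pt) = 0)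
    {Z D G H : Submodule ℝ (LVec (m + r + 1))}
    (hZ : Z = Submodule.span ℝ (Set.range fun p => e (.mid (.inr p)) + μ p • e .zero))
    (hD : D = Submodule.span ℝ {e .pt} ⊔ Z)
    (hG : G = Submodule.span ℝ {e .zero} ⊔ Submodule.span ℝ (Set.range fun α => e (normalIdx α)))
    (hH : H = Submodule.span ℝ {e .pt} ⊔ LinearMap.range J) :
    Module.finrank ℝ D = r + 1 ∧ D ≤ H ∧ D ⊓ G = Submodule.span ℝ {e .pt} ∧ D ⊔ G = H ∧
      Module.finrank ℝ (D.comap J) = r ∧ IsCompl (D.comap J) (G.comap J) := by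
  have hself := he.coeff_self
  have hzero : ∀ η, coeff e 0 η = 0 := fun η => (coeffLin e η).map_zero
  have hlin : ∀ (s : Finset (Fin r)) (x : Fin r → ℝ) (v : Fin r → LVec (m + r + 1)) η,
      coeff e (∑ p ∈ s, x p • v p) η = ∑ p ∈ s, x p * coeff e (v p) η := by
    intro s x v η
    change coeffLin e η _ = _
    rw [map_sum]
    exact Finset.sum_congr rfl fun p _ => map_smul _ _ _
  set C : Fin r → LVec (m + r + 1) := fun p => e (.mid (.inr p)) + μ p • e .zero with hC
  have hCp : ∀ p q, coeff e (C p) (.mid (.inr q)) = if p = q then 1 else 0 := by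
    intro p q
    rw [hC]
    simp only
    rw [coeff_add, coeff_smul, (hself .zero _).2 (by simp), mul_zero, add_zero]
    split_ifs with hpq
    · exact (hself _ _).1 (by rw [hpq])
    · exact (hself _ _).2 (by simpa using hpq)
  have hC0 : ∀ p, coeff e (C p) .zero = μ p := by
    intro p
    rw [hC]
    simp only
    rw [coeff_add, coeff_smul, (hself .zero _).1 rfl, (hself _ _).2 (by simp), mul_one, zero_add]
  have hCpt : ∀ p, lform (C p) (e .pt) = 0 := by
    intro p
    rw [hC]
    simp only
    rw [lform_add_left, lform_smul_left, he.mid_pt, he.zero_pt, mul_zero, add_zero]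
  have hCz : ∀ p, lform (C p) (e .zero) = 0 := by
    intro p
    rw [hC]
    simp only
    rw [lform_add_left, lform_smul_left, lform_comm, he.zero_mid, he.zero_zero, mul_zero, add_zero]
  have hZmem : ∀ w, w ∈ Z ↔ ∃ x : Fin r → ℝ, ∑ p, x p • C p = w := by
    intro w
    rw [hZ]
    exact Submodule.mem_span_range_iff_exists_fun ℝ
  have hZJ : Z ≤ LinearMap.range J := by
    rw [hZ, Submodule.span_le]
    rintro _ ⟨p, rfl⟩
    exact (hrange _).mpr ⟨hCz p, hCpt p⟩
  have hZfin : Module.finrank ℝ Z = r := by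
    have hli : LinearIndependent ℝ C := by
      rw [Fintype.linearIndependent_iff]
      intro x hx q
      have := hlin Finset.univ x C (.mid (.inr q))
      rw [hx, hzero] at this
      simpa [hCp] using this.symm
    rw [hZ]
    simpa using finrank_span_eq_card hli
  -- The image of dx is orthogonal to x, whereas (x, x) = 1.
  have hptZ : Disjoint (Submodule.span ℝ {e .pt}) (LinearMap.range J) := by
    rw [Submodule.disjoint_def]
    intro w hw hw'
    obtain ⟨c, rfl⟩ := Submodule.mem_span_singleton.mp hw
    have := ((hrange _).mp hw').2
    rw [lform_smul_left, he.pt_pt, mul_one] at this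
    rw [this, zero_smul]
  have hne : e .pt ≠ 0 := by
    intro h0
    have := he.pt_pt
    rw [h0, lform_zero_left] at this
    exact zero_ne_one this
  have hDG : D ⊓ G = Submodule.span ℝ {e .pt} := by
    apply le_antisymm
    · rintro w ⟨hwD, hwG⟩
      rw [SetLike.mem_coe, hD] at hwD
      rw [SetLike.mem_coe, hG, he.mem_generator_iff] at hwG
      obtain ⟨y, hy, z, hz, rfl⟩ := Submodule.mem_sup.mp hwD
      obtain ⟨c, rfl⟩ := Submodule.mem_span_singleton.mp hy
      obtain ⟨x, rfl⟩ := (hZmem z).mp hz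
      have hx : ∀ q, x q = 0 := by
        intro q
        have := hwG.2 q
        rw [coeff_add, coeff_smul, (hself _ _).2 (by simp), mul_zero, zero_add, hlin] at this
        simpa [hCp] using this
      simp only [hx, zero_smul, Finset.sum_const_zero, add_zero]
      exact hy
    · refine le_inf (hD ▸ le_sup_left) ?_
      rw [hG]
      refine le_trans ?_ le_sup_right
      exact Submodule.span_mono (by rintro _ rfl; exact ⟨none, rfl⟩)
  have hGH : G ≤ H := by
    rw [hG, hH, sup_le_iff, Submodule.span_le, Submodule.span_le]
    constructor
    · rintro _ rfl
      exact Submodule.mem_sup_right ((hrange _).mpr ⟨he.zero_zero, he.zero_pt⟩)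
    · rintro _ ⟨α, rfl⟩
      cases α with
      | none => exact Submodule.mem_sup_left (Submodule.mem_span_singleton_self _)
      | some a =>
        refine Submodule.mem_sup_right ((hrange _).mpr ⟨?_, he.mid_pt _⟩)
        exact (lform_comm _ _).trans (he.zero_mid _)
  have hDH : D ≤ H := by
    rw [hD, hH]
    exact sup_le_sup le_rfl hZJ
  -- Subtracting from w the C_p with the A_p-components of w as coefficients leaves no
  -- A_p-component, hence a vector of the generator.
  have hdec : ∀ w, lform w (e .zero) = 0 → ∃ z ∈ Z, w - z ∈ G := by
    intro w hw
    refine ⟨∑ p, coeff e w (.mid (.inr p)) • C p, (hZmem _).mpr ⟨_, rfl⟩, ?_⟩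
    rw [hG, he.mem_generator_iff]
    have hsub : ∀ a b η, coeff e (a - b) η = coeff e a η - coeff e b η := fun a b η =>
      map_sub (coeffLin e η) a b
    refine ⟨?_, fun q => ?_⟩
    · rw [coeff_top_eq, lform_sub_left, hw, lform_finset_sum_left]
      simp [lform_smul_left, hCz]
    · rw [hsub, hlin]
      simp [hCp]
  have hJz : ∀ v, lform (J v) (e .zero) = 0 := fun v => ((hrange _).mp ⟨v, rfl⟩).1
  refine ⟨?_, hDH, hDG, ?_, ?_, ?_⟩
  · have h1 := Submodule.finrank_sup_add_finrank_inf_eq (Submodule.span ℝ {e .pt}) Z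
    rw [(hptZ.mono_right hZJ).eq_bot, finrank_bot, finrank_span_singleton hne, hZfin, ← hD] at h1
    omega
  · apply le_antisymm (sup_le hDH hGH)
    intro w hw
    have hw0 : lform w (e .zero) = 0 := by
      rw [hH] at hw
      obtain ⟨y, hy, z, ⟨v, rfl⟩, rfl⟩ := Submodule.mem_sup.mp hw
      obtain ⟨c, rfl⟩ := Submodule.mem_span_singleton.mp hy
      rw [lform_add_left, hJz, lform_smul_left, lform_comm, he.zero_pt, mul_zero, add_zero]
    obtain ⟨z, hz, hwz⟩ := hdec w hw0
    rw [← add_sub_cancel z w]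
    exact Submodule.add_mem_sup (hD ▸ Submodule.mem_sup_right hz) hwz
  -- The direction of x meets the image of dx only in 0, so the part of x ∧ ζ tangent to the
  -- hypersurface is ζ itself.
  · have h1 : (D.comap J).map J = Z := by
      rw [Submodule.map_comap_eq]
      apply le_antisymm
      · rintro w ⟨hwJ, hwD⟩
        rw [SetLike.mem_coe, hD] at hwD
        obtain ⟨y, hy, z, hz, rfl⟩ := Submodule.mem_sup.mp hwD
        have h2 : y ∈ LinearMap.range J := by
          have := Submodule.sub_mem _ hwJ (hZJ hz)
          rwa [add_sub_cancel_right] at this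
        rw [Submodule.disjoint_def.mp hptZ y hy h2, zero_add]
        exact hz
      · exact le_inf hZJ (hD ▸ le_sup_right)
    rw [(Submodule.equivMapOfInjective J hJ _).finrank_eq, h1, hZfin]
  · constructor
    · rw [Submodule.disjoint_def]
      intro v hv hv'
      have h1 : J v ∈ Submodule.span ℝ {e .pt} := hDG ▸ Submodule.mem_inf.mpr ⟨hv, hv'⟩
      exact hJ ((Submodule.disjoint_def.mp hptZ _ h1 ⟨v, rfl⟩).trans (map_zero J).symm)
    · rw [codisjoint_iff_le_sup]
      intro v _
      obtain ⟨z, hz, hwz⟩ := hdec (J v) (hJz v)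
      obtain ⟨v', rfl⟩ := hZJ hz
      rw [← add_sub_cancel v' v]
      refine Submodule.add_mem_sup ?_ ?_
      · exact hD ▸ Submodule.mem_sup_right hz
      · rw [Submodule.mem_comap, map_sub]
        exact hwz

end Pointwise

/-! ### The screen distribution defined by adapted frames -/

section Construction

variable {m r : ℕ}

/-- Directions tangent to the generator annihilate the forms `ω_0^p`. -/
theorem LocalFrame.om_zero_tan_of_mem_generator {A : FrameIdx m r → Par m r → LVec (m + r + 1)}
    {U : Set (Par m r)} (h : LocalFrame A U) {t : Par m r} (ht : t ∈ U) {v : Par m r}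
    (hv : ∀ p, om A .pt (.mid (.inr p)) v t = 0) (p : Fin r) :
    om A .zero (.mid (.inr p)) v t = 0 := by
  have hb := h.basis t ht
  refine h.eq_zero_of_lform_tan ht (fun p => ?_) p
  obtain ⟨u, hu⟩ := h.surj t ht (A (.mid (.inr p)) t) ((lform_comm _ _).trans (hb.zero_mid _))
    (hb.mid_pt _)
  -- With u chosen so that dA_n(u) = A_p, symmetry turns (A_p, dA_0(v)) into (dA_n(v), dA_0(u)).
  -- Here dA_0(u) involves only A_0 and the A_q, to which dA_n(v) is orthogonal.
  rw [lform_comm, ← hu, h.toLightFrame.second_form_symm ht, h.pd_zero ht, lform_add_right,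
    lform_smul_right, h.toLightFrame.tangent t ht, mul_zero, zero_add, lform_finset_sum_right]
  refine Finset.sum_eq_zero fun q _ => ?_
  rw [lform_smul_right, hb.lform_tan (h.orthogonal t ht)]
  have : ∀ s, coeff (fun ζ => A ζ t) (pd v (A .pt) t) (.mid (.inr s)) = 0 := hv
  simp only [this, zero_mul, Finset.sum_const_zero, mul_zero]

variable {N : Type*} [TopologicalSpace N]
  [ChartedSpace (EuclideanSpace ℝ (Fin (m + r + 1))) N]
  {f : N → ℙ ℝ (LVec (m + r + 1))} {ρ : ℕ}

theorem IsScreenConstruction.theta_eq (hf : IsLightlikeHypersurface f)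
    (hr : HasReducedRank m r f) (hρ : ρ ≠ 0) (hM : HasMatrixRank ρ f)
    {W : Set N} {A : FrameIdx m r → N → LVec (m + r + 1)}
    {Λ : N → Option (Fin m) → Matrix (Fin r) (Fin r) ℝ} {μ : N → Fin r → ℝ}
    (h : IsScreenConstruction ρ f W A Λ μ) (Φ : Coords m r N) {t : Par m r}
    (ht : t ∈ Φ.source ∩ Φ ⁻¹' W) (u : Par m r) :
    theta ρ (pull A Φ) (fun s => Λ (Φ s)) u t =
      ∑ p, μ (Φ t) p * om (pull A Φ) .zero (.mid (.inr p)) u t := by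
  have hs := h.frame.pull_localScreen hf hr hρ hM h.lambda Φ
  exact (isMu_iff ht.1 (h.frame.contDiffAt_pull ht.1 ht.2) (hs.contDiffAt_locInv ht) _).mp
    (h.mu _ ht.2) u

/-- The screen plane does not depend on the adapted frame. -/
theorem IsScreenConstruction.screenPlane_unique [IsManifold (𝓡 (m + r + 1)) ∞ N]
    (hf : IsLightlikeHypersurface f) (hr : HasReducedRank m r f) (hρ : ρ ≠ 0)
    (hM : HasMatrixRank ρ f) {W W' : Set N} {A A' : FrameIdx m r → N → LVec (m + r + 1)}
    {Λ Λ' : N → Option (Fin m) → Matrix (Fin r) (Fin r) ℝ} {μ μ' : N → Fin r → ℝ}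
    (h : IsScreenConstruction ρ f W A Λ μ) (h' : IsScreenConstruction ρ f W' A' Λ' μ') {q : N}
    (hq : q ∈ W) (hq' : q ∈ W') : screenPlane A' μ' q = screenPlane A μ q := by
  obtain ⟨Φ, t, ht, rfl⟩ := exists_coords (m := m) (r := r) q
  have hs := h.frame.pull_localScreen hf hr hρ hM h.lambda Φ
  have hs' := h'.frame.pull_localScreen hf hr hρ hM h'.lambda Φ
  set U := Φ.source ∩ Φ ⁻¹' W
  set U' := Φ.source ∩ Φ ⁻¹' W'
  have hres : LocalScreen ρ (pull A Φ) (U ∩ U') fun s => Λ (Φ s) :=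
    ⟨hs.frame.congr (hs.frame.isOpen.inter hs'.frame.isOpen) Set.inter_subset_left
      fun _ _ _ => rfl, fun s hs1 => hs.lam s hs1.1, fun s hs1 => hs.pos s hs1.1, hρ⟩
  have hres' : LocalScreen ρ (pull A' Φ) (U ∩ U') fun s => Λ' (Φ s) :=
    ⟨hs'.frame.congr (hs.frame.isOpen.inter hs'.frame.isOpen) Set.inter_subset_right
      fun _ _ _ => rfl, fun s hs1 => hs'.lam s hs1.2, fun s hs1 => hs'.pos s hs1.2, hρ⟩
  have hl := h.frame.lift _ hq
  have hl' := h'.frame.lift _ hq'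
  have hζ : normSubspace A' μ' (Φ t) = normSubspace A μ (Φ t) :=
    hres.normSubspace_unique hres' (fun s hs1 =>
      exists_smul_of_span_eq (h.frame.lift _ hs1.1.2) (h'.frame.lift _ hs1.2.2))
      ⟨⟨ht, hq⟩, ⟨ht, hq'⟩⟩ (h.theta_eq hf hr hρ hM Φ ⟨ht, hq⟩)
      (h'.theta_eq hf hr hρ hM Φ ⟨ht, hq'⟩)
  rw [screenPlane, screenPlane, hζ, ← hl, hl']

/-- The construction of the screen plane in an adapted frame, and its position. -/
theorem IsAdaptedFrame.exists_construction [IsManifold (𝓡 (m + r + 1)) ∞ N]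
    (hf : IsLightlikeHypersurface f) (hr : HasReducedRank m r f) (hρ : ρ ≠ 0)
    (hM : HasMatrixRank ρ f) {W : Set N} {A : FrameIdx m r → N → LVec (m + r + 1)}
    (hA : IsAdaptedFrame f W A) :
    ∃ (Λ : N → Option (Fin m) → Matrix (Fin r) (Fin r) ℝ) (μ : N → Fin r → ℝ),
      IsScreenConstruction ρ f W A Λ μ ∧
      (∀ α p s, ContMDiffOn (𝓡 (m + r + 1)) 𝓘(ℝ, ℝ) ∞ (fun q => Λ q α p s) W) ∧
      (∀ p, ContMDiffOn (𝓡 (m + r + 1)) 𝓘(ℝ, ℝ) ∞ (fun q => μ q p) W) ∧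
      ∀ q ∈ W, (∀ α, (Λ q α).IsSymm) ∧ relInv ρ A Λ q ≠ 0 ∧
        Module.finrank ℝ (screenPlane A μ q) = r + 1 ∧
        screenPlane A μ q ≤ tangentHyperplane (n := m + r + 1) (A .pt) q ∧
        screenPlane A μ q ⊓ generator A q = Submodule.span ℝ {A .pt q} ∧
        screenPlane A μ q ⊔ generator A q = tangentHyperplane (n := m + r + 1) (A .pt) q ∧
        Module.finrank ℝ ((screenPlane A μ q).comap (dAt (n := m + r + 1) (A .pt) q)) = r ∧
        IsCompl ((screenPlane A μ q).comap (dAt (n := m + r + 1) (A .pt) q))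
          ((generator A q).comap (dAt (n := m + r + 1) (A .pt) q)) ∧
        ∀ v : TangentSpace (𝓡 (m + r + 1)) q,
          dAt (n := m + r + 1) (A .pt) q v ∈ generator A q →
          ∀ p, dAt (n := m + r + 1) (normPt A μ p) q v ∈ normSubspace A μ q := by
  have hex : ∀ q ∈ W, ∃ Λ, IsLambda A q Λ := by
    intro q hq
    obtain ⟨Φ, t, ht, rfl⟩ := exists_coords (m := m) (r := r) q
    obtain ⟨Λ, hΛ⟩ := (hA.localFrame hf hr Φ).exists_lamAt t ⟨ht, hq⟩
    exact ⟨Λ, (isLambda_iff ht (hA.contDiffAt_pull ht hq) Λ).mpr hΛ⟩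
  choose! Λ hΛ using hex
  have hS := fun Φ : Coords m r N => hA.pull_localScreen hf hr hρ hM hΛ Φ
  have hex' : ∀ q ∈ W, ∃ μ, IsMu ρ A Λ q μ := by
    intro q hq
    obtain ⟨Φ, t, ht, rfl⟩ := exists_coords (m := m) (r := r) q
    obtain ⟨μ, hμ⟩ := (hS Φ).exists_mu
    exact ⟨μ t, (isMu_iff ht (hA.contDiffAt_pull ht hq)
      ((hS Φ).contDiffAt_locInv ⟨ht, hq⟩) _).mpr (hμ t ⟨ht, hq⟩)⟩
  choose! μ hμ using hex'
  have hcon : IsScreenConstruction ρ f W A Λ μ := ⟨hA, hΛ, hμ⟩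
  have hθ := fun Φ : Coords m r N => fun t ht => hcon.theta_eq hf hr hρ hM Φ (t := t) ht
  refine ⟨Λ, μ, hcon, fun α p s q hq => ?_, fun p q hq => ?_, fun q hq => ?_⟩
  · obtain ⟨Φ, t, ht, rfl⟩ := exists_coords (m := m) (r := r) q
    exact ((Φ.contMDiffAt_iff ht).mpr
      ((hS Φ).frame.contDiffAt_lam ⟨ht, hq⟩ (hS Φ).lam α p s)).contMDiffWithinAt
  · obtain ⟨Φ, t, ht, rfl⟩ := exists_coords (m := m) (r := r) q
    exact ((Φ.contMDiffAt_iff ht).mpr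
      ((hS Φ).contDiffAt_mu ⟨ht, hq⟩ (μ := fun s => μ (Φ s)) (hθ Φ) p)).contMDiffWithinAt
  · obtain ⟨Φ, t, ht, rfl⟩ := exists_coords (m := m) (r := r) q
    have htU : t ∈ Φ.source ∩ Φ ⁻¹' W := ⟨ht, hq⟩
    have hF := (hS Φ).frame
    have hb : IsConformalBasis fun ξ => A ξ (Φ t) := hA.basis _ hq
    have hsm := hA.contDiffAt_pull ht hq
    have hd : ∀ u, dAt (n := m + r + 1) (A .pt) (Φ t) (Φ.d t u) = pd u (pull A Φ .pt) t :=
      fun u => Φ.dAt_d ht (hsm .pt) u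
    have hJ : Function.Injective (dAt (n := m + r + 1) (A .pt) (Φ t)) := by
      rw [injective_iff_map_eq_zero, forall_tangent ht]
      intro u hu
      rw [hd] at hu
      rw [hF.inj htU hu]
      exact map_zero (mfderiv (𝓡 (m + r + 1)) (𝓡 (m + r + 1)) Φ t)
    have hrange : ∀ w, w ∈ LinearMap.range (dAt (n := m + r + 1) (A .pt) (Φ t)) ↔
        lform w (A .zero (Φ t)) = 0 ∧ lform w (A .pt (Φ t)) = 0 := by
      intro w
      constructor
      · rintro ⟨v, rfl⟩
        obtain ⟨u, rfl⟩ := (Φ.d_bijective ht).surjective v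
        rw [hd]
        exact ⟨hF.toLightFrame.tangent t htU u, hF.toLightFrame.lform_pd_pt_pt htU u⟩
      · rintro ⟨h0, h1⟩
        obtain ⟨u, hu⟩ := hF.surj t htU w h0 h1
        exact ⟨Φ.d t u, by rw [hd, hu]⟩
    obtain ⟨g1, g2, g3, g4, g5, g6⟩ := hb.screen_position (μ (Φ t)) hJ hrange
      (Z := normSubspace A μ (Φ t)) (D := screenPlane A μ (Φ t)) (G := generator A (Φ t))
      (H := tangentHyperplane (n := m + r + 1) (A .pt) (Φ t)) rfl rfl rfl rfl
    refine ⟨fun α => hF.lamAt_isSymm htU ((hS Φ).lam t htU) α, ((hS Φ).pos t htU).ne',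
      g1, g2, g3, g4, g5, g6, ?_⟩
    rw [forall_tangent ht]
    intro u hu p
    rw [hd, generator, hb.mem_generator_iff] at hu
    have hk : ∀ p, om (pull A Φ) .zero (.mid (.inr p)) u t = 0 :=
      hF.om_zero_tan_of_mem_generator htU hu.2
    have hn : ContDiffAt ℝ ∞ (fun s => normPt A μ p (Φ s)) t :=
      (hsm _).add (((hS Φ).contDiffAt_mu htU (μ := fun s => μ (Φ s)) (hθ Φ) p).smul (hsm _))
    rw [Φ.dAt_d ht hn]
    exact (hS Φ).pd_normPt_mem htU (μ := fun s => μ (Φ s)) (hθ Φ) hk p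

end Construction

/-! ### The isotropic normal of a lightlike hypersurface -/

section NullNormal

variable {m r : ℕ}

theorem lform_eq_sum {n : ℕ} (x y : LVec n) :
    lform x y = ∑ j, lform x (fun i => if j = i then 1 else 0) * y j := by
  have := (lformLin n x).pi_apply_eq_sum_univ y
  simpa only [lformLin_apply, smul_eq_mul, mul_comm] using this

/-- `e₀` is the isotropic normal, normalized by `(e₀, N₀) = -1`, of the immersed lightlike
hypersurface `F`. -/
structure NullNormal (F e₀ : Par m r → LVec (m + r + 1)) (N₀ : LVec (m + r + 1))
    (U : Set (Par m r)) : Prop where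
  isOpen : IsOpen U
  smooth : ∀ t ∈ U, ContDiffAt ℝ ∞ F t
  unit : ∀ t ∈ U, lform (F t) (F t) = 1
  inj : ∀ t ∈ U, ∀ u, pd u F t = 0 → u = 0
  smooth_normal : ∀ t ∈ U, ContDiffAt ℝ ∞ e₀ t
  null : ∀ t ∈ U, lform (e₀ t) (e₀ t) = 0
  normal : ∀ t ∈ U, lform (e₀ t) (F t) = 0
  normal_pd : ∀ t ∈ U, ∀ u, lform (e₀ t) (pd u F t) = 0
  normalized : ∀ t ∈ U, lform (e₀ t) N₀ = -1

/-- The isotropic normals y are given point by point, with no continuity. After normalization by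
(e₀, N₀) = -1 the normal solves a square linear system with smooth coefficients, which restores
smoothness. The vector x certifies that N₀ is transversal to the hyperplane at t, that is, that the
system is regular there. -/
theorem exists_nullNormal {F : Par m r → LVec (m + r + 1)} {U : Set (Par m r)} (hU : IsOpen U)
    (hF : ∀ t ∈ U, ContDiffAt ℝ ∞ F t) (hF1 : ∀ t ∈ U, lform (F t) (F t) = 1)
    (hFi : ∀ t ∈ U, ∀ u, pd u F t = 0 → u = 0)
    (hy : ∀ t ∈ U, ∃ y : LVec (m + r + 1), y ≠ 0 ∧ lform y y = 0 ∧ lform y (F t) = 0 ∧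
      ∀ u, lform y (pd u F t) = 0) {t : Par m r} (ht : t ∈ U) {N₀ x : LVec (m + r + 1)}
    (hxF : lform x (F t) = 0) (hxd : ∀ u, lform x (pd u F t) = 0) (hxN : lform x N₀ ≠ 0) :
    ∃ e₀ U', t ∈ U' ∧ U' ⊆ U ∧ NullNormal F e₀ N₀ U' := by
  choose! y hy0 hyy hyF hyd using hy
  let b : Fin (m + r + 1) → Par m r := fun i => EuclideanSpace.single i 1
  have hb : ∀ u : Par m r, u = ∑ i, u i • b i := by
    intro u
    ext j
    simp [b, Pi.single_apply]
  have hpdb : ∀ s u, pd u F s = ∑ i, u i • pd (b i) F s := by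
    intro s u
    conv_lhs => rw [hb u]
    simp only [pd, map_sum, map_smul]
  -- The equations for e₀ are its products with N₀, with F and with the m + r + 1 partial
  -- derivatives of F, as many as there are homogeneous coordinates.
  let R : Par m r → Fin (m + r + 1 + 2) → LVec (m + r + 1) := fun s =>
    Fin.cons N₀ (Fin.cons (F s) fun i => pd (b i) F s)
  let M : Par m r → Matrix (Fin (m + r + 1 + 2)) (Fin (m + r + 1 + 2)) ℝ := fun s =>
    Matrix.of fun i j => lform (R s i) (fun k => if j = k then 1 else 0)
  have hMv : ∀ s i v, (M s).mulVec v i = lform (R s i) v := fun s i v => (lform_eq_sum _ _).symm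
  have hRs : ∀ s ∈ U, ∀ i, ContDiffAt ℝ ∞ (fun s => R s i) s := by
    intro s hs i
    refine Fin.cases ?_ (fun i => Fin.cases ?_ (fun i => ?_) i) i
    · exact contDiffAt_const
    · exact hF s hs
    · exact contDiffAt_pd (b i) (hF s hs)
  have hMs : ∀ s ∈ U, ∀ i j, ContDiffAt ℝ ∞ (fun s => M s i j) s := fun s hs i j =>
    (hRs s hs i).lform (contDiffAt_const (c := fun k => if j = k then 1 else 0))
  have hFF : ∀ u, lform (pd u F t) (F t) = 0 := by
    intro u
    have := lform_pd_of_const u (hF t ht) (hF t ht) (Filter.mem_of_superset (hU.mem_nhds ht) hF1)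
    rw [lform_comm (F t)] at this
    linarith
  have hdet : (M t).det ≠ 0 := by
    intro h0
    obtain ⟨v, hv, hv0⟩ := Matrix.exists_vecMul_eq_zero_iff.mpr h0
    apply hv
    -- In a relation between the rows, the product with x isolates the coefficient of N₀ and the
    -- product with F that of F; the remaining coefficients vanish because F is an immersion.
    have h1 : ∑ i, v i • R t i = 0 := by
      refine lform_nondegenerate fun w => ?_
      rw [lform_eq_sum]
      refine Finset.sum_eq_zero fun j _ => ?_
      have := congrFun hv0 j
      rw [lform_finset_sum_left]
      simp only [lform_smul_left]
      change (∑ i, v i * M t i j) * _ = 0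
      rw [show ∑ i, v i * M t i j = 0 from this, zero_mul]
    rw [Fin.sum_univ_succ, Fin.sum_univ_succ] at h1
    have h2 : v 0 • N₀ + (v (Fin.succ 0) • F t +
        ∑ i : Fin (m + r + 1), v i.succ.succ • pd (b i) F t) = 0 := h1
    have hsum : ∀ w, lform (∑ i : Fin (m + r + 1), v i.succ.succ • pd (b i) F t) w =
        ∑ i : Fin (m + r + 1), v i.succ.succ * lform (pd (b i) F t) w := by
      intro w
      simp only [lform_finset_sum_left, lform_smul_left]
    have h3 : v 0 = 0 := by
      have := congrArg (fun w => lform x w) h2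
      simp only [lform_add_right, lform_smul_right, lform_finset_sum_right, hxF, hxd,
        mul_zero, Finset.sum_const_zero, add_zero, lform_zero_right] at this
      exact (mul_eq_zero.mp this).resolve_right hxN
    have h4 : v (Fin.succ 0) = 0 := by
      have := congrArg (fun w => lform w (F t)) h2
      simp only [h3, zero_smul, zero_add, lform_add_left, lform_smul_left, hsum, hFF, hF1 t ht,
        mul_zero, Finset.sum_const_zero, add_zero, lform_zero_left, mul_one] at this
      exact this
    rw [h3, h4, zero_smul, zero_smul, zero_add, zero_add] at h2
    have h5 := hFi t ht (WithLp.toLp 2 fun i => v i.succ.succ) (by rw [hpdb]; exact h2)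
    funext i
    refine Fin.cases h3 (fun i => Fin.cases h4 (fun i => ?_) i) i
    exact congrArg (fun x : Par m r => x i) h5
  have hdc : ContinuousAt (fun s => (M s).det) t := (contDiffAt_det (hMs t ht)).continuousAt
  obtain ⟨U', hU's, hU'o, htU'⟩ := mem_nhds_iff.mp
    (Filter.inter_mem (hdc.eventually_ne hdet) (hU.mem_nhds ht))
  have hne : ∀ s ∈ U', lform (y s) N₀ ≠ 0 := by
    intro s hs h0
    have hd : (M s).det ≠ 0 := (hU's hs).1
    have hsU := (hU's hs).2
    apply hd
    -- If y were orthogonal to N₀ as well, it would be a nonzero vector in the kernel of the regular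
    -- system.
    refine Matrix.exists_mulVec_eq_zero_iff.mp ⟨y s, hy0 s hsU, funext fun i => ?_⟩
    rw [hMv, lform_comm]
    refine Fin.cases ?_ (fun i => Fin.cases ?_ (fun i => ?_) i) i
    · exact h0
    · exact hyF s hsU
    · exact hyd s hsU _
  let e₀ : Par m r → LVec (m + r + 1) := fun s => (-(lform (y s) N₀)⁻¹) • y s
  have heN : ∀ s ∈ U', lform (e₀ s) N₀ = -1 := by
    intro s hs
    rw [lform_smul_left, neg_mul, inv_mul_cancel₀ (hne s hs)]
  have heF : ∀ s ∈ U', lform (e₀ s) (F s) = 0 := fun s hs => by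
    rw [lform_smul_left, hyF s (hU's hs).2, mul_zero]
  have hed : ∀ s ∈ U', ∀ u, lform (e₀ s) (pd u F s) = 0 := fun s hs u => by
    rw [lform_smul_left, hyd s (hU's hs).2, mul_zero]
  refine ⟨e₀, U', htU', fun s hs => (hU's hs).2, hU'o, fun s hs => hF s (hU's hs).2,
    fun s hs => hF1 s (hU's hs).2, fun s hs => hFi s (hU's hs).2, fun s hs => ?_,
    fun s hs => ?_, heF, hed, heN⟩
  · refine contDiffAt_pi.mpr fun i => contDiffAt_of_mulVec (M := M)
      (θ := fun _ => Fin.cons (-1) fun _ => 0) (hMs s (hU's hs).2) (hU's hs).1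
      (fun _ => contDiffAt_const) ?_ i
    filter_upwards [hU'o.mem_nhds hs] with x hx i
    refine Eq.trans ?_ (hMv x i (e₀ x)).symm
    rw [lform_comm]
    refine Fin.cases ?_ (fun i => Fin.cases ?_ (fun i => ?_) i) i
    · exact (heN x hx).symm
    · exact (heF x hx).symm
    · exact (hed x hx _).symm
  · rw [lform_smul_left, lform_smul_right, hyy s (hU's hs).2, mul_zero, mul_zero]

end NullNormal

/-! ### Conformal frames with a given point and isotropic normal -/

section ProjFrame

variable {m r : ℕ}

/-- The isotropic vector `A_{n+1}` of the frame with `A_n = x`, `A_0 = e₀`, in the span of `x`, `e₀`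
and `N₀`. -/
def projTop {n : ℕ} (N₀ x e₀ : LVec n) : LVec n :=
  (N₀ - lform N₀ x • x) +
    ((1 / 2 : ℝ) * lform (N₀ - lform N₀ x • x) (N₀ - lform N₀ x • x)) • e₀

/-- The orthogonal projection onto the complement of `x`, `e₀` and `projTop N₀ x e₀`. -/
def proj {n : ℕ} (N₀ x e₀ b : LVec n) : LVec n :=
  b - lform b x • x + lform b e₀ • projTop N₀ x e₀ + lform b (projTop N₀ x e₀) • e₀

/-- The frame with `A_n = x`, `A_0 = e₀` and `A_i` the projection of `B i`. -/
def projFrame (N₀ x e₀ : LVec (m + r + 1)) (B : Fin m ⊕ Fin r → LVec (m + r + 1)) :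
    FrameIdx m r → LVec (m + r + 1)
  | .zero => e₀
  | .mid i => proj N₀ x e₀ (B i)
  | .pt => x
  | .top => projTop N₀ x e₀

/-- The normalization of the data of `projFrame`. -/
structure IsNormalPair {n : ℕ} (N₀ x e₀ : LVec n) : Prop where
  unit : lform x x = 1
  null : lform e₀ e₀ = 0
  normal : lform e₀ x = 0
  normalized : lform e₀ N₀ = -1

namespace IsNormalPair

variable {n : ℕ} {N₀ x e₀ : LVec n} (h : IsNormalPair N₀ x e₀)

include h

theorem zero_top : lform e₀ (projTop N₀ x e₀) = -1 := by
  simp only [projTop, lform_add_right, lform_sub_right, lform_smul_right, h.normalized, h.normal,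
    h.null, mul_zero, sub_zero, add_zero]

theorem pt_top : lform x (projTop N₀ x e₀) = 0 := by
  rw [projTop, lform_add_right, lform_sub_right, lform_smul_right, lform_smul_right, h.unit,
    lform_comm x e₀, h.normal, lform_comm x N₀]
  ring

/-- For N = N₀ - (N₀, x) x one has (e₀, N) = -1, so adding ½ (N, N) e₀ changes the square of N by
exactly -(N, N). -/
theorem top_top : lform (projTop N₀ x e₀) (projTop N₀ x e₀) = 0 := by
  have h1 : lform e₀ (N₀ - lform N₀ x • x) = -1 := by
    rw [lform_sub_right, lform_smul_right, h.normal, h.normalized, mul_zero, sub_zero]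
  have h2 := h1
  rw [lform_comm] at h2
  rw [projTop]
  simp only [lform_add_left, lform_add_right, lform_smul_left, lform_smul_right, h1, h2, h.null]
  ring

theorem ne_zero : e₀ ≠ 0 := by
  intro h0
  have := h.normalized
  rw [h0, lform_zero_left] at this
  norm_num at this

theorem zero_proj (b : LVec n) : lform e₀ (proj N₀ x e₀ b) = 0 := by
  simp only [proj, lform_add_right, lform_sub_right, lform_smul_right, h.normal, h.zero_top,
    h.null, lform_comm b e₀]
  ring

theorem pt_proj (b : LVec n) : lform x (proj N₀ x e₀ b) = 0 := by
  simp only [proj, lform_add_right, lform_sub_right, lform_smul_right, h.unit, h.pt_top,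
    lform_comm x e₀, h.normal, lform_comm b x]
  ring

theorem top_proj (b : LVec n) : lform (projTop N₀ x e₀) (proj N₀ x e₀ b) = 0 := by
  rw [proj, lform_add_right, lform_add_right, lform_sub_right, lform_smul_right, lform_smul_right,
    lform_smul_right, h.top_top, lform_comm (projTop N₀ x e₀) x, h.pt_top,
    lform_comm (projTop N₀ x e₀) e₀, h.zero_top, lform_comm b (projTop N₀ x e₀)]
  ring

omit h in
theorem proj_eq_self {b : LVec n} (h1 : lform b x = 0) (h2 : lform b e₀ = 0)
    (h3 : lform b (projTop N₀ x e₀) = 0) : proj N₀ x e₀ b = b := by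
  rw [proj, h1, h2, h3]
  simp

/-- The scalar product is positive definite on the complement of `e₀` and `projTop N₀ x e₀`. -/
theorem lform_self_pos {v : LVec n} (h1 : lform e₀ v = 0) (h2 : lform (projTop N₀ x e₀) v = 0)
    (hv : v ≠ 0) : 0 < lform v v := by
  obtain ⟨h3, h4⟩ := lform_self_nonneg_of_isotropic h.ne_zero h.null h1
  refine lt_of_le_of_ne h3 fun h5 => hv ?_
  obtain ⟨c, rfl⟩ := h4 h5.symm
  rw [lform_smul_right, lform_comm, h.zero_top] at h2
  have : c = 0 := by linarith
  rw [this, zero_smul]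

theorem gram_posDef {κ : Type*} [Fintype κ] {v : κ → LVec n} (h1 : ∀ i, lform e₀ (v i) = 0)
    (h2 : ∀ i, lform (projTop N₀ x e₀) (v i) = 0) (hv : LinearIndependent ℝ v) :
    (Matrix.of fun i j => lform (v i) (v j)).PosDef := by
  refine Matrix.PosDef.of_dotProduct_mulVec_pos ?_ fun c hc => ?_
  · rw [Matrix.IsHermitian, Matrix.conjTranspose_eq_transpose_of_trivial]
    ext i j
    exact lform_comm _ _
  · have hexp : dotProduct (star c) ((Matrix.of fun i j => lform (v i) (v j)).mulVec c) =
        lform (∑ i, c i • v i) (∑ i, c i • v i) := by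
      simp only [lform_finset_sum_left, lform_smul_left, lform_finset_sum_right, lform_smul_right,
        dotProduct, Matrix.mulVec, Matrix.of_apply, star_trivial]
      refine Finset.sum_congr rfl fun i _ => ?_
      congr 1
      exact Finset.sum_congr rfl fun j _ => by rw [lform_comm, mul_comm]
    rw [hexp]
    refine h.lform_self_pos ?_ ?_ fun h0 => hc ?_
    · simp [lform_finset_sum_right, lform_smul_right, h1]
    · simp [lform_finset_sum_right, lform_smul_right, h2]
    · exact funext (Fintype.linearIndependent_iff.mp hv c h0)

omit h in
theorem linearIndependent_of_gram {κ : Type*} [Fintype κ] [DecidableEq κ] {v : κ → LVec n}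
    (hv : (Matrix.of fun i j => lform (v i) (v j)).det ≠ 0) : LinearIndependent ℝ v := by
  rw [Fintype.linearIndependent_iff]
  intro c hc
  have h1 : (Matrix.of fun i j => lform (v i) (v j)).mulVec c = 0 := by
    funext i
    have : lform (v i) (∑ j, c j • v j) = 0 := by rw [hc, lform_zero_right]
    rw [lform_finset_sum_right] at this
    refine Eq.trans (Finset.sum_congr rfl fun j _ => ?_) this
    rw [lform_smul_right, mul_comm]
    rfl
  exact congrFun (Matrix.eq_zero_of_mulVec_eq_zero hv h1)

end IsNormalPair

/-- The signature does the work: on the complement of e₀ and `projTop` the scalar product is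
positive definite, so a nonzero Gram determinant, which is an open condition, already gives a
conformal frame. -/
theorem IsNormalPair.projFrame_basis {N₀ x e₀ : LVec (m + r + 1)} (h : IsNormalPair N₀ x e₀)
    {B : Fin m ⊕ Fin r → LVec (m + r + 1)} (hB : (gram (projFrame N₀ x e₀ B)).det ≠ 0) :
    IsConformalBasis (projFrame N₀ x e₀ B) where
  zero_zero := h.null
  zero_mid _ := h.zero_proj _
  zero_pt := h.normal
  zero_top := h.zero_top
  mid_pt _ := (lform_comm _ _).trans (h.pt_proj _)
  mid_top _ := (lform_comm _ _).trans (h.top_proj _)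
  pt_pt := h.unit
  pt_top := h.pt_top
  top_top := h.top_top
  posDef := h.gram_posDef (fun _ => h.zero_proj _) (fun _ => h.top_proj _)
    (linearIndependent_of_gram hB)

theorem proj_sub {n : ℕ} (N₀ x e₀ b c : LVec n) :
    proj N₀ x e₀ (b - c) = proj N₀ x e₀ b - proj N₀ x e₀ c := by
  simp only [proj, lform_sub_left]
  module

theorem proj_smul {n : ℕ} (N₀ x e₀ b : LVec n) (k : ℝ) :
    proj N₀ x e₀ (k • b) = k • proj N₀ x e₀ b := by
  simp only [proj, lform_smul_left]
  module

theorem proj_sum {n : ℕ} {κ : Type*} (s : Finset κ) (N₀ x e₀ : LVec n) (b : κ → LVec n) :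
    proj N₀ x e₀ (∑ i ∈ s, b i) = ∑ i ∈ s, proj N₀ x e₀ (b i) := by
  simp only [proj, lform_finset_sum_left, Finset.sum_smul, Finset.sum_add_distrib,
    Finset.sum_sub_distrib]

/-- The Gram matrix of the projections of the vectors `z p`. -/
def projGram {n : ℕ} (N₀ x e₀ : LVec n) (z : Fin r → LVec n) : Matrix (Fin r) (Fin r) ℝ :=
  Matrix.of fun p q => lform (proj N₀ x e₀ (z p)) (proj N₀ x e₀ (z q))

/-- The vectors `z p` together with the vectors `b a` corrected so as to become orthogonal
to the `z p` after projection. -/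
def adaptBase (b : Fin m → LVec (m + r + 1)) (N₀ x e₀ : LVec (m + r + 1))
    (z : Fin r → LVec (m + r + 1)) : Fin m ⊕ Fin r → LVec (m + r + 1)
  | .inl a => b a - ∑ p, (∑ q, lform (proj N₀ x e₀ (b a)) (proj N₀ x e₀ (z q)) *
      (projGram N₀ x e₀ z)⁻¹ q p) • z p
  | .inr p => z p

/-- The adapted frame determined by `x`, `e₀` and derivatives `z p` of `e₀`. -/
def canFrame (b : Fin m → LVec (m + r + 1)) (N₀ : LVec (m + r + 1))
    (J : LVec (m + r + 1) × LVec (m + r + 1) × (Fin r → LVec (m + r + 1))) :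
    FrameIdx m r → LVec (m + r + 1) :=
  projFrame N₀ J.1 J.2.1 (adaptBase b N₀ J.1 J.2.1 J.2.2)

/-- The correction of b a is the orthogonal projection onto the span of the projected z p, written
with the inverse Gram matrix. -/
theorem canFrame_orthogonal {b : Fin m → LVec (m + r + 1)} {N₀ : LVec (m + r + 1)}
    {J : LVec (m + r + 1) × LVec (m + r + 1) × (Fin r → LVec (m + r + 1))}
    (hg : (projGram N₀ J.1 J.2.1 J.2.2).det ≠ 0) (a : Fin m) (p : Fin r) :
    lform (canFrame b N₀ J (.mid (.inl a))) (canFrame b N₀ J (.mid (.inr p))) = 0 := by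
  simp only [canFrame, projFrame, adaptBase, proj_sub, proj_sum, proj_smul, lform_sub_left,
    lform_finset_sum_left, lform_smul_left]
  set v : Fin r → ℝ := fun q => lform (proj N₀ J.1 J.2.1 (b a)) (proj N₀ J.1 J.2.1 (J.2.2 q))
  set g := projGram N₀ J.1 J.2.1 J.2.2
  have h1 : Matrix.vecMul (Matrix.vecMul v g⁻¹) g = v := by
    rw [Matrix.vecMul_vecMul, Matrix.nonsing_inv_mul _ (isUnit_iff_ne_zero.mpr hg),
      Matrix.vecMul_one]
  exact sub_eq_zero.mpr (congrFun h1 p).symm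

/-! ### Smoothness of the projected vectors -/

section Smooth

variable {E : Type*} [NormedAddCommGroup E] [NormedSpace ℝ E] {n : ℕ} {N₀ : LVec n} {k : WithTop ℕ∞}
  {x e₀ b : E → LVec n} {t : E} (hx : ContDiffAt ℝ k x t) (he : ContDiffAt ℝ k e₀ t)

include hx he

theorem ContDiffAt.projTop : ContDiffAt ℝ k (fun s => projTop N₀ (x s) (e₀ s)) t := by
  have h1 : ContDiffAt ℝ k (fun s => N₀ - lform N₀ (x s) • x s) t :=
    contDiffAt_const.sub ((contDiffAt_const.lform hx).smul hx)
  exact h1.add ((contDiffAt_const.mul (h1.lform h1)).smul he)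

theorem ContDiffAt.proj (hb : ContDiffAt ℝ k b t) :
    ContDiffAt ℝ k (fun s => proj N₀ (x s) (e₀ s) (b s)) t := by
  have h1 := ContDiffAt.projTop (N₀ := N₀) hx he
  exact ((hb.sub ((hb.lform hx).smul hx)).add ((hb.lform he).smul h1)).add ((hb.lform h1).smul he)

theorem ContDiffAt.projGram_inv {z : E → Fin r → LVec n}
    (hz : ∀ p, ContDiffAt ℝ k (fun s => z s p) t) (hg : (projGram N₀ (x t) (e₀ t) (z t)).det ≠ 0)
    (p q : Fin r) : ContDiffAt ℝ k (fun s => (projGram N₀ (x s) (e₀ s) (z s))⁻¹ p q) t := by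
  have h1 : ∀ i j, ContDiffAt ℝ k (fun s => projGram N₀ (x s) (e₀ s) (z s) i j) t := fun i j =>
    (ContDiffAt.proj hx he (hz i)).lform (ContDiffAt.proj hx he (hz j))
  exact contDiffAt_matrix_inv h1 hg p q

end Smooth

theorem contDiffAt_canFrame {b : Fin m → LVec (m + r + 1)} {N₀ : LVec (m + r + 1)}
    {J : LVec (m + r + 1) × LVec (m + r + 1) × (Fin r → LVec (m + r + 1))}
    (hg : (projGram N₀ J.1 J.2.1 J.2.2).det ≠ 0) (ξ : FrameIdx m r) :
    ContDiffAt ℝ ∞ (fun J => canFrame b N₀ J ξ) J := by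
  have hx : ContDiffAt ℝ ∞ (fun J : LVec (m + r + 1) × LVec (m + r + 1) ×
    (Fin r → LVec (m + r + 1)) => J.1) J := contDiffAt_fst
  have he : ContDiffAt ℝ ∞ (fun J : LVec (m + r + 1) × LVec (m + r + 1) ×
    (Fin r → LVec (m + r + 1)) => J.2.1) J := contDiffAt_fst.comp J contDiffAt_snd
  have hz : ∀ p, ContDiffAt ℝ ∞ (fun J : LVec (m + r + 1) × LVec (m + r + 1) ×
    (Fin r → LVec (m + r + 1)) => J.2.2 p) J := fun p =>
    (contDiffAt_pi.mp (contDiffAt_snd (𝕜 := ℝ) (p := J.2)) p).comp J contDiffAt_snd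
  cases ξ with
  | zero => exact he
  | pt => exact hx
  | top => exact ContDiffAt.projTop hx he
  | mid i =>
    refine ContDiffAt.proj hx he ?_
    cases i with
    | inr p => exact hz p
    | inl a =>
      refine contDiffAt_const.sub (ContDiffAt.sum fun p _ => ContDiffAt.fun_smul
        (ContDiffAt.sum fun q _ => ContDiffAt.mul ?_ ?_) (hz p))
      · exact (ContDiffAt.proj hx he contDiffAt_const).lform (ContDiffAt.proj hx he (hz q))
      · exact ContDiffAt.projGram_inv hx he hz hg q p

end ProjFrame

/-! ### Existence of adapted frames -/

section CanField

variable {m r : ℕ} {F e₀ : Par m r → LVec (m + r + 1)} {N₀ : LVec (m + r + 1)}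
  {U : Set (Par m r)}

/-- The tensor `ν` of the hypersurface `F` has rank `r`. -/
def ReducedOn (F : Par m r → LVec (m + r + 1)) (U : Set (Par m r)) : Prop :=
  ∀ (A : FrameIdx m r → Par m r → LVec (m + r + 1)) (U' : Set (Par m r)), U' ⊆ U →
    LightFrame A U' → (∀ t ∈ U', A .pt t = F t) → ∀ t ∈ U', ∀ ν, NuAt A t ν → ν.rank = r

/-- The data from which `canFrame` builds the adapted frame. -/
def canJet (F e₀ : Par m r → LVec (m + r + 1)) (w : Fin r → Par m r) (t : Par m r) :
    LVec (m + r + 1) × LVec (m + r + 1) × (Fin r → LVec (m + r + 1)) :=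
  (F t, e₀ t, fun p => pd (w p) e₀ t)

/-- The adapted frame determined by `F`, `e₀`, the directions `w p` and the vectors `b a`. -/
def canField (b : Fin m → LVec (m + r + 1)) (N₀ : LVec (m + r + 1))
    (F e₀ : Par m r → LVec (m + r + 1)) (w : Fin r → Par m r) :
    FrameIdx m r → Par m r → LVec (m + r + 1) :=
  fun ξ t => canFrame b N₀ (canJet F e₀ w t) ξ

namespace NullNormal

variable (h : NullNormal F e₀ N₀ U) {t : Par m r} (ht : t ∈ U)

include h ht

theorem isNormalPair : IsNormalPair N₀ (F t) (e₀ t) :=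
  ⟨h.unit t ht, h.null t ht, h.normal t ht, h.normalized t ht⟩

theorem eventually_mem : ∀ᶠ s in 𝓝 t, s ∈ U := h.isOpen.mem_nhds ht

theorem lform_pd_zero (u : Par m r) : lform (pd u e₀ t) (e₀ t) = 0 := by
  have := lform_pd_of_const u (h.smooth_normal t ht) (h.smooth_normal t ht)
    ((h.eventually_mem ht).mono h.null)
  rw [lform_comm (e₀ t)] at this
  linarith

theorem lform_pd_pt (u : Par m r) : lform (pd u e₀ t) (F t) = 0 := by
  rw [lform_pd_of_const u (h.smooth_normal t ht) (h.smooth t ht)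
    ((h.eventually_mem ht).mono h.normal), h.normal_pd t ht, neg_zero]

/-- Derivatives of e₀ are already orthogonal to e₀ and F, so the projection changes them only by a
multiple of e₀. -/
theorem proj_pd (u : Par m r) : proj N₀ (F t) (e₀ t) (pd u e₀ t) =
    pd u e₀ t + lform (pd u e₀ t) (projTop N₀ (F t) (e₀ t)) • e₀ t := by
  rw [proj, h.lform_pd_pt ht, h.lform_pd_zero ht]
  simp

omit ht in
theorem lightFrame {A : FrameIdx m r → Par m r → LVec (m + r + 1)} {U' : Set (Par m r)}
    (hU' : IsOpen U') (hsub : U' ⊆ U) (hA : ∀ ξ, ∀ t ∈ U', ContDiffAt ℝ ∞ (A ξ) t)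
    (hb : ∀ t ∈ U', IsConformalBasis fun ξ => A ξ t) (hpt : A .pt = F) (h0 : A .zero = e₀) :
    LightFrame A U' where
  isOpen := hU'
  smooth := hA
  basis := hb
  tangent t ht u := by
    rw [hpt, h0, lform_comm]
    exact h.normal_pd t (hsub ht) u
  inj t ht u hu := by
    rw [hpt] at hu
    exact h.inj t (hsub ht) u hu

theorem contDiffAt_canJet (w : Fin r → Par m r) : ContDiffAt ℝ ∞ (canJet F e₀ w) t :=
  (h.smooth t ht).prodMk ((h.smooth_normal t ht).prodMk
    (contDiffAt_pi.mpr fun p => contDiffAt_pd (w p) (h.smooth_normal t ht)))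

theorem contDiffAt_canField {b : Fin m → LVec (m + r + 1)} {w : Fin r → Par m r}
    (hg : (projGram N₀ (F t) (e₀ t) fun p => pd (w p) e₀ t).det ≠ 0) (ξ : FrameIdx m r) :
    ContDiffAt ℝ ∞ (canField b N₀ F e₀ w ξ) t :=
  (contDiffAt_canFrame (J := canJet F e₀ w t) hg ξ).comp t (h.contDiffAt_canJet ht w)

/-- A frame made from constant vectors, in general not adapted. It serves to apply the rank
hypothesis before adapted frames are available. -/
theorem exists_constFrame {B : Fin m ⊕ Fin r → LVec (m + r + 1)}
    (hB : (gram (projFrame N₀ (F t) (e₀ t) B)).det ≠ 0) :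
    ∃ U', t ∈ U' ∧ U' ⊆ U ∧ LightFrame (fun ξ s => projFrame N₀ (F s) (e₀ s) B ξ) U' := by
  have hsm : ∀ ξ, ∀ s ∈ U, ContDiffAt ℝ ∞ (fun s => projFrame N₀ (F s) (e₀ s) B ξ) s := by
    intro ξ s hs
    cases ξ with
    | zero => exact h.smooth_normal s hs
    | pt => exact h.smooth s hs
    | top => exact ContDiffAt.projTop (h.smooth s hs) (h.smooth_normal s hs)
    | mid i => exact ContDiffAt.proj (h.smooth s hs) (h.smooth_normal s hs) contDiffAt_const
  have hc : ContinuousAt (fun s => (gram (projFrame N₀ (F s) (e₀ s) B)).det) t :=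
    (contDiffAt_det (k := ∞) fun i j => (hsm (.mid i) t ht).lform (hsm (.mid j) t ht)).continuousAt
  obtain ⟨U', hU's, hU'o, htU'⟩ := mem_nhds_iff.mp
    (Filter.inter_mem (hc.eventually_ne hB) (h.isOpen.mem_nhds ht))
  refine ⟨U', htU', fun s hs => (hU's hs).2, h.lightFrame hU'o (fun s hs => (hU's hs).2)
    (fun ξ s hs => hsm ξ s (hU's hs).2) (fun s hs => ?_) rfl rfl⟩
  exact (h.isNormalPair (hU's hs).2).projFrame_basis (hU's hs).1

/-- The frame `canField` is adapted. -/
theorem exists_localFrame (hr : ReducedOn F U) {b : Fin m → LVec (m + r + 1)}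
    {w : Fin r → Par m r}
    (hg : (projGram N₀ (F t) (e₀ t) fun p => pd (w p) e₀ t).det ≠ 0)
    (hb : (gram fun ξ => canField b N₀ F e₀ w ξ t).det ≠ 0) :
    ∃ U', t ∈ U' ∧ U' ⊆ U ∧ LocalFrame (canField b N₀ F e₀ w) U' := by
  have hc : ContinuousAt (fun s => (gram fun ξ => canField b N₀ F e₀ w ξ s).det) t :=
    (contDiffAt_det (k := ∞) fun i j => (h.contDiffAt_canField ht hg (.mid i)).lform
      (h.contDiffAt_canField ht hg (.mid j))).continuousAt
  have hgc : ContinuousAt (fun s => (projGram N₀ (F s) (e₀ s) fun p => pd (w p) e₀ s).det) t :=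
    (contDiffAt_det (k := ∞) fun i j =>
      (ContDiffAt.proj (h.smooth t ht) (h.smooth_normal t ht)
        (contDiffAt_pd (w i) (h.smooth_normal t ht))).lform
      (ContDiffAt.proj (h.smooth t ht) (h.smooth_normal t ht)
        (contDiffAt_pd (w j) (h.smooth_normal t ht)))).continuousAt
  obtain ⟨U', hU's, hU'o, htU'⟩ := mem_nhds_iff.mp
    (Filter.inter_mem (hc.eventually_ne hb)
      (Filter.inter_mem (hgc.eventually_ne hg) (h.isOpen.mem_nhds ht)))
  have hsub : U' ⊆ U := fun s hs => (hU's hs).2.2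
  have hL : LightFrame (canField b N₀ F e₀ w) U' :=
    h.lightFrame hU'o hsub (fun ξ s hs => h.contDiffAt_canField (hsub hs) (hU's hs).2.1 ξ)
      (fun s hs => (h.isNormalPair (hsub hs)).projFrame_basis (hU's hs).1) rfl rfl
  have ho : ∀ s ∈ U', ∀ a p, lform (canField b N₀ F e₀ w (.mid (.inl a)) s)
      (canField b N₀ F e₀ w (.mid (.inr p)) s) = 0 := fun s hs a p =>
    canFrame_orthogonal (J := canJet F e₀ w s) (hU's hs).2.1 a p
  refine ⟨U', htU', hsub, hL.toLocalFrame ho (fun s hs a u => ?_)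
    (hr _ U' hsub hL fun _ _ => rfl)⟩
  obtain ⟨ν, hν⟩ := hL.exists_nuAt hs
  have hrank := hL.rank_nu hs hν
  rw [hr _ U' hsub hL (fun _ _ => rfl) s hs ν hν] at hrank
  set L : Par m r →ₗ[ℝ] (Fin m ⊕ Fin r → ℝ) :=
    LinearMap.pi fun i => omLin (canField b N₀ F e₀ w) (.mid i) .top s with hLdef
  have hLu : ∀ u i, L u i = lform (canField b N₀ F e₀ w (.mid i) s) (pd u e₀ s) := fun u i =>
    hL.om_mid_top hs i u
  -- The derivative of e₀ along w_p is A_p modulo e₀, so the values of the ω_i^{n+1} on w_p are the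
  -- scalar products g_{ip}, which vanish for i = a.
  have hz : ∀ i p, L (w p) i = lform (canField b N₀ F e₀ w (.mid i) s)
      (canField b N₀ F e₀ w (.mid (.inr p)) s) := by
    intro i p
    have h1 : canField b N₀ F e₀ w (.mid (.inr p)) s = pd (w p) e₀ s +
        lform (pd (w p) e₀ s) (projTop N₀ (F s) (e₀ s)) • e₀ s := h.proj_pd (hsub hs) (w p)
    have h2 : lform (canField b N₀ F e₀ w (.mid i) s) (e₀ s) = 0 :=
      (lform_comm _ _).trans ((hL.basis s hs).zero_mid i)
    rw [hLu, h1, lform_add_right, lform_smul_right, h2, mul_zero, add_zero]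
  set g := projGram N₀ (F s) (e₀ s) fun p => pd (w p) e₀ s with hgdef
  have hgu : IsUnit g.det := isUnit_iff_ne_zero.mpr (hU's hs).2.1
  have hLw : ∀ c : Fin r → ℝ, (∀ q, L (∑ p, c p • w p) (.inr q) = g.mulVec c q) ∧
      ∀ a, L (∑ p, c p • w p) (.inl a) = 0 := by
    intro c
    have h1 : ∀ i, L (∑ p, c p • w p) i = ∑ p, c p * L (w p) i := by
      intro i
      rw [map_sum, Finset.sum_apply]
      simp only [map_smul, Pi.smul_apply, smul_eq_mul]
    refine ⟨fun q => ?_, fun a => ?_⟩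
    · rw [h1]
      exact Finset.sum_congr rfl fun p _ => by rw [hz, mul_comm]; rfl
    · rw [h1]
      exact Finset.sum_eq_zero fun p _ => by rw [hz, ho s hs, mul_zero]
  let π : LinearMap.range L →ₗ[ℝ] (Fin r → ℝ) :=
    (LinearMap.pi fun p => LinearMap.proj (Sum.inr p)).comp (LinearMap.range L).subtype
  have hinv : ∀ c : Fin r → ℝ, g.mulVec (g⁻¹.mulVec c) = c := fun c => by
    rw [Matrix.mulVec_mulVec, Matrix.mul_nonsing_inv _ hgu, Matrix.one_mulVec]
  have hsurj : Function.Surjective π := by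
    intro c
    refine ⟨⟨L (∑ p, (g⁻¹.mulVec c) p • w p), ⟨_, rfl⟩⟩, funext fun q => ?_⟩
    exact ((hLw _).1 q).trans (congrFun (hinv c) q)
  have hinj : Function.Injective π := by
    refine (LinearMap.injective_iff_surjective_of_finrank_eq_finrank ?_).mpr hsurj
    rw [← hrank]
    simp
  -- The range of L has dimension r and is mapped onto the last r coordinates, hence injectively. So
  -- L u equals the value of L on a combination of the w_p, whose a-coordinates are 0.
  have key := @hinj ⟨L u, ⟨u, rfl⟩⟩
    ⟨L (∑ p, (g⁻¹.mulVec fun q => L u (.inr q)) p • w p), ⟨_, rfl⟩⟩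
    (funext fun q => ((hLw _).1 q).symm ▸ (congrFun (hinv fun q => L u (.inr q)) q).symm)
  exact (congrFun (congrArg Subtype.val key) (Sum.inl a)).trans ((hLw _).2 a)

end NullNormal

/-- Linearly independent vectors orthogonal to given ones. -/
theorem exists_orthogonal_family {n : ℕ} {ι κ : Type*} [Fintype ι] [Fintype κ] (y : κ → LVec n)
    (hcard : Fintype.card ι + Fintype.card κ ≤ n + 2) :
    ∃ v : ι → LVec n, LinearIndependent ℝ v ∧ ∀ i k, lform (v i) (y k) = 0 := by
  let L : LVec n →ₗ[ℝ] (κ → ℝ) := LinearMap.pi fun k => (lformLin n).flip (y k)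
  have h1 := LinearMap.finrank_range_add_finrank_ker L
  have h2 : Module.finrank ℝ (LinearMap.range L) ≤ Fintype.card κ := by
    simpa using Submodule.finrank_le (LinearMap.range L)
  have h3 : Fintype.card ι ≤ Module.finrank ℝ (LinearMap.ker L) := by
    simp only [Module.finrank_fintype_fun_eq_card, Fintype.card_fin] at h1
    omega
  obtain ⟨v, hv⟩ := exists_linearIndependent_of_le_finrank h3
  refine ⟨fun i => (v (Fintype.equivFin ι i) : LVec n), ?_, fun i k => ?_⟩
  · exact (hv.map' _ (Submodule.ker_subtype _)).comp _ (Fintype.equivFin ι).injective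
  · exact congrFun (LinearMap.mem_ker.mp (v (Fintype.equivFin ι i)).2) k

/-- There are directions and vectors for which `canField` is a frame at a given point. -/
theorem NullNormal.exists_data (h : NullNormal F e₀ N₀ U) (hr : ReducedOn F U) {t : Par m r}
    (ht : t ∈ U) : ∃ (b : Fin m → LVec (m + r + 1)) (w : Fin r → Par m r),
      (projGram N₀ (F t) (e₀ t) fun p => pd (w p) e₀ t).det ≠ 0 ∧
      (gram fun ξ => canField b N₀ F e₀ w ξ t).det ≠ 0 := by
  have hn := h.isNormalPair ht
  -- There is exactly room for the m + r vectors: three orthogonality conditions in dimension m + r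
  -- + 3.
  obtain ⟨B, hBi, hB⟩ := exists_orthogonal_family (ι := Fin m ⊕ Fin r)
    ![F t, e₀ t, projTop N₀ (F t) (e₀ t)] (by simp)
  have hBp : ∀ i, proj N₀ (F t) (e₀ t) (B i) = B i := fun i =>
    IsNormalPair.proj_eq_self (hB i 0) (hB i 1) (hB i 2)
  obtain ⟨U', htU', hU', hL⟩ := h.exists_constFrame ht (B := B) (by
    have := (hn.gram_posDef (v := fun i => proj N₀ (F t) (e₀ t) (B i))
      (fun _ => hn.zero_proj _) (fun _ => hn.top_proj _)
      (by simpa only [hBp] using hBi)).det_pos.ne'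
    exact this)
  set A : FrameIdx m r → Par m r → LVec (m + r + 1) := fun ξ s => projFrame N₀ (F s) (e₀ s) B ξ
    with hA
  obtain ⟨ν, hν⟩ := hL.exists_nuAt htU'
  have hrank := hL.rank_nu htU' hν
  rw [hr A U' hU' hL (fun _ _ => rfl) t htU' ν hν] at hrank
  set L : Par m r →ₗ[ℝ] (Fin m ⊕ Fin r → ℝ) := LinearMap.pi fun i => omLin A (.mid i) .top t
    with hLdef
  have hLu : ∀ u i, L u i = lform (A (.mid i) t) (pd u e₀ t) := fun u i =>
    hL.om_mid_top htU' i u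
  -- The directions w are preimages of a basis of the r-dimensional space of values of the forms
  -- ω_i^{n+1}.
  let β := Module.finBasisOfFinrankEq ℝ (LinearMap.range L) hrank.symm
  choose w hw using fun p => (β p).2
  -- A relation between the projections makes the corresponding derivative of e₀ a multiple of e₀,
  -- on which all ω_i^{n+1} vanish; this contradicts the choice of w.
  have hpr : LinearIndependent ℝ fun p => proj N₀ (F t) (e₀ t) (pd (w p) e₀ t) := by
    rw [Fintype.linearIndependent_iff]
    intro c hc
    simp only [h.proj_pd ht, smul_add, Finset.sum_add_distrib, smul_smul, ← Finset.sum_smul] at hc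
    have h1 : L (∑ p, c p • w p) = 0 := by
      funext i
      have h2 : pd (∑ p, c p • w p) e₀ t = ∑ p, c p • pd (w p) e₀ t := by
        simp only [pd, map_sum, map_smul]
      have h3 : lform (A (.mid i) t) (e₀ t) = 0 :=
        (lform_comm _ _).trans ((hL.basis t htU').zero_mid i)
      rw [hLu, h2, eq_neg_of_add_eq_zero_left hc, lform_neg_right, lform_smul_right, h3, mul_zero,
        neg_zero]
      rfl
    have h2 : ∑ p, c p • β p = 0 := by
      apply Subtype.ext
      rw [map_sum] at h1
      simp only [map_smul, hw] at h1
      simpa using h1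
    exact Fintype.linearIndependent_iff.mp β.linearIndependent c h2
  have hg : (projGram N₀ (F t) (e₀ t) fun p => pd (w p) e₀ t).PosDef :=
    hn.gram_posDef (fun _ => hn.zero_proj _) (fun _ => hn.top_proj _) hpr
  -- The b a are taken orthogonal to the projected derivatives, so at the point t the correction in
  -- `adaptBase` is zero.
  obtain ⟨b, hbi, hb⟩ := exists_orthogonal_family (ι := Fin m)
    (Sum.elim ![F t, e₀ t, projTop N₀ (F t) (e₀ t)]
      fun p : Fin r => proj N₀ (F t) (e₀ t) (pd (w p) e₀ t)) (by simp; omega)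
  have hbp : ∀ a, proj N₀ (F t) (e₀ t) (b a) = b a := fun a =>
    IsNormalPair.proj_eq_self (hb a (.inl 0)) (hb a (.inl 1)) (hb a (.inl 2))
  have hbz : ∀ a p, lform (b a) (proj N₀ (F t) (e₀ t) (pd (w p) e₀ t)) = 0 := fun a p =>
    hb a (.inr p)
  refine ⟨b, w, hg.det_pos.ne', ?_⟩
  have hmid : ∀ i, canField b N₀ F e₀ w (.mid i) t =
      Sum.elim b (fun p => proj N₀ (F t) (e₀ t) (pd (w p) e₀ t)) i := by
    intro i
    cases i with
    | inr p => rfl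
    | inl a =>
      change proj N₀ (F t) (e₀ t) (b a - ∑ p, (∑ q, lform (proj N₀ (F t) (e₀ t) (b a))
        (proj N₀ (F t) (e₀ t) (pd (w q) e₀ t)) * _) • _) = b a
      simp only [hbp, hbz, zero_mul, Finset.sum_const_zero, zero_smul, sub_zero]
  refine (hn.gram_posDef (v := fun i => canField b N₀ F e₀ w (.mid i) t)
    (fun _ => hn.zero_proj _) (fun _ => hn.top_proj _) ?_).det_pos.ne'
  simp only [hmid]
  rw [Fintype.linearIndependent_iff]
  intro c hc
  rw [Fintype.sum_sum_type] at hc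
  simp only [Sum.elim_inl, Sum.elim_inr] at hc
  have h1 : ∀ p, c (.inr p) = 0 := by
    have h2 : Matrix.mulVec (projGram N₀ (F t) (e₀ t) fun p => pd (w p) e₀ t)
        (fun p => c (.inr p)) = 0 := by
      funext q
      have := congrArg (fun x => lform (proj N₀ (F t) (e₀ t) (pd (w q) e₀ t)) x) hc
      simp only [lform_add_right, lform_finset_sum_right, lform_smul_right,
        lform_comm (proj N₀ (F t) (e₀ t) (pd (w q) e₀ t)) (b _), hbz, mul_zero,
        Finset.sum_const_zero, zero_add, lform_zero_right] at this
      rw [Matrix.mulVec, dotProduct]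
      refine Eq.trans (Finset.sum_congr rfl fun p _ => ?_) this
      exact mul_comm _ _
    exact congrFun (Matrix.eq_zero_of_mulVec_eq_zero hg.det_pos.ne' h2)
  simp only [h1, zero_smul, Finset.sum_const_zero, add_zero] at hc
  rintro (a | p)
  · exact Fintype.linearIndependent_iff.mp hbi _ hc a
  · exact h1 p

end CanField

/-! ### Curves in the generators -/

section Curves

variable {m r : ℕ}

/-- The zero solution of a linear system of differential equations is unique. -/
theorem eq_zero_of_linear_system {ι : Type*} [Fintype ι] {y : ℝ → ι → ℝ} {c : ℝ → ι → ι → ℝ}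
    {δ : ℝ} (hy : ∀ s ∈ Set.Icc 0 δ, ∀ i, HasDerivAt (fun x => y x i) (∑ j, c s i j * y s j) s)
    (hc : ∀ i j, ContinuousOn (fun s => c s i j) (Set.Icc 0 δ)) (h0 : y 0 = 0) :
    ∀ s ∈ Set.Icc 0 δ, y s = 0 := by
  have hb : ∀ i j, ∃ C, ∀ s ∈ Set.Icc 0 δ, ‖c s i j‖ ≤ C := fun i j =>
    isCompact_Icc.exists_bound_of_continuousOn (hc i j)
  choose C hC using hb
  have hy' : ∀ s ∈ Set.Icc 0 δ, HasDerivAt y (fun i => ∑ j, c s i j * y s j) s := fun s hs =>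
    hasDerivAt_pi.mpr (hy s hs)
  refine eq_zero_of_abs_deriv_le_mul_abs_self_of_eq_zero_right (K := ∑ i, ∑ j, |C i j|)
    (fun s hs => (hy' s hs).continuousAt.continuousWithinAt)
    (fun s hs => (hy' s (Set.Ico_subset_Icc_self hs)).hasDerivWithinAt) h0 fun s hs => ?_
  have hs' := Set.Ico_subset_Icc_self hs
  rw [pi_norm_le_iff_of_nonneg (by positivity)]
  intro i
  calc ‖∑ j, c s i j * y s j‖ ≤ ∑ j, ‖c s i j * y s j‖ := norm_sum_le _ _
    _ ≤ ∑ j, |C i j| * ‖y s‖ := by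
        refine Finset.sum_le_sum fun j _ => ?_
        rw [norm_mul]
        exact mul_le_mul ((hC i j s hs').trans (le_abs_self _)) (norm_le_pi_norm _ _)
          (norm_nonneg _) (abs_nonneg _)
    _ = (∑ j, |C i j|) * ‖y s‖ := (Finset.sum_mul _ _ _).symm
    _ ≤ (∑ i, ∑ j, |C i j|) * ‖y s‖ := by
        refine mul_le_mul_of_nonneg_right ?_ (norm_nonneg _)
        exact Finset.single_le_sum (f := fun i => ∑ j, |C i j|)
          (fun i _ => Finset.sum_nonneg fun j _ => abs_nonneg _) (Finset.mem_univ i)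

/-- The indices of the vertices of the generator. -/
def genIdx : Option (Option (Fin m)) → FrameIdx m r
  | none => .zero
  | some α => normalIdx α

theorem span_genIdx (e : FrameIdx m r → LVec (m + r + 1)) :
    Submodule.span ℝ {e .zero} ⊔ Submodule.span ℝ (Set.range fun α => e (normalIdx α)) =
      Submodule.span ℝ (Set.range fun i => e (genIdx i)) := by
  rw [← Submodule.span_union]
  congr 1
  ext x
  constructor
  · rintro (rfl | ⟨α, rfl⟩)
    · exact ⟨none, rfl⟩
    · exact ⟨some α, rfl⟩
  · rintro ⟨_ | α, rfl⟩
    · exact Or.inl rfl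
    · exact Or.inr ⟨α, rfl⟩

namespace LocalFrame

variable {A : FrameIdx m r → Par m r → LVec (m + r + 1)} {U : Set (Par m r)} (h : LocalFrame A U)
  {t : Par m r} (ht : t ∈ U)

include h ht

/-- The vertices of the generator satisfy a closed homogeneous linear system along directions
annihilated by the ω_0^p. This is what keeps the generator fixed in `exists_curve`. -/
theorem pd_genIdx_of_kernel {v : Par m r} (hv : ∀ p, om A .zero (.mid (.inr p)) v t = 0)
    (i : Option (Option (Fin m))) : pd v (A (genIdx i)) t =
      ∑ j, om A (genIdx i) (genIdx j) v t • A (genIdx j) t := by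
  cases i with
  | none =>
    have h1 : ∀ α, om A .zero (normalIdx α) v t = 0 :=
      h.eq_zero_of_lform_normal ht fun β => h.pd_zero_normal ht β v
    rw [Fintype.sum_option]
    simp only [genIdx, h1, zero_smul, Finset.sum_const_zero, add_zero]
    exact h.pd_zero_of_kernel ht hv
  | some α =>
    rw [Fintype.sum_option]
    exact h.pd_normal_of_kernel ht hv α

/-- Every direction annihilated by the forms `ω_0^p` is tangent to a curve along which the point
`A_n` stays in the generator. -/
theorem exists_curve {w : Fin r → Par m r}
    (hw : ∀ s ∈ U, ∀ p q, om A .zero (.mid (.inr p)) (w q) s = if p = q then 1 else 0)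
    {v : Par m r} (hv : ∀ p, om A .zero (.mid (.inr p)) v t = 0) :
    ∃ γ : ℝ → Par m r, γ 0 = t ∧ HasDerivAt γ v 0 ∧ ∃ δ > 0, ∀ s ∈ Set.Icc 0 δ,
      A .pt (γ s) ∈ Submodule.span ℝ (Set.range fun i => A (genIdx i) t) := by
  -- The direction v is corrected at every point so as to annihilate the ω_0^p; this uses that w is
  -- dual to these forms on all of U. At t no correction is needed.
  let V : Par m r → Par m r := fun x => v - ∑ p, om A .zero (.mid (.inr p)) v x • w p
  have hVs : ∀ x ∈ U, ContDiffAt ℝ ∞ V x := fun x hx =>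
    contDiffAt_const.sub (ContDiffAt.sum fun p _ => (h.contDiffAt_om hx _ _ v).smul contDiffAt_const)
  have hVt : V t = v := by simp [V, hv]
  have hVk : ∀ x ∈ U, ∀ p, om A .zero (.mid (.inr p)) (V x) x = 0 := by
    intro x hx p
    rw [← omLin_apply, map_sub, map_sum]
    simp only [map_smul, smul_eq_mul, omLin_apply, hw x hx]
    simp
  obtain ⟨ρ, hρ, ε, hε, hex⟩ := ((hVs t ht).of_le
    (by simp) : ContDiffAt ℝ 1 V t).exists_forall_mem_closedBall_exists_eq_forall_mem_Ioo_hasDerivAt 0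
  obtain ⟨γ, hγ0, hγ⟩ := hex t (Metric.mem_closedBall_self hρ.le)
  have hd0 : HasDerivAt γ v 0 := by
    have := hγ 0 ⟨by linarith, by linarith⟩
    rwa [hγ0, hVt] at this
  have hU : ∀ᶠ s in 𝓝 (0 : ℝ), γ s ∈ U :=
    hd0.continuousAt.eventually (by rw [hγ0]; exact h.isOpen.mem_nhds ht)
  obtain ⟨δ₀, hδ₀, hball⟩ := Metric.eventually_nhds_iff.mp hU
  have hδ : ∀ s ∈ Set.Icc 0 (min δ₀ ε / 2), γ s ∈ U ∧ HasDerivAt γ (V (γ s)) s := by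
    intro s hs
    have hpos : 0 < min δ₀ ε := lt_min hδ₀ hε
    have h1 : s < δ₀ := by
      have := min_le_left δ₀ ε
      linarith [hs.2]
    have h2 : s < ε := by
      have := min_le_right δ₀ ε
      linarith [hs.2]
    refine ⟨hball ?_, hγ s ⟨by linarith [hs.1], by linarith⟩⟩
    rw [Real.dist_eq, sub_zero, abs_of_nonneg hs.1]
    exact h1
  refine ⟨γ, hγ0, hd0, min δ₀ ε / 2, half_pos (lt_min hδ₀ hε), fun s hs => ?_⟩
  by_contra hmem
  -- A functional vanishing on the generator at t would separate it from the point A_n on the curve.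
  -- Its values on the vertices solve a homogeneous linear system with zero initial data, hence
  -- vanish.
  obtain ⟨φ, hφ, hφL⟩ := Submodule.exists_le_ker_of_notMem hmem
  apply hφ
  have key := eq_zero_of_linear_system (y := fun s i => φ (A (genIdx i) (γ s)))
    (c := fun s i j => om A (genIdx i) (genIdx j) (V (γ s)) (γ s)) (δ := min δ₀ ε / 2)
    (fun s hs i => ?_) (fun i j s hs => ?_) (funext fun i => ?_) s hs
  · exact congrFun key (some none)
  · obtain ⟨hsU, hsd⟩ := hδ s hs
    have h1 := (h.diff hsU (genIdx i)).hasFDerivAt.comp_hasDerivAt s hsd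
    have h2 := (LinearMap.toContinuousLinearMap φ).hasFDerivAt.comp_hasDerivAt s h1
    refine HasDerivAt.congr_deriv h2 ?_
    have h3 := h.pd_genIdx_of_kernel hsU (hVk _ hsU) i
    change φ (pd (V (γ s)) (A (genIdx i)) (γ s)) = _
    rw [h3, map_sum]
    simp only [map_smul, smul_eq_mul]
  · obtain ⟨hsU, hsd⟩ := hδ s hs
    have h1 : ContDiffAt ℝ ∞ (fun x => fderiv ℝ (A (genIdx i)) x (V x)) (γ s) :=
      ((h.smooth (genIdx i) _ hsU).fderiv_right (m := ∞) (by simp)).clm_apply (hVs _ hsU)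
    have h2 := (h.contDiffAt_coeff hsU h1 (genIdx j)).continuousAt
    exact (ContinuousAt.comp (f := γ) h2 hsd.continuousAt).continuousWithinAt
  · change φ (A (genIdx i) (γ 0)) = 0
    rw [hγ0]
    exact hφL (Submodule.subset_span ⟨i, rfl⟩)

end LocalFrame

end Curves

/-! ### Functions vanishing to a given order -/

section Flat

variable {E G : Type*} [NormedAddCommGroup E] [NormedSpace ℝ E] [NormedAddCommGroup G]
  [NormedSpace ℝ G]

/-- `F` is smooth in a neighborhood of `t`. -/
def SmoothNear (F : E → G) (t : E) : Prop := ∀ᶠ s in 𝓝 t, ContDiffAt ℝ ∞ F s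

/-- All partial derivatives of `F` of order at most `k` vanish at `t`. -/
def Flat : ℕ → (E → G) → E → Prop
  | 0, F, t => F t = 0
  | k + 1, F, t => F t = 0 ∧ ∀ a, Flat k (pd a F) t

variable {F F' : E → G} {t : E} {k : ℕ}

theorem SmoothNear.self (h : SmoothNear F t) : ContDiffAt ℝ ∞ F t := h.self_of_nhds

theorem SmoothNear.pd (h : SmoothNear F t) (a : E) : SmoothNear (pd a F) t :=
  h.mono fun _ hs => contDiffAt_pd a hs

theorem SmoothNear.sub (h : SmoothNear F t) (h' : SmoothNear F' t) :
    SmoothNear (fun s => F s - F' s) t := by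
  filter_upwards [h, h'] with s hs hs' using hs.sub hs'

theorem SmoothNear.neg (h : SmoothNear F t) : SmoothNear (fun s => -F s) t :=
  h.mono fun _ hs => hs.neg

theorem smoothNear_const (c : G) : SmoothNear (fun _ : E => c) t :=
  Filter.Eventually.of_forall fun _ => contDiffAt_const

theorem SmoothNear.lform {n : ℕ} {F F' : E → LVec n} (h : SmoothNear F t) (h' : SmoothNear F' t) :
    SmoothNear (fun s => lform (F s) (F' s)) t := by
  filter_upwards [h, h'] with s hs hs' using hs.lform hs'

theorem Flat.eq_zero (h : Flat k F t) : F t = 0 := by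
  cases k with
  | zero => exact h
  | succ k => exact h.1

theorem Flat.of_succ (h : Flat (k + 1) F t) : Flat k F t := by
  induction k generalizing F with
  | zero => exact h.1
  | succ k ih => exact ⟨h.1, fun a => ih (h.2 a)⟩

theorem Flat.congr (h : Flat k F t) (hF : F =ᶠ[𝓝 t] F') : Flat k F' t := by
  induction k generalizing F F' with
  | zero => exact hF.self_of_nhds.symm.trans h
  | succ k ih =>
    exact ⟨hF.self_of_nhds.symm.trans h.1, fun a => ih (h.2 a) (pd_eventually_congr a hF)⟩

theorem flat_zero (t : E) : Flat k (fun _ : E => (0 : G)) t := by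
  induction k with
  | zero => exact rfl
  | succ k ih => exact ⟨rfl, fun a => ih.congr (Filter.Eventually.of_forall fun s =>
      (pd_const a (0 : G) s).symm)⟩

theorem Flat.add (h : Flat k F t) (h' : Flat k F' t) (hF : SmoothNear F t)
    (hF' : SmoothNear F' t) : Flat k (fun s => F s + F' s) t := by
  induction k generalizing F F' with
  | zero => exact (congrArg₂ (· + ·) h h').trans (add_zero 0)
  | succ k ih =>
    refine ⟨(congrArg₂ (· + ·) h.1 h'.1).trans (add_zero 0), fun a =>
      (ih (h.2 a) (h'.2 a) (hF.pd a) (hF'.pd a)).congr ?_⟩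
    filter_upwards [hF, hF'] with s hs hs'
    exact (pd_add a (differentiableAt_of_smooth hs) (differentiableAt_of_smooth hs')).symm

theorem Flat.neg (h : Flat k F t) : Flat k (fun s => -F s) t := by
  induction k generalizing F with
  | zero => exact (congrArg (fun x => -x) h).trans neg_zero
  | succ k ih =>
    refine ⟨(congrArg (fun x => -x) h.1).trans neg_zero, fun a => (ih (h.2 a)).congr ?_⟩
    exact Filter.Eventually.of_forall fun s => by
      change -fderiv ℝ F s a = fderiv ℝ (-F) s a
      rw [fderiv_neg]
      rfl

theorem Flat.sub (h : Flat k F t) (h' : Flat k F' t) (hF : SmoothNear F t)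
    (hF' : SmoothNear F' t) : Flat k (fun s => F s - F' s) t :=
  (h.add h'.neg hF hF'.neg).congr (Filter.Eventually.of_forall fun _ => (sub_eq_add_neg _ _).symm)

/-! ### Order of vanishing of scalar products -/

section Lform

variable {n : ℕ} {X Y : E → LVec n}

theorem pd_lform_eventually (a : E) (hX : SmoothNear X t) (hY : SmoothNear Y t) :
    pd a (fun s => lform (X s) (Y s)) =ᶠ[𝓝 t] fun s =>
      lform (pd a X s) (Y s) + lform (X s) (pd a Y s) := by
  filter_upwards [hX, hY] with s hs hs'
  exact pd_lform a (differentiableAt_of_smooth hs) (differentiableAt_of_smooth hs')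

theorem Flat.lform (h : Flat k X t) (hX : SmoothNear X t) (hY : SmoothNear Y t) :
    Flat k (fun s => lform (X s) (Y s)) t := by
  induction k generalizing X Y with
  | zero => exact (congrArg (fun x => DeSitter.lform x (Y t)) h).trans (lform_zero_left _)
  | succ k ih =>
    refine ⟨(congrArg (fun x => DeSitter.lform x (Y t)) h.1).trans (lform_zero_left _), fun a =>
      Flat.congr ?_ (pd_lform_eventually a hX hY).symm⟩
    exact (ih (h.2 a) (hX.pd a) hY).add (ih h.of_succ hX (hY.pd a)) ((hX.pd a).lform hY)
      (hX.lform (hY.pd a))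

/-- A factor that vanishes at t raises the order of vanishing by one; by the product rule this
reduces to order k for derivatives of X. -/
theorem Flat.lform_succ (h : Flat k X t) (hX : SmoothNear X t) (hY : SmoothNear Y t)
    (h0 : Y t = 0) : Flat (k + 1) (fun s => DeSitter.lform (X s) (Y s)) t := by
  induction k generalizing X with
  | zero =>
    refine ⟨(congrArg (DeSitter.lform (X t)) h0).trans (lform_zero_right _), fun a => Flat.congr ?_ (pd_lform_eventually a hX hY).symm⟩
    change DeSitter.lform (DeSitter.pd a X t) (Y t) + DeSitter.lform (X t) _ = 0
    rw [h0, h.eq_zero, lform_zero_right, lform_zero_left, add_zero]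
  | succ k ih =>
    refine ⟨(congrArg (DeSitter.lform (X t)) h0).trans (lform_zero_right _), fun a => Flat.congr ?_ (pd_lform_eventually a hX hY).symm⟩
    exact (ih (h.2 a) (hX.pd a)).add (h.lform hX (hY.pd a)) ((hX.pd a).lform hY)
      (hX.lform (hY.pd a))

end Lform

theorem flat_of_iteratedFDeriv (hF : SmoothNear F t)
    (h : ∀ j ≤ k, iteratedFDeriv ℝ j F t = 0) : Flat k F t := by
  induction k generalizing F with
  | zero =>
    have := h 0 le_rfl
    exact (congrArg (fun L => L 0) this)
  | succ k ih =>
    refine ⟨congrArg (fun L => L 0) (h 0 (Nat.zero_le _)), fun a => ih (hF.pd a) fun j hj => ?_⟩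
    have h1 : iteratedFDeriv ℝ j (fderiv ℝ F) t = 0 := by
      rw [← norm_eq_zero, norm_iteratedFDeriv_fderiv, h (j + 1) (by omega), norm_zero]
    have h2 := (ContinuousLinearMap.apply ℝ G a).iteratedFDeriv_comp_left
      (hF.self.fderiv_right (m := ∞) (by simp)) (i := j) (by exact_mod_cast le_top)
    rw [h1] at h2
    refine Eq.trans h2 ?_
    ext
    simp

/-- The derivative in the direction of a curve along which `F` is flat is flat. -/
theorem flat_pd_of_curve (hF : SmoothNear F t) {γ : ℝ → E} {v : E} {δ : ℝ} (hδ : 0 < δ)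
    (hγ0 : γ 0 = t) (hγ : HasDerivAt γ v 0) (h : ∀ s ∈ Set.Icc 0 δ, Flat k F (γ s)) :
    Flat k (pd v F) t := by
  have base : ∀ F : E → G, SmoothNear F t → (∀ s ∈ Set.Icc 0 δ, F (γ s) = 0) → pd v F t = 0 := by
    intro F hF h
    have h1 : HasDerivAt (fun s => F (γ s)) (pd v F t) 0 := by
      have hd : HasFDerivAt F (fderiv ℝ F t) (γ 0) := by
        rw [hγ0]; exact (differentiableAt_of_smooth hF.self).hasFDerivAt
      exact hd.comp_hasDerivAt 0 hγ
    -- The one-sided derivative at 0 is enough, so half a curve suffices.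
    have h2 : HasDerivWithinAt (fun s => F (γ s)) 0 (Set.Icc 0 δ) 0 :=
      (hasDerivWithinAt_const (0 : ℝ) (Set.Icc 0 δ) (0 : G)).congr h (h 0 ⟨le_rfl, hδ.le⟩)
    exact ((uniqueDiffOn_Icc hδ).uniqueDiffWithinAt ⟨le_rfl, hδ.le⟩).eq_deriv _
      h1.hasDerivWithinAt h2
  induction k generalizing F with
  | zero => exact base F hF h
  | succ k ih =>
    refine ⟨base F hF fun s hs => (h s hs).eq_zero, fun a => ?_⟩
    refine (ih (hF.pd a) fun s hs => (h s hs).2 a).congr ?_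
    filter_upwards [hF] with s hs using pd_comm v a hs

end Flat

/-! ### Contact of the isotropic normals -/

section Contact

variable {m r : ℕ}

namespace LocalFrame

variable {A A' : FrameIdx m r → Par m r → LVec (m + r + 1)} {U : Set (Par m r)}
  (h : LocalFrame A U) {t : Par m r} (ht : t ∈ U)

include h

theorem smoothNear (ht : t ∈ U) (ξ : FrameIdx m r) : SmoothNear (A ξ) t :=
  (h.eventually_mem ht).mono (h.smooth ξ)

theorem mono {U' : Set (Par m r)} (hU' : IsOpen U') (hsub : U' ⊆ U) : LocalFrame A U' :=
  h.congr hU' hsub fun _ _ _ => rfl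

include ht

/-- The generator is the orthogonal complement of `A_0` and its derivatives. -/
theorem mem_generator_iff {w : LVec (m + r + 1)} :
    w ∈ Submodule.span ℝ {A .zero t} ⊔
      Submodule.span ℝ (Set.range fun α => A (normalIdx α) t) ↔
      lform w (A .zero t) = 0 ∧ ∀ u, lform w (pd u (A .zero) t) = 0 := by
  rw [(h.basis t ht).mem_generator_iff (w := w), coeff_top_eq, neg_eq_zero]
  refine and_congr_right fun h0 => ⟨fun hw u => ?_, fun hw p => ?_⟩
  · rw [h.pd_zero ht, lform_add_right, lform_smul_right, h0, lform_finset_sum_right, mul_zero,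
      zero_add]
    refine Finset.sum_eq_zero fun p _ => ?_
    rw [lform_smul_right, (h.basis t ht).lform_tan (h.orthogonal t ht)]
    simp only [hw, zero_mul, Finset.sum_const_zero, mul_zero]
  · refine h.eq_zero_of_lform_tan ht (fun q => ?_) p
    obtain ⟨W, hW⟩ := h.exists_dual ht
    have := hw (W q)
    rw [h.pd_zero ht, lform_add_right, lform_smul_right, h0, mul_zero, zero_add] at this
    simpa [hW, ite_smul] using this

/-- The generator does not depend on the frame. -/
theorem generator_le (h' : LocalFrame A' U)
    (hpt : ∀ t ∈ U, ∃ c : ℝ, A' .pt t = c • A .pt t) :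
    Submodule.span ℝ {A .zero t} ⊔ Submodule.span ℝ (Set.range fun α => A (normalIdx α) t) ≤
      Submodule.span ℝ {A' .zero t} ⊔
        Submodule.span ℝ (Set.range fun α => A' (normalIdx α) t) := by
  intro w hw
  rw [h.mem_generator_iff ht] at hw
  rw [h'.mem_generator_iff ht]
  have hk : ContDiffAt ℝ ∞ (fun s => -lform (A' .zero s) (A .top s)) t :=
    ((h'.smooth .zero t ht).lform (h.smooth .top t ht)).neg
  have hev : A' .zero =ᶠ[𝓝 t] fun s => (-lform (A' .zero s) (A .top s)) • A .zero s :=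
    (h.eventually_mem ht).mono fun s hs => (h.exists_zero_eq_smul h' hpt hs).1
  refine ⟨?_, fun u => ?_⟩
  · rw [(h.exists_zero_eq_smul h' hpt ht).1, lform_smul_right, hw.1, mul_zero]
  · rw [pd_congr u hev, pd_smul u (differentiableAt_of_smooth hk) (h.diff ht .zero),
      lform_add_right, lform_smul_right, lform_smul_right, hw.1, hw.2, mul_zero, mul_zero, add_zero]

/-- A vector function whose products with `N₀`, the point and its derivatives are flat is flat. -/
theorem flat_of_lform {N₀ : LVec (m + r + 1)} (hN : lform (A .zero t) N₀ = -1) {k : ℕ}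
    {X : Par m r → LVec (m + r + 1)} (hX : SmoothNear X t)
    (hXF : Flat k (fun s => lform (X s) (A .pt s)) t)
    (hXd : ∀ a, Flat k (fun s => lform (X s) (pd a (A .pt) s)) t)
    (hXN : Flat k (fun s => lform (X s) N₀) t) : Flat k X t := by
  have base : ∀ X : Par m r → LVec (m + r + 1), lform (X t) (A .pt t) = 0 →
      (∀ a, lform (X t) (pd a (A .pt) t) = 0) → lform (X t) N₀ = 0 → X t = 0 := by
    intro X hF hd hN0
    have hsurj : ∀ w, lform w (A .zero t) = 0 → lform w (A .pt t) = 0 → lform (X t) w = 0 := by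
      intro w h0 hp
      obtain ⟨u, rfl⟩ := h.surj t ht w h0 hp
      exact hd u
    have hb := h.basis t ht
    have h1 := hb.eq_smul_zero
      (hsurj _ hb.zero_zero hb.zero_pt)
      (fun i => hsurj _ ((lform_comm _ _).trans (hb.zero_mid i)) (hb.mid_pt i)) hF
    have h2 : -lform (X t) (A .top t) = 0 := by
      rw [h1, lform_smul_left, hN] at hN0
      linarith
    rw [h1, h2, zero_smul]
  have hsm : SmoothNear (A .pt) t := h.smoothNear ht .pt
  have hcN : SmoothNear (fun _ : Par m r => N₀) t := smoothNear_const N₀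
  induction k generalizing X with
  | zero => exact base X hXF hXd hXN
  | succ k ih =>
    have hk : Flat k X t := ih hX hXF.of_succ (fun a => (hXd a).of_succ) hXN.of_succ
    -- (∂_b X, Y) = ∂_b (X, Y) - (X, ∂_b Y). The first term loses one of its k + 1 orders; the
    -- second vanishes to order k by hypothesis or because X is already flat of order k.
    have key : ∀ (b : Par m r) (Y : Par m r → LVec (m + r + 1)), SmoothNear Y t →
        Flat (k + 1) (fun s => lform (X s) (Y s)) t → Flat k (fun s => lform (X s) (pd b Y s)) t →
        Flat k (fun s => lform (pd b X s) (Y s)) t := by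
      intro b Y hY h1 h2
      refine ((h1.2 b).sub h2 ((hX.lform hY).pd b) (hX.lform (hY.pd b))).congr ?_
      filter_upwards [pd_lform_eventually b hX hY] with s hs
      rw [hs, add_sub_cancel_right]
    refine ⟨hk.eq_zero, fun b => ih (hX.pd b) ?_ (fun a => ?_) ?_⟩
    · exact key b _ hsm hXF (hXd b).of_succ
    · exact key b _ (hsm.pd a) (hXd a) (hk.lform hX ((hsm.pd a).pd b))
    · refine key b _ hcN hXN ?_
      refine (flat_zero t).congr (Filter.Eventually.of_forall fun s => ?_)
      change 0 = lform (X s) (pd b (fun _ => N₀) s)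
      rw [pd_const, lform_zero_right]

end LocalFrame

/-! ### The difference of two isotropic normals -/

section Normals

variable {F F' e₀ e₀' : Par m r → LVec (m + r + 1)} {N₀ : LVec (m + r + 1)}
  {U U' : Set (Par m r)} {t : Par m r}

theorem NullNormal.smoothNear (h : NullNormal F e₀ N₀ U) (ht : t ∈ U) : SmoothNear F t :=
  (h.eventually_mem ht).mono h.smooth

theorem NullNormal.smoothNear_normal (h : NullNormal F e₀ N₀ U) (ht : t ∈ U) :
    SmoothNear e₀ t :=
  (h.eventually_mem ht).mono h.smooth_normal

variable (h : NullNormal F e₀ N₀ U) (h' : NullNormal F' e₀' N₀ U') (ht : t ∈ U) (ht' : t ∈ U')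

include h h' ht ht'

/-- The relations (e₀, F) = 0 and (e₀', F') = 0 transfer the difference from the normals to the
points, so its order of vanishing is inherited from F - F'. -/
theorem NullNormal.lform_sub_pt : (fun s => -lform (F s - F' s) (e₀' s)) =ᶠ[𝓝 t]
    fun s => lform (e₀ s - e₀' s) (F s) := by
  filter_upwards [h.eventually_mem ht, h'.eventually_mem ht'] with s hs hs'
  rw [lform_sub_left, lform_sub_left, h.normal s hs, lform_comm (F' s), h'.normal s hs',
    lform_comm (F s)]
  ring

theorem NullNormal.lform_sub_pd (a : Par m r) :
    (fun s => -lform (pd a (fun x => F x - F' x) s) (e₀' s)) =ᶠ[𝓝 t]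
      fun s => lform (e₀ s - e₀' s) (pd a F s) := by
  filter_upwards [h.eventually_mem ht, h'.eventually_mem ht'] with s hs hs'
  rw [pd_sub a (differentiableAt_of_smooth (h.smooth s hs))
    (differentiableAt_of_smooth (h'.smooth s hs')), lform_sub_left, lform_sub_left,
    h.normal_pd s hs, lform_comm (pd a F' s), h'.normal_pd s hs', lform_comm (pd a F s)]
  ring

theorem NullNormal.flat_lform_pt {k : ℕ} (hG : Flat k (fun s => F s - F' s) t) :
    Flat k (fun s => lform (e₀ s - e₀' s) (F s)) t :=
  ((hG.lform ((h.smoothNear ht).sub (h'.smoothNear ht')) (h'.smoothNear_normal ht')).neg).congr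
    (h.lform_sub_pt h' ht ht')

theorem NullNormal.flat_lform_pd {k : ℕ} {a : Par m r}
    (hG : Flat k (pd a fun s => F s - F' s) t) :
    Flat k (fun s => lform (e₀ s - e₀' s) (pd a F s)) t :=
  ((hG.lform (((h.smoothNear ht).sub (h'.smoothNear ht')).pd a)
    (h'.smoothNear_normal ht')).neg).congr (h.lform_sub_pd h' ht ht' a)

/-- The normal is determined by the point and its first derivatives, so one order of contact is
lost; `flat_sub_generator` recovers it for some components. -/
theorem NullNormal.flat_sub {A : FrameIdx m r → Par m r → LVec (m + r + 1)} {U₁ : Set (Par m r)}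
    (hA : LocalFrame A U₁) (hpt : A .pt = F) (h0 : A .zero = e₀) (ht₁ : t ∈ U₁) {k : ℕ}
    (hG : Flat (k + 1) (fun s => F s - F' s) t) : Flat k (fun s => e₀ s - e₀' s) t := by
  subst hpt h0
  refine hA.flat_of_lform ht₁ (h.normalized t ht)
    ((h.smoothNear_normal ht).sub (h'.smoothNear_normal ht'))
    (h.flat_lform_pt h' ht ht' hG.of_succ) (fun a => h.flat_lform_pd h' ht ht' (hG.2 a)) ?_
  refine (flat_zero t).congr ?_
  filter_upwards [h.eventually_mem ht, h'.eventually_mem ht'] with s hs hs'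
  rw [lform_sub_left, h.normalized s hs, h'.normalized s hs', sub_self]

/-- The components of `e₀ - e₀'` along the generator vanish to one order more. -/
theorem NullNormal.flat_sub_generator {A : FrameIdx m r → Par m r → LVec (m + r + 1)}
    {U₁ : Set (Par m r)} (hA : LocalFrame A U₁) (hpt : A .pt = F) (h0 : A .zero = e₀)
    (ht₁ : t ∈ U₁) {k : ℕ} (hG : Flat (k + 1) (fun s => F s - F' s) t)
    (hK : ∀ v, (∀ p, om A .zero (.mid (.inr p)) v t = 0) →
      Flat (k + 1) (pd v fun s => F s - F' s) t) (α : Option (Fin m)) :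
    Flat (k + 1) (fun s => lform (e₀ s - e₀' s) (A (normalIdx α) t)) t := by
  have hG0 := h.flat_sub h' ht ht' hA hpt h0 ht₁ hG
  have hs0 := (h.smoothNear_normal ht).sub (h'.smoothNear_normal ht')
  -- The variable vector Y may be frozen at t: the error is a product of e₀ - e₀', flat of order k,
  -- with a factor that vanishes at t.
  have key : ∀ Y : Par m r → LVec (m + r + 1), SmoothNear Y t →
      Flat (k + 1) (fun s => lform (e₀ s - e₀' s) (Y s)) t →
      Flat (k + 1) (fun s => lform (e₀ s - e₀' s) (Y t)) t := by
    intro Y hY h1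
    have h2 := hG0.lform_succ hs0 (hY.sub (smoothNear_const (Y t))) (sub_self (Y t))
    refine (h1.sub h2 (hs0.lform hY) (hs0.lform (hY.sub (smoothNear_const (Y t))))).congr
      (Filter.Eventually.of_forall fun s => ?_)
    change lform _ (Y s) - lform _ (Y s - Y t) = _
    rw [lform_sub_right, sub_sub_cancel]
  cases α with
  | none =>
    have := key F (h.smoothNear ht) (h.flat_lform_pt h' ht ht' hG)
    rw [← hpt] at this
    exact this
  | some a =>
    have hb := hA.basis t ht₁
    -- A_a is the derivative of F in a direction tangent to the generator, in which the derivative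
    -- of F - F' keeps the full order of vanishing.
    obtain ⟨v, hv⟩ := hA.surj t ht₁ (A (.mid (.inl a)) t)
      ((lform_comm _ _).trans (hb.zero_mid _)) (hb.mid_pt _)
    have hker : ∀ p, om A .zero (.mid (.inr p)) v t = 0 :=
      hA.om_zero_tan_of_mem_generator ht₁ fun p => by
        rw [om, hv]
        exact (hb.coeff_self (.mid (.inl a)) (.mid (.inr p))).2 (by simp)
    have := key (pd v F) ((h.smoothNear ht).pd v) (h.flat_lform_pd h' ht ht' (hK v hker))
    rw [← hpt, hv] at this
    exact this

end Normals

end Contact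

/-! ### Contact of the screens -/

section ContactScreen

variable {m r : ℕ}

theorem pd_canJet {F e₀ : Par m r → LVec (m + r + 1)} {w : Fin r → Par m r} {t : Par m r}
    (hF : ContDiffAt ℝ ∞ F t) (he : ContDiffAt ℝ ∞ e₀ t) (u : Par m r) :
    pd u (canJet F e₀ w) t = (pd u F t, pd u e₀ t, fun p => pd u (pd (w p) e₀) t) := by
  have h1 : HasFDerivAt (fun s => fun p => pd (w p) e₀ s)
      (ContinuousLinearMap.pi fun p => fderiv ℝ (pd (w p) e₀) t) t :=
    hasFDerivAt_pi.mpr fun p => (differentiableAt_of_smooth (contDiffAt_pd (w p) he)).hasFDerivAt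
  have h2 := (differentiableAt_of_smooth hF).hasFDerivAt.prodMk
    ((differentiableAt_of_smooth he).hasFDerivAt.prodMk h1)
  have h3 : fderiv ℝ (canJet F e₀ w) t = _ := h2.fderiv
  rw [pd, h3]
  rfl

variable {F F' e₀ e₀' : Par m r → LVec (m + r + 1)} {N₀ : LVec (m + r + 1)}
  {U U' : Set (Par m r)} {t : Par m r} {b : Fin m → LVec (m + r + 1)} {w : Fin r → Par m r}

theorem NullNormal.pd_canField (h : NullNormal F e₀ N₀ U) (ht : t ∈ U)
    (hg : (projGram N₀ (F t) (e₀ t) fun p => pd (w p) e₀ t).det ≠ 0) (ξ : FrameIdx m r)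
    (u : Par m r) : pd u (canField b N₀ F e₀ w ξ) t =
      fderiv ℝ (fun J => canFrame b N₀ J ξ) (canJet F e₀ w t)
        (pd u F t, pd u e₀ t, fun p => pd u (pd (w p) e₀) t) := by
  have h1 := fderiv_comp t (g := fun J => canFrame b N₀ J ξ) (f := canJet F e₀ w)
    (differentiableAt_of_smooth (contDiffAt_canFrame (b := b) (J := canJet F e₀ w t) hg ξ))
    (differentiableAt_of_smooth (h.contDiffAt_canJet ht w))
  have h2 : fderiv ℝ (canField b N₀ F e₀ w ξ) t = _ := h1
  rw [pd, h2, ← pd_canJet (h.smooth t ht) (h.smooth_normal t ht)]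
  rfl

/-- The directions `w` are dual to the forms `ω_0^p` of the frame which they define. -/
theorem NullNormal.om_canField (h : NullNormal F e₀ N₀ U)
    (hA : LocalFrame (canField b N₀ F e₀ w) U') (hsub : U' ⊆ U) (ht : t ∈ U') (p q : Fin r) :
    om (canField b N₀ F e₀ w) .zero (.mid (.inr p)) (w q) t = if p = q then 1 else 0 := by
  have h1 : pd (w q) e₀ t = canField b N₀ F e₀ w (.mid (.inr q)) t +
      (-lform (pd (w q) e₀ t) (projTop N₀ (F t) (e₀ t))) • canField b N₀ F e₀ w .zero t := by
    have h2 : canField b N₀ F e₀ w (.mid (.inr q)) t = _ := h.proj_pd (hsub ht) (w q)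
    have h3 : canField b N₀ F e₀ w .zero t = e₀ t := rfl
    rw [h2, h3, neg_smul, add_neg_cancel_right]
  change coeff (fun ζ => canField b N₀ F e₀ w ζ t) (pd (w q) e₀ t) (.mid (.inr p)) = _
  rw [h1, coeff_add, coeff_smul, hA.coeff_self_mid ht, hA.coeff_self_zero ht]
  simp

/-- The directions w are dual to the ω_0^p at all points of the domain, so in this frame λ_{βpq} is
a plain second partial derivative of e₀ paired with A_β, and the identity may be differentiated. -/
theorem NullNormal.lowerIdx_canField (h : NullNormal F e₀ N₀ U)
    (hA : LocalFrame (canField b N₀ F e₀ w) U') (hsub : U' ⊆ U)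
    {Λ : Option (Fin m) → Matrix (Fin r) (Fin r) ℝ} (ht : t ∈ U')
    (hΛ : LamAt (canField b N₀ F e₀ w) t Λ) (β : Option (Fin m)) (p q : Fin r) :
    lowerIdx (norGram fun ζ => canField b N₀ F e₀ w ζ t) Λ β p q =
      lform (pd (w q) (pd (w p) e₀) t) (canField b N₀ F e₀ w (normalIdx β) t) := by
  have h1 := hA.second_form_eq ht hΛ β (w q) (w p)
  simp only [h.om_canField hA hsub ht] at h1
  have h2 : canField b N₀ F e₀ w .zero = e₀ := rfl
  rw [h2] at h1
  rw [h1]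
  simp

/-- Data for which the screens of two hypersurfaces coincide at a point. -/
structure ContactData (b : Fin m → LVec (m + r + 1)) (N₀ : LVec (m + r + 1))
    (F F' e₀ e₀' : Par m r → LVec (m + r + 1)) (w : Fin r → Par m r) (U : Set (Par m r))
    (t : Par m r) : Prop where
  mem : t ∈ U
  normal : NullNormal F e₀ N₀ U
  normal' : NullNormal F' e₀' N₀ U
  frame : LocalFrame (canField b N₀ F e₀ w) U
  frame' : LocalFrame (canField b N₀ F' e₀' w) U
  det_ne : (projGram N₀ (F t) (e₀ t) fun p => pd (w p) e₀ t).det ≠ 0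
  flat : Flat 3 (fun s => F s - F' s) t
  flat_pd : ∀ v, (∀ p, om (canField b N₀ F e₀ w) .zero (.mid (.inr p)) v t = 0) →
    Flat 3 (pd v fun s => F s - F' s) t

theorem eq_of_flat {E G : Type*} [NormedAddCommGroup E] [NormedSpace ℝ E] [NormedAddCommGroup G]
    [NormedSpace ℝ G] {X Y : E → G} {t : E} (h : Flat 1 (fun s => X s - Y s) t)
    (hX : ContDiffAt ℝ ∞ X t) (hY : ContDiffAt ℝ ∞ Y t) :
    X t = Y t ∧ ∀ u, pd u X t = pd u Y t := by
  refine ⟨sub_eq_zero.mp h.1, fun u => sub_eq_zero.mp ?_⟩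
  rw [← pd_sub u (differentiableAt_of_smooth hX) (differentiableAt_of_smooth hY)]
  exact h.2 u

namespace ContactData

variable (h : ContactData b N₀ F F' e₀ e₀' w U t)

include h

theorem flat_normal : Flat 2 (fun s => e₀ s - e₀' s) t :=
  h.normal.flat_sub h.normal' h.mem h.mem h.frame rfl rfl h.mem h.flat

theorem flat_pd_normal (u : Par m r) : Flat 1 (fun s => pd u e₀ s - pd u e₀' s) t := by
  refine (h.flat_normal.2 u).congr ?_
  filter_upwards [h.normal.eventually_mem h.mem] with s hs
  exact pd_sub u (differentiableAt_of_smooth (h.normal.smooth_normal s hs))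
    (differentiableAt_of_smooth (h.normal'.smooth_normal s hs))

theorem pt_eq : F t = F' t ∧ ∀ u, pd u F t = pd u F' t :=
  eq_of_flat h.flat.of_succ.of_succ (h.normal.smooth t h.mem) (h.normal'.smooth t h.mem)

theorem normal_eq : e₀ t = e₀' t ∧ ∀ u, pd u e₀ t = pd u e₀' t :=
  eq_of_flat h.flat_normal.of_succ (h.normal.smooth_normal t h.mem)
    (h.normal'.smooth_normal t h.mem)

theorem pd_pd_normal_eq (u v : Par m r) : pd u (pd v e₀) t = pd u (pd v e₀') t :=
  (eq_of_flat (h.flat_pd_normal v) (contDiffAt_pd v (h.normal.smooth_normal t h.mem))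
    (contDiffAt_pd v (h.normal'.smooth_normal t h.mem))).2 u

theorem canJet_eq : canJet F e₀ w t = canJet F' e₀' w t := by
  simp only [canJet, h.pt_eq.1, h.normal_eq.1, h.normal_eq.2]

theorem canField_eq (ξ : FrameIdx m r) :
    canField b N₀ F e₀ w ξ t = canField b N₀ F' e₀' w ξ t :=
  congrArg (fun J => canFrame b N₀ J ξ) h.canJet_eq

/-- The frame is a fixed function of F, e₀ and first derivatives of e₀, so its first derivatives
contain only second derivatives of e₀, within the available order. -/
theorem pd_canField_eq (ξ : FrameIdx m r) (u : Par m r) :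
    pd u (canField b N₀ F e₀ w ξ) t = pd u (canField b N₀ F' e₀' w ξ) t := by
  have hg := h.det_ne
  have h1 := h.normal.pd_canField (b := b) h.mem hg ξ u
  simp only [h.pt_eq.1, h.normal_eq.1, h.normal_eq.2] at hg
  have h2 := h.normal'.pd_canField (b := b) h.mem hg ξ u
  rw [h1, h2, h.canJet_eq]
  simp only [h.pt_eq.2, h.normal_eq.2, h.pd_pd_normal_eq]

/-- The third derivatives of e₀ and e₀' are not known to agree; their products with A_β do, by the
additional order from `flat_sub_generator`. -/
theorem lform_pd_pd_pd_eq (u v v' : Par m r) (β : Option (Fin m)) :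
    lform (pd u (pd v (pd v' e₀)) t) (canField b N₀ F e₀ w (normalIdx β) t) =
      lform (pd u (pd v (pd v' e₀')) t) (canField b N₀ F e₀ w (normalIdx β) t) := by
  set c := canField b N₀ F e₀ w (normalIdx β) t
  have h1 := h.normal.flat_sub_generator h.normal' h.mem h.mem h.frame rfl rfl h.mem h.flat
    h.flat_pd β
  have hs : SmoothNear (fun s => e₀ s - e₀' s) t :=
    (h.normal.smoothNear_normal h.mem).sub (h.normal'.smoothNear_normal h.mem)
  have key : ∀ (X : Par m r → LVec (m + r + 1)) (a : Par m r), SmoothNear X t →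
      pd a (fun s => lform (X s) c) =ᶠ[𝓝 t] fun s => lform (pd a X s) c := by
    intro X a hX
    filter_upwards [pd_lform_eventually a hX (smoothNear_const c)] with s hs
    rw [hs]
    change _ + lform _ (pd a (fun _ => c) s) = _
    rw [pd_const, lform_zero_right, add_zero]
  have h2 : Flat 2 (fun s => lform (pd v' (fun s => e₀ s - e₀' s) s) c) t :=
    (h1.2 v').congr (key _ v' hs)
  have h3 : Flat 1 (fun s => lform (pd v (pd v' fun s => e₀ s - e₀' s) s) c) t :=
    (h2.2 v).congr (key _ v (hs.pd v'))
  have h4 : lform (pd u (pd v (pd v' fun s => e₀ s - e₀' s)) t) c = 0 :=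
    ((h3.2 u).congr (key _ u ((hs.pd v').pd v)))
  have h5 : (pd v' fun s => e₀ s - e₀' s) =ᶠ[𝓝 t] fun s => pd v' e₀ s - pd v' e₀' s := by
    filter_upwards [h.normal.eventually_mem h.mem] with s hs
    exact pd_sub v' (differentiableAt_of_smooth (h.normal.smooth_normal s hs))
      (differentiableAt_of_smooth (h.normal'.smooth_normal s hs))
  have h6 : (pd v fun s => pd v' e₀ s - pd v' e₀' s) =ᶠ[𝓝 t]
      fun s => pd v (pd v' e₀) s - pd v (pd v' e₀') s := by
    filter_upwards [h.normal.eventually_mem h.mem] with s hs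
    exact pd_sub v (differentiableAt_of_smooth (contDiffAt_pd v' (h.normal.smooth_normal s hs)))
      (differentiableAt_of_smooth (contDiffAt_pd v' (h.normal'.smooth_normal s hs)))
  have hd := fun (e : Par m r → LVec (m + r + 1)) (he : ContDiffAt ℝ ∞ e t) =>
    differentiableAt_of_smooth (contDiffAt_pd v (contDiffAt_pd v' he))
  rw [pd_congr u ((pd_eventually_congr v h5).trans h6),
    pd_sub u (hd _ (h.normal.smooth_normal t h.mem)) (hd _ (h.normal'.smooth_normal t h.mem)),
    lform_sub_left] at h4
  exact sub_eq_zero.mp h4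

variable {ρ : ℕ} {Λ Λ' : Par m r → Option (Fin m) → Matrix (Fin r) (Fin r) ℝ}
  (hS : LocalScreen ρ (canField b N₀ F e₀ w) U Λ)
  (hS' : LocalScreen ρ (canField b N₀ F' e₀' w) U Λ')

include hS hS'

theorem frameTriple_eq : frameTriple (canField b N₀ F e₀ w) Λ t =
    frameTriple (canField b N₀ F' e₀' w) Λ' t := by
  have h1 : ∀ β p q, lowerIdx (norGram fun ζ => canField b N₀ F e₀ w ζ t) (Λ t) β p q =
      lowerIdx (norGram fun ζ => canField b N₀ F' e₀' w ζ t) (Λ' t) β p q := by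
    intro β p q
    rw [h.normal.lowerIdx_canField h.frame subset_rfl h.mem (hS.lam t h.mem),
      h.normal'.lowerIdx_canField h.frame' subset_rfl h.mem (hS'.lam t h.mem),
      h.pd_pd_normal_eq, h.canField_eq]
  simp only [frameTriple, h1]
  simp only [norGram, tanGram, h.canField_eq]

/-- The derivative of (∂∂e₀, A_β) contains the third derivatives of e₀ only in the product with A_β,
which is covered by `lform_pd_pd_pd_eq`. -/
theorem pd_frameTriple_eq (u : Par m r) : pd u (frameTriple (canField b N₀ F e₀ w) Λ) t =
    pd u (frameTriple (canField b N₀ F' e₀' w) Λ') t := by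
  have hl : ∀ ξ η, pd u (fun s => lform (canField b N₀ F e₀ w ξ s) (canField b N₀ F e₀ w η s)) t =
      pd u (fun s => lform (canField b N₀ F' e₀' w ξ s) (canField b N₀ F' e₀' w η s)) t := by
    intro ξ η
    rw [pd_lform u (h.frame.diff h.mem ξ) (h.frame.diff h.mem η),
      pd_lform u (h.frame'.diff h.mem ξ) (h.frame'.diff h.mem η), h.canField_eq, h.canField_eq,
      h.pd_canField_eq, h.pd_canField_eq]
  have h1 : ∀ β p q, pd u (fun s => lowerIdx (norGram fun ζ => canField b N₀ F e₀ w ζ s) (Λ s)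
      β p q) t = pd u (fun s => lowerIdx (norGram fun ζ => canField b N₀ F' e₀' w ζ s) (Λ' s)
      β p q) t := by
    intro β p q
    have e1 : (fun s => lowerIdx (norGram fun ζ => canField b N₀ F e₀ w ζ s) (Λ s) β p q)
        =ᶠ[𝓝 t] fun s => lform (pd (w q) (pd (w p) e₀) s)
          (canField b N₀ F e₀ w (normalIdx β) s) := by
      filter_upwards [h.normal.eventually_mem h.mem] with s hs
      exact h.normal.lowerIdx_canField h.frame subset_rfl hs (hS.lam s hs) β p q
    have e2 : (fun s => lowerIdx (norGram fun ζ => canField b N₀ F' e₀' w ζ s) (Λ' s) β p q)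
        =ᶠ[𝓝 t] fun s => lform (pd (w q) (pd (w p) e₀') s)
          (canField b N₀ F' e₀' w (normalIdx β) s) := by
      filter_upwards [h.normal.eventually_mem h.mem] with s hs
      exact h.normal'.lowerIdx_canField h.frame' subset_rfl hs (hS'.lam s hs) β p q
    have hd := fun (e : Par m r → LVec (m + r + 1)) (he : ContDiffAt ℝ ∞ e t) =>
      differentiableAt_of_smooth (contDiffAt_pd (w q) (contDiffAt_pd (w p) he))
    rw [pd_congr u e1, pd_congr u e2,
      pd_lform u (hd _ (h.normal.smooth_normal t h.mem)) (h.frame.diff h.mem _),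
      pd_lform u (hd _ (h.normal'.smooth_normal t h.mem)) (h.frame'.diff h.mem _),
      h.lform_pd_pd_pd_eq, h.pd_pd_normal_eq, h.pd_canField_eq, h.canField_eq]
  rw [hS.pd_frameTriple h.mem, hS'.pd_frameTriple h.mem]
  simp only [h1]
  simp only [norGram, tanGram, Matrix.of_apply, hl]

theorem locInv_eq : locInv ρ (canField b N₀ F e₀ w) Λ t =
    locInv ρ (canField b N₀ F' e₀' w) Λ' t := by
  rw [LocalScreen.locInv_eq (h.frame.basis t h.mem), LocalScreen.locInv_eq (h.frame'.basis t h.mem),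
    h.frameTriple_eq hS hS']

/-- The normalizing subspaces are defined by the third-order neighborhood of the generator. -/
theorem pd_normZero_eq (u : Par m r) : pd u (normZero ρ (canField b N₀ F e₀ w) Λ) t =
    pd u (normZero ρ (canField b N₀ F' e₀' w) Λ') t := by
  have hc : (fun ζ => canField b N₀ F e₀ w ζ t) = fun ζ => canField b N₀ F' e₀' w ζ t :=
    funext fun ζ => h.canField_eq ζ
  have hom : ∀ η, om (canField b N₀ F e₀ w) .zero η u t =
      om (canField b N₀ F' e₀' w) .zero η u t := by
    intro η
    rw [om, om, hc, h.pd_canField_eq]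
  have hpl : pd u (locInv ρ (canField b N₀ F e₀ w) Λ) t =
      pd u (locInv ρ (canField b N₀ F' e₀' w) Λ') t := by
    rw [hS.pd_locInv h.mem, hS'.pd_locInv h.mem, h.frameTriple_eq hS hS',
      h.pd_frameTriple_eq hS hS']
  rw [hS.pd_normZero h.mem, hS'.pd_normZero h.mem, theta, theta, hpl, h.locInv_eq hS hS']
  simp only [hom, h.canField_eq]

end ContactData

end ContactScreen

/-! ### Screens from local parametrizations -/

section Parametrizations

variable {m r : ℕ} {N : Type*} [TopologicalSpace N]
  [ChartedSpace (EuclideanSpace ℝ (Fin (m + r + 1))) N] {f : N → ℙ ℝ (LVec (m + r + 1))}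

/-- `F` is a smooth immersive unit representation of the lightlike hypersurface `f` in the
coordinates `Φ`. -/
structure ParamOn (f : N → ℙ ℝ (LVec (m + r + 1))) (Φ : Coords m r N)
    (F : Par m r → LVec (m + r + 1)) (U : Set (Par m r)) : Prop where
  isOpen : IsOpen U
  subset : U ⊆ Φ.source
  smooth : ∀ s ∈ U, ContDiffAt ℝ ∞ F s
  unit : ∀ s ∈ U, lform (F s) (F s) = 1
  lift : ∀ s ∈ U, (f (Φ s)).submodule = Submodule.span ℝ {F s}
  inj : ∀ s ∈ U, ∀ u, pd u F s = 0 → u = 0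
  exists_normal : ∀ s ∈ U, ∃ y : LVec (m + r + 1), y ≠ 0 ∧ lform y y = 0 ∧ lform y (F s) = 0 ∧
    ∀ u, lform y (pd u F s) = 0

theorem pd_const_smul {E G : Type*} [NormedAddCommGroup E] [NormedSpace ℝ E]
    [NormedAddCommGroup G] [NormedSpace ℝ G] {F : E → G} {t : E} (c : ℝ) (u : E)
    (hF : DifferentiableAt ℝ F t) : pd u (fun s => c • F s) t = c • pd u F t := by
  rw [pd_smul u (differentiableAt_const c) hF, pd_const, zero_smul, zero_add]

theorem IsLightlikeHypersurface.exists_paramOn (hf : IsLightlikeHypersurface f) (Φ : Coords m r N)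
    {t : Par m r} (ht : t ∈ Φ.source) : ∃ F U, t ∈ U ∧ ParamOn f Φ F U := by
  obtain ⟨U, F, h1, h2, h3, h4, h5, h6, h7, h8⟩ := hf.exists_lift Φ ht
  exact ⟨F, U, h2, h1, h3, h4, h5, h6, h7, h8⟩

/-- A continuous unit representation is a smooth immersive one. -/
theorem IsLightlikeHypersurface.paramOn_of_eventually (hf : IsLightlikeHypersurface f)
    (Φ : Coords m r N) {t : Par m r} (ht : t ∈ Φ.source) {F : Par m r → LVec (m + r + 1)}
    (hF : ContinuousAt F t)
    (hl : ∀ᶠ s in 𝓝 t, lform (F s) (F s) = 1 ∧ (f (Φ s)).submodule = Submodule.span ℝ {F s}) :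
    ∃ U, t ∈ U ∧ ParamOn f Φ F U := by
  obtain ⟨F₁, U₁, ht₁, h₁⟩ := hf.exists_paramOn Φ ht
  have hev : ∀ᶠ s in 𝓝 t, F s = lform (F s) (F₁ s) • F₁ s ∧
      lform (F s) (F₁ s) * lform (F s) (F₁ s) = 1 := by
    filter_upwards [hl, h₁.isOpen.mem_nhds ht₁] with s hs hs₁
    obtain ⟨c, hc⟩ := exists_smul_of_span_eq (h₁.lift s hs₁) hs.2
    have h2 : lform (F s) (F₁ s) = c := by
      rw [hc, lform_smul_left, h₁.unit s hs₁, mul_one]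
    rw [h2]
    refine ⟨hc, ?_⟩
    have := hs.1
    rwa [hc, lform_smul_left, lform_smul_right, h₁.unit s hs₁, mul_one] at this
  have hcont : ContinuousAt (fun s => lform (F s) (F₁ s)) t := by
    have h2 := (h₁.smooth t ht₁).continuousAt
    have h3 : ContinuousAt (fun s => lformCLM (m + r + 1) (F s) (F₁ s)) t :=
      ((lformCLM (m + r + 1)).continuous.continuousAt.comp hF).clm_apply h2
    exact h3
  -- The proportionality factor to the smooth representation is continuous and squares to 1, so it
  -- is a constant ±1 near t.
  set c := lform (F t) (F₁ t) with hc
  have hc1 : c * c = 1 := hev.self_of_nhds.2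
  have hc0 : c ≠ 0 := fun h => by rw [h] at hc1; norm_num at hc1
  have hnear : ∀ᶠ s in 𝓝 t, F s = c • F₁ s := by
    have hpos : ∀ᶠ s in 𝓝 t, 0 < lform (F s) (F₁ s) * c := by
      have : ContinuousAt (fun s => lform (F s) (F₁ s) * c) t := hcont.mul continuousAt_const
      exact this.eventually (lt_mem_nhds (zero_lt_one.trans_eq hc1.symm))
    filter_upwards [hev, hpos] with s hs hs'
    have h2 : lform (F s) (F₁ s) = c := by
      rcases mul_self_eq_mul_self_iff.mp (hs.2.trans hc1.symm) with h | h
      · exact h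
      · rw [h] at hs'
        linarith
    rw [h2] at hs
    exact hs.1
  obtain ⟨U, hU, hUo, htU⟩ := mem_nhds_iff.mp
    (Filter.inter_mem (Filter.inter_mem hnear hl) (h₁.isOpen.mem_nhds ht₁))
  have hF : ∀ s ∈ U, F =ᶠ[𝓝 s] fun x => c • F₁ x := fun s hs =>
    Filter.mem_of_superset (hUo.mem_nhds hs) fun x hx => (hU hx).1.1
  have hpd : ∀ s ∈ U, ∀ u, pd u F s = c • pd u F₁ s := fun s hs u => by
    rw [pd_congr u (hF s hs),
      pd_const_smul c u (differentiableAt_of_smooth (h₁.smooth s (hU hs).2))]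
  refine ⟨U, htU, hUo, fun s hs => h₁.subset (hU hs).2, fun s hs => ?_, fun s hs => (hU hs).1.2.1,
    fun s hs => (hU hs).1.2.2, fun s hs u hu => ?_, fun s hs => ?_⟩
  · exact (contDiffAt_const.fun_smul (h₁.smooth s (hU hs).2)).congr_of_eventuallyEq (hF s hs)
  · rw [hpd s hs] at hu
    exact h₁.inj s (hU hs).2 u ((smul_eq_zero.mp hu).resolve_left hc0)
  · obtain ⟨y, hy, hyy, hyF, hyd⟩ := h₁.exists_normal s (hU hs).2
    refine ⟨y, hy, hyy, ?_, fun u => ?_⟩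
    · rw [(hF s hs).self_of_nhds, lform_smul_right, hyF, mul_zero]
    · rw [hpd s hs, lform_smul_right, hyd, mul_zero]

theorem ParamOn.reducedOn (hr : HasReducedRank m r f) {Φ : Coords m r N}
    {F : Par m r → LVec (m + r + 1)} {U : Set (Par m r)} (h : ParamOn f Φ F U)
    {U' : Set (Par m r)} (hU' : U' ⊆ U) : ReducedOn F U' := by
  intro A V hV hA hpt t ht ν hν
  refine hr.rank_nu hA (fun s hs => h.subset (hU' (hV hs))) (fun s hs => ?_) ht hν
  rw [hpt s hs]
  exact h.lift s (hU' (hV hs))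

/-- The screen in a form without μ, as the span of x and the derivatives of the normalized isotropic
vector; this is the form in which contact compares two hypersurfaces. -/
theorem LocalFrame.isScreenAt [IsManifold (𝓡 (m + r + 1)) ∞ N]
    (hf : IsLightlikeHypersurface f) (hr : HasReducedRank m r f) {ρ : ℕ} (hρ : ρ ≠ 0)
    (hM : HasMatrixRank ρ f) {A : FrameIdx m r → Par m r → LVec (m + r + 1)} {U : Set (Par m r)}
    (hA : LocalFrame A U) {Φ : Coords m r N} (hU : U ⊆ Φ.source)
    (hl : ∀ t ∈ U, (f (Φ t)).submodule = Submodule.span ℝ {A .pt t}) {t : Par m r} (ht : t ∈ U) :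
    ∃ Λ, LocalScreen ρ A U Λ ∧ IsScreenAt ρ f (Φ t) (Submodule.span ℝ {A .pt t} ⊔
      Submodule.span ℝ (Set.range fun u => pd u (normZero ρ A Λ) t)) := by
  have hB := hA.isAdaptedFrame hU hl
  obtain ⟨Λ, μ, hc, -⟩ := hB.exists_construction hf hr hρ hM
  have hmem : ∀ s ∈ U, s ∈ Φ.source ∩ Φ ⁻¹' (Φ.target ∩ Φ.symm ⁻¹' U) := fun s hs =>
    ⟨hU hs, (mem_push hU).mpr ⟨s, hs, rfl⟩⟩
  have hS := hB.pull_localScreen hf hr hρ hM hc.lambda Φ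
  have hfun : ∀ s ∈ U, (fun ζ => pull (push A Φ) Φ ζ s) = fun ζ => A ζ s := fun s hs =>
    funext fun ζ => pull_push A Φ (hU hs) ζ
  have hinv : ∀ s ∈ U, locInv ρ (pull (push A Φ) Φ) (fun x => Λ (Φ x)) s =
      locInv ρ A (fun x => Λ (Φ x)) s := fun s hs => by
    rw [locInv, locInv, hfun s hs]
  have hLS : LocalScreen ρ A U fun s => Λ (Φ s) := by
    refine ⟨hA, fun s hs => ?_, fun s hs => ?_, hρ⟩
    · have := hS.lam s (hmem s hs)
      simp only [LamAt, om_pull_push (hU hs)] at this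
      exact this
    · rw [← hinv s hs]
      exact hS.pos s (hmem s hs)
  refine ⟨fun s => Λ (Φ s), hLS, _, push A Φ, Λ, μ, (hmem t ht).2, hc, ?_⟩
  have hθ : ∀ u, theta ρ A (fun s => Λ (Φ s)) u t =
      ∑ p, μ (Φ t) p * om A .zero (.mid (.inr p)) u t := by
    intro u
    have h1 := hc.theta_eq hf hr hρ hM Φ (hmem t ht) u
    have h2 : locInv ρ (pull (push A Φ) Φ) (fun x => Λ (Φ x)) =ᶠ[𝓝 t]
        locInv ρ A fun x => Λ (Φ x) := (hA.eventually_mem ht).mono hinv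
    simp only [theta, om_pull_push (hU ht), pd_congr u h2, hinv t ht] at h1
    exact h1
  rw [← hLS.span_pd_normZero ht hθ]
  have h3 : ∀ ξ, push A Φ ξ (Φ t) = A ξ t := fun ξ => pull_push A Φ (hU ht) ξ
  simp only [screenPlane, normSubspace, normPt, h3]

theorem exists_lform_ne_zero {n : ℕ} {y : LVec n} (hy : y ≠ 0) : ∃ N₀, lform y N₀ ≠ 0 := by
  by_contra! hcon
  exact hy (lform_nondegenerate hcon)

theorem NullNormal.mono {F e₀ : Par m r → LVec (m + r + 1)} {N₀ : LVec (m + r + 1)}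
    {U U' : Set (Par m r)} (h : NullNormal F e₀ N₀ U) (hU' : IsOpen U') (hsub : U' ⊆ U) :
    NullNormal F e₀ N₀ U' :=
  ⟨hU', fun t ht => h.smooth t (hsub ht), fun t ht => h.unit t (hsub ht),
    fun t ht => h.inj t (hsub ht), fun t ht => h.smooth_normal t (hsub ht),
    fun t ht => h.null t (hsub ht), fun t ht => h.normal t (hsub ht),
    fun t ht => h.normal_pd t (hsub ht), fun t ht => h.normalized t (hsub ht)⟩

theorem ParamOn.exists_nullNormal {Φ : Coords m r N} {F : Par m r → LVec (m + r + 1)}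
    {U : Set (Par m r)} (h : ParamOn f Φ F U) {t : Par m r} (ht : t ∈ U)
    {N₀ x : LVec (m + r + 1)} (hxF : lform x (F t) = 0) (hxd : ∀ u, lform x (pd u F t) = 0)
    (hxN : lform x N₀ ≠ 0) : ∃ e₀ U', t ∈ U' ∧ U' ⊆ U ∧ NullNormal F e₀ N₀ U' :=
  DeSitter.exists_nullNormal h.isOpen h.smooth h.unit h.inj h.exists_normal ht hxF hxd hxN

/-- There is a screen at every point. -/
theorem IsLightlikeHypersurface.exists_isScreenAt [IsManifold (𝓡 (m + r + 1)) ∞ N]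
    (hf : IsLightlikeHypersurface f) (hr : HasReducedRank m r f) {ρ : ℕ} (hρ : ρ ≠ 0)
    (hM : HasMatrixRank ρ f) (q : N) : ∃ S, IsScreenAt ρ f q S := by
  obtain ⟨Φ, t, ht, rfl⟩ := exists_coords (m := m) (r := r) q
  obtain ⟨F, U, htU, hF⟩ := hf.exists_paramOn Φ ht
  obtain ⟨y, hy, -, hyF, hyd⟩ := hF.exists_normal t htU
  obtain ⟨N₀, hN₀⟩ := exists_lform_ne_zero hy
  obtain ⟨e₀, U₁, ht₁, hU₁, hn⟩ := hF.exists_nullNormal htU hyF hyd hN₀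
  have hred := hF.reducedOn hr hU₁
  obtain ⟨b, w, hg, hb⟩ := hn.exists_data hred ht₁
  obtain ⟨U₂, ht₂, hU₂, hA⟩ := hn.exists_localFrame ht₁ hred hg hb
  obtain ⟨Λ, -, hS⟩ := hA.isScreenAt hf hr hρ hM
    (fun s hs => hF.subset (hU₁ (hU₂ hs))) (fun s hs => hF.lift s (hU₁ (hU₂ hs))) ht₂
  exact ⟨_, hS⟩

theorem isScreenAt_unique [IsManifold (𝓡 (m + r + 1)) ∞ N]
    (hf : IsLightlikeHypersurface f) (hr : HasReducedRank m r f) {ρ : ℕ} (hρ : ρ ≠ 0)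
    (hM : HasMatrixRank ρ f) {q : N} {S S' : Submodule ℝ (LVec (m + r + 1))}
    (hS : IsScreenAt ρ f q S) (hS' : IsScreenAt ρ f q S') : S' = S := by
  obtain ⟨W, A, Λ, μ, hq, hc, rfl⟩ := hS
  obtain ⟨W', A', Λ', μ', hq', hc', rfl⟩ := hS'
  exact hc.screenPlane_unique hf hr hρ hM hc' hq hq'

end Parametrizations

/-! ### Motions -/

section Motions

variable {m r : ℕ} {N : Type*} [TopologicalSpace N]
  [ChartedSpace (EuclideanSpace ℝ (Fin (m + r + 1))) N] {f : N → ℙ ℝ (LVec (m + r + 1))}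

theorem moved_submodule {n : ℕ} {N : Type*} [TopologicalSpace N]
    [ChartedSpace (EuclideanSpace ℝ (Fin n)) N] (T : LVec n ≃ₗ[ℝ] LVec n) (f : N → ℙ ℝ (LVec n))
    (q : N) : (moved T f q).submodule = (f q).submodule.map T.toLinearMap := by
  rw [moved]
  induction f q using Projectivization.ind with
  | h v hv =>
    rw [Projectivization.map_mk, Projectivization.submodule_mk, Projectivization.submodule_mk,
      Submodule.map_span, Set.image_singleton]

/-- The rank hypotheses quantify over all frames of a hypersurface; they pass to the image by
carrying its frames back with the inverse motion. -/
theorem moved_symm_moved {n : ℕ} {N : Type*} [TopologicalSpace N]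
    [ChartedSpace (EuclideanSpace ℝ (Fin n)) N] (T : LVec n ≃ₗ[ℝ] LVec n) (f : N → ℙ ℝ (LVec n)) :
    moved T.symm (moved T f) = f := by
  funext q
  apply Projectivization.submodule_injective
  rw [moved_submodule, moved_submodule, ← Submodule.map_comp]
  simp

variable {T : LVec (m + r + 1) ≃ₗ[ℝ] LVec (m + r + 1)} (hT : IsMotion T)

theorem IsMotion.symm {n : ℕ} {T : LVec n ≃ₗ[ℝ] LVec n} (hT : IsMotion T) : IsMotion T.symm := by
  intro x y
  rw [← hT, T.apply_symm_apply, T.apply_symm_apply]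

theorem dAt_map {n : ℕ} {N : Type*} [TopologicalSpace N]
    [ChartedSpace (EuclideanSpace ℝ (Fin n)) N] (T : LVec n ≃ₗ[ℝ] LVec n) {F : N → LVec n} {q : N}
    (hF : MDifferentiableAt (𝓡 n) 𝓘(ℝ, LVec n) F q) (v : TangentSpace (𝓡 n) q) :
    dAt (n := n) (fun x => T (F x)) q v = T (dAt (n := n) F q v) := by
  have h1 : HasMFDerivAt 𝓘(ℝ, LVec n) 𝓘(ℝ, LVec n) T (F q)
      (T.toContinuousLinearEquiv : LVec n →L[ℝ] LVec n) :=
    (T.toContinuousLinearEquiv : LVec n →L[ℝ] LVec n).hasFDerivAt.hasMFDerivAt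
  have h2 := (h1.comp q hF.hasMFDerivAt).mfderiv
  have h3 : mfderiv (𝓡 n) 𝓘(ℝ, LVec n) (fun x => T (F x)) q = _ := h2
  rw [dAt, h3]
  rfl

theorem contMDiffOn_map {n : ℕ} {N : Type*} [TopologicalSpace N]
    [ChartedSpace (EuclideanSpace ℝ (Fin n)) N] (T : LVec n ≃ₗ[ℝ] LVec n) {F : N → LVec n}
    {W : Set N} (hF : ContMDiffOn (𝓡 n) 𝓘(ℝ, LVec n) ∞ F W) :
    ContMDiffOn (𝓡 n) 𝓘(ℝ, LVec n) ∞ (fun x => T (F x)) W :=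
  (T.toContinuousLinearEquiv : LVec n →L[ℝ] LVec n).contDiff.contMDiff.comp_contMDiffOn hF

theorem mdifferentiableAt_of_contMDiffOn {n : ℕ} {N : Type*} [TopologicalSpace N]
    [ChartedSpace (EuclideanSpace ℝ (Fin n)) N] {F : N → LVec n} {W : Set N} (hW : IsOpen W)
    (hF : ContMDiffOn (𝓡 n) 𝓘(ℝ, LVec n) ∞ F W) {q : N} (hq : q ∈ W) :
    MDifferentiableAt (𝓡 n) 𝓘(ℝ, LVec n) F q :=
  (hF.contMDiffAt (hW.mem_nhds hq)).mdifferentiableAt (by simp)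

/-- The image of a moving frame. -/
def mapFrame (T : LVec (m + r + 1) ≃ₗ[ℝ] LVec (m + r + 1))
    (A : FrameIdx m r → N → LVec (m + r + 1)) : FrameIdx m r → N → LVec (m + r + 1) :=
  fun ξ q => T (A ξ q)

theorem IsLightlikeHypersurface.moved {n : ℕ} {N : Type*} [TopologicalSpace N]
    [ChartedSpace (EuclideanSpace ℝ (Fin n)) N] {f : N → ℙ ℝ (LVec n)} {T : LVec n ≃ₗ[ℝ] LVec n}
    (hT : IsMotion T) (hf : IsLightlikeHypersurface f) :
    IsLightlikeHypersurface (DeSitter.moved T f) := by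
  intro p
  obtain ⟨W, F, hW, hp, hF, h⟩ := hf p
  refine ⟨W, fun q => T (F q), hW, hp, ⟨contMDiffOn_map T hF.smooth, fun q hq => ?_,
    fun q hq => ?_⟩, fun q hq => ?_⟩
  · rw [hT, hF.unit q hq]
  · rw [moved_submodule, hF.lift q hq, Submodule.map_span, Set.image_singleton]
    rfl
  · have hd := dAt_map T (mdifferentiableAt_of_contMDiffOn hW hF.smooth hq)
    obtain ⟨hinj, y, hy, hyy, hyw⟩ := h q hq
    refine ⟨fun u v huv => hinj (T.injective ?_), T y, by simpa using hy, by rw [hT, hyy],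
      fun w hw => ?_⟩
    · rw [← hd, ← hd]
      exact huv
    · have hle : tangentHyperplane (n := n) (fun x => T (F x)) q ≤
          (tangentHyperplane (n := n) F q).map T.toLinearMap := by
        refine sup_le ?_ ?_
        · rw [Submodule.span_singleton_le_iff_mem]
          exact ⟨F q, Submodule.mem_sup_left (Submodule.mem_span_singleton_self _), rfl⟩
        · rintro _ ⟨v, rfl⟩
          exact ⟨dAt (n := n) F q v, Submodule.mem_sup_right ⟨v, rfl⟩, (hd v).symm⟩
      obtain ⟨w', hw', rfl⟩ := hle hw
      exact (hT y w').trans (hyw w' hw')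

include hT

theorem gram_map (e : FrameIdx m r → LVec (m + r + 1)) : gram (fun ξ => T (e ξ)) = gram e := by
  ext i j
  exact hT _ _

theorem coeff_map (e : FrameIdx m r → LVec (m + r + 1)) (w : LVec (m + r + 1))
    (ξ : FrameIdx m r) : coeff (fun ξ => T (e ξ)) (T w) ξ = coeff e w ξ := by
  cases ξ <;> simp only [coeff, hT _ _, gram_map hT]

theorem IsConformalBasis.map {e : FrameIdx m r → LVec (m + r + 1)} (he : IsConformalBasis e) :
    IsConformalBasis fun ξ => T (e ξ) where
  zero_zero := (hT _ _).trans he.zero_zero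
  zero_mid i := (hT _ _).trans (he.zero_mid i)
  zero_pt := (hT _ _).trans he.zero_pt
  zero_top := (hT _ _).trans he.zero_top
  mid_pt i := (hT _ _).trans (he.mid_pt i)
  mid_top i := (hT _ _).trans (he.mid_top i)
  pt_pt := (hT _ _).trans he.pt_pt
  pt_top := (hT _ _).trans he.pt_top
  top_top := (hT _ _).trans he.top_top
  posDef := by rw [gram_map hT]; exact he.posDef

variable {W : Set N} {A : FrameIdx m r → N → LVec (m + r + 1)}

theorem omega_map {q : N} {ξ : FrameIdx m r}
    (hA : MDifferentiableAt (𝓡 (m + r + 1)) 𝓘(ℝ, LVec (m + r + 1)) (A ξ) q) (η : FrameIdx m r)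
    (v : TangentSpace (𝓡 (m + r + 1)) q) : omega (mapFrame T A) q ξ η v = omega A q ξ η v := by
  have h1 : dAt (n := m + r + 1) (mapFrame T A ξ) q v = T (dAt (n := m + r + 1) (A ξ) q v) :=
    dAt_map T hA v
  rw [omega, h1]
  exact coeff_map hT _ _ _

theorem IsLightlikeFrame.omega_map (hA : IsLightlikeFrame f W A) {q : N} (hq : q ∈ W)
    (ξ η : FrameIdx m r) (v : TangentSpace (𝓡 (m + r + 1)) q) :
    omega (mapFrame T A) q ξ η v = omega A q ξ η v :=
  DeSitter.omega_map hT (mdifferentiableAt_of_contMDiffOn hA.isOpen (hA.smooth ξ) hq) η v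

theorem IsLightlikeFrame.map (hA : IsLightlikeFrame f W A) :
    IsLightlikeFrame (moved T f) W (mapFrame T A) where
  isOpen := hA.isOpen
  smooth ξ := contMDiffOn_map T (hA.smooth ξ)
  basis q hq := (hA.basis q hq).map hT
  lift q hq := by
    rw [moved_submodule, hA.lift q hq, Submodule.map_span, Set.image_singleton]
    rfl
  tangent q hq v := by rw [hA.omega_map hT hq, hA.tangent q hq]

theorem IsAdaptedFrame.map (hA : IsAdaptedFrame f W A) :
    IsAdaptedFrame (moved T f) W (mapFrame T A) where
  toIsLightlikeFrame := hA.toIsLightlikeFrame.map hT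
  orthogonal q hq a p := (hT _ _).trans (hA.orthogonal q hq a p)
  kernel q hq a v := by rw [hA.omega_map hT hq, hA.kernel q hq]

theorem HasReducedRank.moved (hr : HasReducedRank m r f) :
    HasReducedRank m r (DeSitter.moved T f) := by
  intro W A hA q hq ν hν
  have hB := hA.map hT.symm
  rw [moved_symm_moved] at hB
  refine hr W _ hB q hq ν fun i v => ?_
  simp only [hA.omega_map hT.symm hq]
  exact hν i v

theorem HasMatrixRank.moved {ρ : ℕ} (hM : HasMatrixRank ρ f) :
    HasMatrixRank ρ (DeSitter.moved T f) := by
  intro W A hA q hq Λ hΛ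
  have hB := hA.map hT.symm
  rw [moved_symm_moved] at hB
  have h1 : gTan (mapFrame T.symm A) q = gTan A q := by
    ext p s
    exact hT.symm _ _
  rw [← h1]
  refine hM W _ hB q hq Λ fun α p v => ?_
  simp only [hA.omega_map hT.symm hq]
  exact hΛ α p v

/-- The screens are invariant under motions. -/
theorem IsScreenAt.moved {ρ : ℕ} {q : N} {S : Submodule ℝ (LVec (m + r + 1))}
    (h : IsScreenAt ρ f q S) : IsScreenAt ρ (DeSitter.moved T f) q (S.map T.toLinearMap) := by
  obtain ⟨W, A, Λ, μ, hq, hc, rfl⟩ := h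
  have hinv : relInv ρ (mapFrame T A) Λ = relInv ρ A Λ := by
    funext x
    have h1 : gTan (mapFrame T A) x = gTan A x := by
      ext p s
      exact hT _ _
    have h2 : gNor (mapFrame T A) x = gNor A x := by
      ext p s
      exact hT _ _
    rw [relInv, relInv, h1, h2]
  refine ⟨W, mapFrame T A, Λ, μ, hq, ⟨hc.frame.map hT, fun x hx α p v => ?_, fun x hx v => ?_⟩, ?_⟩
  · simp only [hc.frame.omega_map hT hx]
    exact hc.lambda x hx α p v
  · simp only [hc.frame.omega_map hT hx, hinv]
    exact hc.mu x hx v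
  · rw [screenPlane, screenPlane, Submodule.map_sup, normSubspace, normSubspace, Submodule.map_span,
      Submodule.map_span, Set.image_singleton, ← Set.range_comp]
    congr 3
    funext p
    simp [normPt, mapFrame]

end Motions

/-! ### Hypersurfaces in contact along a generator -/

section ContactAlongGenerator

variable {m r : ℕ}

theorem flat_sub_of_iteratedFDeriv_eq {E G : Type*} [NormedAddCommGroup E] [NormedSpace ℝ E]
    [NormedAddCommGroup G] [NormedSpace ℝ G] {F F' : E → G} {t : E} {k : ℕ}
    (hF : SmoothNear F t) (hF' : SmoothNear F' t)
    (h : ∀ j ≤ k, iteratedFDeriv ℝ j F t = iteratedFDeriv ℝ j F' t) :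
    Flat k (fun s => F s - F' s) t := by
  refine flat_of_iteratedFDeriv (hF.sub hF') fun j hj => ?_
  have h1 := iteratedFDeriv_sub_apply (hF.self.of_le (m := j) (by exact_mod_cast le_top))
    (hF'.self.of_le (m := j) (by exact_mod_cast le_top))
  rw [h j hj, sub_self] at h1
  exact h1

/-- Two parametrizations which have contact of third order along a generator determine
`ContactData`. -/
theorem exists_contactData {F F' : Par m r → LVec (m + r + 1)} {U U' : Set (Par m r)}
    {t : Par m r} {N N' : Type*} [TopologicalSpace N]
    [ChartedSpace (EuclideanSpace ℝ (Fin (m + r + 1))) N] [TopologicalSpace N']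
    [ChartedSpace (EuclideanSpace ℝ (Fin (m + r + 1))) N'] {f : N → ℙ ℝ (LVec (m + r + 1))}
    {f' : N' → ℙ ℝ (LVec (m + r + 1))} {Φ : Coords m r N} {Φ' : Coords m r N'}
    (hr : HasReducedRank m r f) (hr' : HasReducedRank m r f')
    (hF : ParamOn f Φ F U) (hF' : ParamOn f' Φ' F' U') (ht : t ∈ U) (ht' : t ∈ U')
    {B : FrameIdx m r → Par m r → LVec (m + r + 1)} {V : Set (Par m r)} (hB : LocalFrame B V)
    (htV : t ∈ V) (hBF : ∀ s ∈ V, ∃ c : ℝ, F s = c • B .pt s)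
    (hcon : ∀ᶠ s in 𝓝 t, F s ∈ Submodule.span ℝ {B .zero t} ⊔
      Submodule.span ℝ (Set.range fun α => B (normalIdx α) t) →
      Flat 3 (fun x => F x - F' x) s) :
    ∃ b N₀ e₀ e₀' w U₀, U₀ ⊆ U ∩ U' ∧ ContactData b N₀ F F' e₀ e₀' w U₀ t := by
  -- The point t itself belongs to its generator.
  have hflat : Flat 3 (fun s => F s - F' s) t := by
    refine hcon.self_of_nhds ?_
    obtain ⟨c, hc⟩ := hBF t htV
    rw [hc]
    exact Submodule.smul_mem _ _ (Submodule.mem_sup_right (Submodule.subset_span ⟨none, rfl⟩))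
  obtain ⟨h0, hpd⟩ := eq_of_flat hflat.of_succ.of_succ (hF.smooth t ht) (hF'.smooth t ht')
  obtain ⟨y, hy, -, hyF, hyd⟩ := hF.exists_normal t ht
  obtain ⟨N₀, hN₀⟩ := exists_lform_ne_zero hy
  obtain ⟨e₀, U₁, ht₁, hU₁, hn⟩ := hF.exists_nullNormal ht hyF hyd hN₀
  -- The first derivatives agree at t, so y is also normal to F', and the same N₀ normalizes both
  -- isotropic vectors.
  simp only [h0, hpd] at hyF hyd
  obtain ⟨e₀', U₁', ht₁', hU₁', hn'⟩ := hF'.exists_nullNormal ht' hyF hyd hN₀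
  have hred := hF.reducedOn hr hU₁
  obtain ⟨b, w, hg, hb⟩ := hn.exists_data hred ht₁
  obtain ⟨U₂, ht₂, hU₂, hA⟩ := hn.exists_localFrame ht₁ hred hg hb
  obtain ⟨he, hpe⟩ := eq_of_flat (hn.flat_sub hn' ht₁ ht₁' hA rfl rfl ht₂ hflat).of_succ
    (hn.smooth_normal t ht₁) (hn'.smooth_normal t ht₁')
  -- The data of the two frames coincide at t, so the b and w chosen for F define an adapted frame
  -- for F' as well.
  have hJ : canJet F e₀ w t = canJet F' e₀' w t := by simp only [canJet, h0, he, hpe]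
  have hg' := hg
  simp only [h0, he, hpe] at hg'
  have hb' : (gram fun ξ => canField b N₀ F' e₀' w ξ t).det ≠ 0 := by
    have h1 : (fun ξ => canField b N₀ F' e₀' w ξ t) = fun ξ => canField b N₀ F e₀ w ξ t :=
      funext fun ξ => congrArg (fun J => canFrame b N₀ J ξ) hJ.symm
    rw [h1]
    exact hb
  obtain ⟨U₂', ht₂', hU₂', hA'⟩ := hn'.exists_localFrame ht₁' (hF'.reducedOn hr' hU₁') hg' hb'
  have hmem : t ∈ U₂ ∩ U₂' := ⟨ht₂, ht₂'⟩
  have ho : IsOpen (U₂ ∩ U₂') := hA.isOpen.inter hA'.isOpen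
  refine ⟨b, N₀, e₀, e₀', w, U₂ ∩ U₂', fun s hs => ⟨hU₁ (hU₂ hs.1), hU₁' (hU₂' hs.2)⟩, hmem,
    hn.mono ho fun s hs => hU₂ hs.1, hn'.mono ho fun s hs => hU₂' hs.2,
    hA.mono ho Set.inter_subset_left, hA'.mono ho Set.inter_subset_right, hg, hflat,
    fun v hv => ?_⟩
  have hoV : IsOpen (U₂ ∩ V) := hA.isOpen.inter hB.isOpen
  -- The curve below stays in the generator of the constructed frame, whereas contact is assumed
  -- along the generator of the given frame B.
  have hgen := (hA.mono hoV Set.inter_subset_left).generator_le ⟨ht₂, htV⟩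
    (hB.mono hoV Set.inter_subset_right) fun s hs => by
      obtain ⟨c, hc⟩ := hBF s hs.2
      have hF0 : F s ≠ 0 := fun h => by
        have := hF.unit s (hU₁ (hU₂ hs.1))
        rw [h, lform_zero_left] at this
        norm_num at this
      have hc0 : c ≠ 0 := fun h => hF0 (by rw [hc, h, zero_smul])
      refine ⟨c⁻¹, ?_⟩
      change B .pt s = c⁻¹ • F s
      rw [hc, smul_smul, inv_mul_cancel₀ hc0, one_smul]
  obtain ⟨γ, hγ0, hγ, δ, hδ, hγL⟩ := hA.exists_curve ht₂
    (fun s hs p q => hn.om_canField hA hU₂ hs p q) hv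
  rw [← span_genIdx fun ξ => canField b N₀ F e₀ w ξ t] at hγL
  have hev : ∀ᶠ s in 𝓝 (0 : ℝ), F (γ s) ∈ Submodule.span ℝ {B .zero t} ⊔
      Submodule.span ℝ (Set.range fun α => B (normalIdx α) t) →
      Flat 3 (fun x => F x - F' x) (γ s) :=
    hγ.continuousAt.eventually (by rw [hγ0]; exact hcon)
  obtain ⟨ε, hε, hball⟩ := Metric.eventually_nhds_iff.mp hev
  -- The parameter interval is shortened so that the curve lies both in the generator and in the
  -- neighborhood where contact holds.
  refine flat_pd_of_curve ((hn.smoothNear ht₁).sub (hn'.smoothNear ht₁'))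
    (half_pos (lt_min hδ hε)) hγ0 hγ fun s hs => ?_
  have hpos : 0 < min δ ε := lt_min hδ hε
  have h1 := min_le_left δ ε
  have h2 := min_le_right δ ε
  refine hball ?_ (hgen (hγL s ⟨hs.1, by linarith [hs.2]⟩))
  rw [Real.dist_eq, sub_zero, abs_of_nonneg hs.1]
  linarith [hs.2]

/-- Hypersurfaces with contact of third order along a generator have the same screen. -/
theorem HaveContactAlongGenerator.exists_isScreenAt {N N' : Type*} [TopologicalSpace N]
    [ChartedSpace (EuclideanSpace ℝ (Fin (m + r + 1))) N] [IsManifold (𝓡 (m + r + 1)) ∞ N]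
    [TopologicalSpace N'] [ChartedSpace (EuclideanSpace ℝ (Fin (m + r + 1))) N']
    [IsManifold (𝓡 (m + r + 1)) ∞ N'] {f : N → ℙ ℝ (LVec (m + r + 1))}
    {f' : N' → ℙ ℝ (LVec (m + r + 1))} {ρ : ℕ} (hρ : ρ ≠ 0)
    (hf : IsLightlikeHypersurface f) (hr : HasReducedRank m r f) (hM : HasMatrixRank ρ f)
    (hf' : IsLightlikeHypersurface f') (hr' : HasReducedRank m r f') (hM' : HasMatrixRank ρ f')
    {p : N} {p' : N'} (h : HaveContactAlongGenerator 3 f p f' p') :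
    ∃ S, IsScreenAt ρ f p S ∧ IsScreenAt ρ f' p' S := by
  obtain ⟨F, F', ⟨hF, ψ, ⟨Φ, h0, hψΦ⟩, hψ, hl⟩, ⟨hF', ψ', ⟨Φ', h0', hψΦ'⟩, hψ', hl'⟩, L,
    ⟨W, B, hpW, hB, rfl⟩, hcon⟩ := h
  have hl₁ : ∀ᶠ s in 𝓝 (0 : Par m r), lform (F s) (F s) = 1 ∧
      (f (Φ s)).submodule = Submodule.span ℝ {F s} := by
    filter_upwards [hl, Φ.open_source.mem_nhds h0] with s hs hs0
    rw [← hψΦ hs0]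
    exact hs
  have hl₁' : ∀ᶠ s in 𝓝 (0 : Par m r), lform (F' s) (F' s) = 1 ∧
      (f' (Φ' s)).submodule = Submodule.span ℝ {F' s} := by
    filter_upwards [hl', Φ'.open_source.mem_nhds h0'] with s hs hs0
    rw [← hψΦ' hs0]
    exact hs
  have hp : Φ (0 : Par m r) = p := (hψΦ h0).symm.trans hψ
  have hp' : Φ' (0 : Par m r) = p' := (hψΦ' h0').symm.trans hψ'
  subst hp hp'
  obtain ⟨U, h0U, hP⟩ := hf.paramOn_of_eventually Φ h0 hF.continuousAt hl₁
  obtain ⟨U', h0U', hP'⟩ := hf'.paramOn_of_eventually Φ' h0' hF'.continuousAt hl₁'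
  have hBl := hB.localFrame hf hr Φ
  have hV : IsOpen (U ∩ (Φ.source ∩ Φ ⁻¹' W)) := hP.isOpen.inter hBl.isOpen
  have hcon' : ∀ᶠ s in 𝓝 (0 : Par m r), F s ∈ Submodule.span ℝ {pull B Φ .zero 0} ⊔
      Submodule.span ℝ (Set.range fun α => pull B Φ (normalIdx α) 0) →
      Flat 3 (fun x => F x - F' x) s := by
    filter_upwards [hcon, hP.isOpen.mem_nhds h0U, hP'.isOpen.mem_nhds h0U'] with s hs hsU hsU' hsL
    exact flat_sub_of_iteratedFDeriv_eq
      (Filter.mem_of_superset (hP.isOpen.mem_nhds hsU) hP.smooth)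
      (Filter.mem_of_superset (hP'.isOpen.mem_nhds hsU') hP'.smooth) (hs hsL)
  obtain ⟨b, N₀, e₀, e₀', w, U₀, hU₀, hd⟩ := exists_contactData hr hr' hP hP' h0U h0U'
    (hBl.mono hV Set.inter_subset_right) ⟨h0U, h0, hpW⟩
    (fun s hs => exists_smul_of_span_eq (hB.lift _ hs.2.2) (hP.lift s hs.1)) hcon'
  obtain ⟨Λ, hΛ, hS⟩ := hd.frame.isScreenAt hf hr hρ hM (fun s hs => hP.subset (hU₀ hs).1)
    (fun s hs => hP.lift s (hU₀ hs).1) hd.mem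
  obtain ⟨Λ', hΛ', hS'⟩ := hd.frame'.isScreenAt hf' hr' hρ hM' (fun s hs => hP'.subset (hU₀ hs).2)
    (fun s hs => hP'.lift s (hU₀ hs).2) hd.mem
  refine ⟨_, hS, ?_⟩
  simp only [hd.canField_eq, hd.pd_normZero_eq hΛ hΛ']
  exact hS'

end ContactAlongGenerator

end

end DeSitter

theorem theorem10 {m r ρ : ℕ} (hm : 1 ≤ m) (hρ : ρ ≠ 0)
    {N : Type*} [TopologicalSpace N] [ChartedSpace (EuclideanSpace ℝ (Fin (m + r + 1))) N]
    [IsManifold (𝓡 (m + r + 1)) ∞ N]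
    (f : N → ℙ ℝ (LVec (m + r + 1)))
    (hf : IsLightlikeHypersurface f) (hr : HasReducedRank m r f) (hA : HasMatrixRank ρ f) :
    ∃ Δ : N → Submodule ℝ (LVec (m + r + 1)),
      -- the construction yields exactly one plane at each point, whatever the adapted frame
      (∀ p S, IsScreenAt ρ f p S ↔ S = Δ p) ∧
      -- it can be carried out, smoothly, in every adapted frame
      (∀ (W : Set N) (A : FrameIdx m r → N → LVec (m + r + 1)), IsAdaptedFrame f W A →
        ∃ (Λ : N → Option (Fin m) → Matrix (Fin r) (Fin r) ℝ) (μ : N → Fin r → ℝ),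
          IsScreenConstruction ρ f W A Λ μ ∧
          (∀ α p s, ContMDiffOn (𝓡 (m + r + 1)) 𝓘(ℝ, ℝ) ∞ (fun q => Λ q α p s) W) ∧
          (∀ p, ContMDiffOn (𝓡 (m + r + 1)) 𝓘(ℝ, ℝ) ∞ (fun q => μ q p) W) ∧
          ∀ q ∈ W,
            (∀ α, (Λ q α).IsSymm) ∧ relInv ρ A Λ q ≠ 0 ∧
            -- the screen at `q` is an `r`-plane of the tangent hyperplane through the point `A_n`
            Δ q = screenPlane A μ q ∧ Module.finrank ℝ (Δ q) = r + 1 ∧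
            Δ q ≤ tangentHyperplane (n := m + r + 1) (A .pt) q ∧
            -- it is complementary to the generator
            Δ q ⊓ generator A q = Submodule.span ℝ {A .pt q} ∧
            Δ q ⊔ generator A q = tangentHyperplane (n := m + r + 1) (A .pt) q ∧
            -- the same for the corresponding distribution of directions on `N`
            Module.finrank ℝ ((Δ q).comap (dAt (n := m + r + 1) (A .pt) q)) = r ∧
            IsCompl ((Δ q).comap (dAt (n := m + r + 1) (A .pt) q)) ((generator A q).comap (dAt (n := m + r + 1) (A .pt) q)) ∧
            -- the normalizing subspace does not change along the generator
            ∀ v : TangentSpace (𝓡 (m + r + 1)) q, dAt (n := m + r + 1) (A .pt) q v ∈ generator A q →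
              ∀ p, dAt (n := m + r + 1) (normPt A μ p) q v ∈ normSubspace A μ q) ∧
      -- it is invariant under motions and depends only on the third-order neighborhood of the
      -- plane generator
      (∀ {N' : Type*} [TopologicalSpace N'] [ChartedSpace (EuclideanSpace ℝ (Fin (m + r + 1))) N']
        [IsManifold (𝓡 (m + r + 1)) ∞ N'] (f' : N' → ℙ ℝ (LVec (m + r + 1))),
        IsLightlikeHypersurface f' → HasReducedRank m r f' → HasMatrixRank ρ f' →
        ∀ T : LVec (m + r + 1) ≃ₗ[ℝ] LVec (m + r + 1), IsMotion T →
        ∀ (p : N) (p' : N'), HaveContactAlongGenerator 3 (moved T f) p f' p' →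
        IsScreenAt ρ f' p' ((Δ p).map T.toLinearMap)) := by
  choose Δ hΔ using hf.exists_isScreenAt hr hρ hA
  have huniq : ∀ p S, IsScreenAt ρ f p S → S = Δ p := fun p S hS =>
    isScreenAt_unique hf hr hρ hA (hΔ p) hS
  refine ⟨Δ, fun p S => ⟨huniq p S, fun h => h ▸ hΔ p⟩, fun W A hfr => ?_, ?_⟩
  · obtain ⟨Λ, μ, hc, hΛ, hμ, h⟩ := hfr.exists_construction hf hr hρ hA
    refine ⟨Λ, μ, hc, hΛ, hμ, fun q hq => ?_⟩
    have hq' : Δ q = screenPlane A μ q := (huniq q _ ⟨W, A, Λ, μ, hq, hc, rfl⟩).symm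
    obtain ⟨h1, h2, h3⟩ := h q hq
    rw [hq']
    exact ⟨h1, h2, rfl, h3⟩
  · intro N' _ _ _ f' hf' hr' hA' T hT p p' hcon
    -- Contact yields a common screen of the moved hypersurface and of f'; uniqueness for the moved
    -- hypersurface identifies it with the image of Δ under T.
    obtain ⟨S, hS, hS'⟩ := hcon.exists_isScreenAt hρ (hf.moved hT) (hr.moved hT) (hA.moved hT)
      hf' hr' hA'
    rw [isScreenAt_unique (hf.moved hT) (hr.moved hT) hρ (hA.moved hT) hS ((hΔ p).moved hT)]
    exact hS'
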